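/- Let $L>0$, $\nu>0$, $\Omega=[0,L]^2$. Let $H$ be the closure in $L^2(\Omega)^2$ of the set of $\mathbb{R}^2$-valued trigonometric polynomials $v$ of period $L$ in each variable with $\nabla\cdot v=0$ and $\int_\Omega v\,dx=0$, with norm $|u|=\big(\int_\Omega |u(x)|^2dx\big)^{1/2}$. Let $\mathcal{P}$ be the orthogonal projection of $L^2(\Omega)^2$ onto $H$, let $A=-\mathcal{P}\Delta$ be the Stokes operator with periodic boundary conditions, with domain $\mathcal{D}(A)=\{u\in H:\Delta u\in L^2(\Omega)^2\}$ (where $\Delta u$ is the periodic distributional Laplacian), and let $B(u,v)=\mathcal{P}((u\cdot\nabla)v)$. For $g\in H$ consider the two-dimensional Navier-Stokes equation $$\frac{du}{dt}+\nu Au+B(u,u)=g$$ in $H$. A solution for all $t\in\mathbb{R}$ is a function $u:\mathbb{R}\to H$, differentiable in the norm of $H$, with $u(t)\in\mathcal{D}(A)$ that satisfies the equation at every $t\in\mathbb{R}$. The global attractor $\mathcal{A}$ is the set of all $u_0\in H$ for which there is a solution $u$ for all $t\in\mathbb{R}$ with $u(0)=u_0$ and $\sup_{t\in\mathbb{R}}|u(t)|<\infty$.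 If $0\in\mathcal{A}$, then $\mathcal{A}\cup\{g\}\subset C^\infty([0,L]^2)$; that is, $g$ and every element of $\mathcal{A}$ agree almost everywhere on $\Omega$ with an $\mathbb{R}^2$-valued $C^\infty$ function on $\mathbb{R}^2$ that is $L$-periodic in each variable. -/

import Mathlib

open MeasureTheory Set
open scoped ContDiff

noncomputable section

namespace NSE2D

/-- The plane with its Euclidean norm; both positions `x` and velocities `u(x)` live here. -/
abbrev Plane : Type := EuclideanSpace ℝ (Fin 2)

/-- The `i`-th standard basis vector of the plane. -/
def basisVec (i : Fin 2) : Plane := EuclideanSpace.single i 1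

/-- The spatial domain `Ω = [0, L]²`. -/
def box (L : ℝ) : Set Plane := {x | ∀ i, x i ∈ Icc 0 L}

/-- `f` is `L`-periodic in each of the two coordinate directions. -/
def IsPeriodic (L : ℝ) (f : Plane → Plane) : Prop :=
  ∀ i, Function.Periodic f (L • basisVec i)

/-- The real Hilbert space `L²(Ω)²` with `(u, v) = ∫_Ω u(x) · v(x) dx`. -/
abbrev L2 (L : ℝ) : Type := Lp Plane 2 (volume.restrict (box L))

/-- The partial derivative `∂f/∂x_i` of a differentiable vector field. -/
def partialDeriv (i : Fin 2) (f : Plane → Plane) (x : Plane) : Plane :=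
  fderiv ℝ f x (basisVec i)

/-- The divergence `∂f₀/∂x₀ + ∂f₁/∂x₁` of a differentiable vector field. -/
def divergence (f : Plane → Plane) (x : Plane) : ℝ :=
  ∑ i, partialDeriv i f x i

/-- The phase `κ₀ k · x`, where `κ₀ = 2π / L`. -/
def phase (L : ℝ) (k : Fin 2 → ℤ) (x : Plane) : ℝ :=
  2 * Real.pi / L * ∑ i, (k i : ℝ) * x i

/-- `ℝ²`-valued trigonometric polynomials of period `L`. -/
def IsTrigPoly (L : ℝ) (f : Plane → Plane) : Prop :=
  ∃ (s : Finset (Fin 2 → ℤ)) (a b : (Fin 2 → ℤ) → Plane), ∀ x,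
    f x = ∑ k ∈ s, (Real.cos (phase L k x) • a k + Real.sin (phase L k x) • b k)

/-- The classes in `L²(Ω)²` of the divergence-free trigonometric polynomials of mean zero. -/
def solenoidalTrigPolys (L : ℝ) : Set (L2 L) :=
  {v | ∃ f : Plane → Plane, IsTrigPoly L f ∧ (∀ x, divergence f x = 0) ∧
    ∫ x in box L, f x = 0 ∧ v =ᵐ[volume.restrict (box L)] f}

/-- The phase space `H`: the closure in `L²(Ω)²` of the divergence-free trigonometric
polynomials of mean zero. (These already form a linear subspace; `span` only bundles it.) -/
def H (L : ℝ) : Submodule ℝ (L2 L) :=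
  (Submodule.span ℝ (solenoidalTrigPolys L)).topologicalClosure

instance (L : ℝ) : CompleteSpace (H L) :=
  inferInstanceAs
    (CompleteSpace (Submodule.span ℝ (solenoidalTrigPolys L)).topologicalClosure)

/-- The Helmholtz-Leray projection: the orthogonal projection of `L²(Ω)²` onto `H`. -/
def leray (L : ℝ) : L2 L →L[ℝ] H L := (H L).orthogonalProjectionOnto

/-- `ℓ ∈ L²(Ω)²` is the Laplacian of `u`, with periodic boundary conditions, in the sense of
distributions: `∫_Ω u · Δφ = ∫_Ω ℓ · φ` for all smooth periodic vector fields `φ`. -/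
def IsWeakLaplacian (L : ℝ) (u l : L2 L) : Prop :=
  ∀ φ : Plane → Plane, ContDiff ℝ ∞ φ → IsPeriodic L φ →
    ∫ x in box L, inner ℝ (u x) (Laplacian.laplacian φ x) =
      ∫ x in box L, inner ℝ (l x) (φ x)

/-- `w ∈ L²(Ω)²` is the partial derivative `∂v/∂x_i`, with periodic boundary conditions, in the
sense of distributions: `∫_Ω v · ∂φ/∂x_i = - ∫_Ω w · φ` for all smooth periodic fields `φ`. -/
def IsWeakPartial (L : ℝ) (i : Fin 2) (v w : L2 L) : Prop :=
  ∀ φ : Plane → Plane, ContDiff ℝ ∞ φ → IsPeriodic L φ →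
    ∫ x in box L, inner ℝ (v x) (partialDeriv i φ x) =
      -∫ x in box L, inner ℝ (w x) (φ x)

/-- The graph of the Stokes operator `A = -PΔ`: `u ∈ D(A)` and `A u = f`. Here `D(A)` consists of
those `u ∈ H` whose (periodic, distributional) Laplacian belongs to `L²(Ω)²`. -/
def IsStokes (L : ℝ) (u f : H L) : Prop :=
  ∃ l : L2 L, IsWeakLaplacian L u l ∧ f = -leray L l

/-- The graph of the bilinear operator `B(u, v) = P((u · ∇)v)`: the field
`(u · ∇)v = u₀ ∂v/∂x₀ + u₁ ∂v/∂x₁` is defined and belongs to `L²(Ω)²`, and `b` is its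
projection to `H`. This is the case for all `u` and `v` in the domain of the Stokes operator. -/
def IsBilin (L : ℝ) (u v b : H L) : Prop :=
  ∃ (D : Fin 2 → L2 L) (h : L2 L), (∀ i, IsWeakPartial L i v (D i)) ∧
    (∀ᵐ x ∂(volume.restrict (box L)), h x = ∑ i, (u : L2 L) x i • D i x) ∧
    b = leray L h

/-- `u : ℝ → H` is a solution for all times of the Navier-Stokes equation
`du/dt + ν A u + B(u, u) = g` in `H`: at every time `t`, `u(t) ∈ D(A)` and the equation holds,
`du/dt` being the derivative in the norm of `H` (so that `u` is continuous). -/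
def IsSolution (L ν : ℝ) (g : H L) (u : ℝ → H L) : Prop :=
  ∀ t : ℝ, ∃ a b : H L, IsStokes L (u t) a ∧ IsBilin L (u t) (u t) b ∧
    HasDerivAt u (g - ν • a - b) t

/-- The global attractor: all `u₀ ∈ H` through which there passes, at time `0`, a solution
`u(t)` defined for all `t ∈ ℝ` with `sup_t |u(t)| < ∞`. -/
def attractor (L ν : ℝ) (g : H L) : Set (H L) :=
  {u₀ | ∃ u : ℝ → H L, IsSolution L ν g u ∧ u 0 = u₀ ∧ ∃ C : ℝ, ∀ t, ‖u t‖ ≤ C}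

/-- The elements of `H` that are `C^∞`, i.e. that agree almost everywhere on `Ω` with an
`Ω`-periodic `C^∞` vector field on the plane. -/
def smoothFields (L : ℝ) : Set (H L) :=
  {v | ∃ f : Plane → Plane, ContDiff ℝ ∞ f ∧ IsPeriodic L f ∧
    (v : L2 L) =ᵐ[volume.restrict (box L)] f}

end NSE2D

end

/-! If a trajectory passes through `0` at time `0`, then there `A u` and `B(u, u)` vanish and the
equation reads `du/dt = g`. So `g` is the velocity of a trajectory, and the velocity is smoother
than the force: it solves the equation differentiated in time, `w' + ν A w + B(w, u) + B(u, w) = 0`,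
in which the constant `g` no longer appears. Feeding this back into itself shows that `g` has every
order of smoothness. With a smooth force every trajectory defined on all of `ℝ` is smooth, and this
covers the attractor.

Everything is done on Fourier coefficients. A solenoidal field of mean zero is a scalar sequence
along the unit vectors `perp k`, and smoothness is measured by pointwise decay `|c k| ≤ C * wt k ^
(-p)`, locally uniform in time (`Decays`). Each coefficient solves a scalar damped equation with
rate `μ |k|²`. Running it for one unit of time makes the initial value negligible and gains two
powers of decay over the forcing (`decay_of_ode`). The nonlinearity costs one power, and
convolutions of decaying sequences are controlled by `conv_decay`. Under a force of rate `b` this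
gives rate `b + 2` for the solution (`IsFlow.decays_of_force`) and, for `b ≥ 1`, rate `b + 1` for
the velocity (`IsFlow.velocity_decays_succ`). The induction in `IsFlow.force_decays` starts with
`IsFlow.velocity_decays_one`, where the force is only square summable.

The bootstrap needs a first estimate that is uniform on bounded time intervals, whereas a solution
is only known to lie in `D(A)` at each separate time. This is `IsFlow.h1_bounded`, the
two-dimensional enstrophy estimate: the trilinear term is bounded by a Fourier form of
Ladyzhenskaya's inequality, and Gronwall's inequality takes its integrating factor from the energy
inequality. Because the time derivative exists only in `H`, the enstrophy is truncated by the
bounded multipliers `cut N`.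

The translation between fields and sequences is `IsSolution.exists_isFlow` in one direction and
`mem_smoothFields` in the other. -/

noncomputable section

open scoped ComplexConjugate BoundedContinuousFunction

namespace NSE2D

/-! ### Weights on the frequency lattice and decay of convolutions -/

/-- Frequencies of `L`-periodic fields. -/
abbrev Freq : Type := Fin 2 → ℤ

/-- A frequency regarded as a vector of the plane. -/
def freqVec (k : Freq) : Plane := !₂[(k 0 : ℝ), (k 1 : ℝ)]

/-- The weight `max 1 |k|`. -/
def wt (k : Freq) : ℝ := max 1 ‖freqVec k‖

lemma freqVec_add (k l : Freq) : freqVec (k + l) = freqVec k + freqVec l := by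
  ext i; fin_cases i <;> simp [freqVec]

lemma freqVec_sub (k l : Freq) : freqVec (k - l) = freqVec k - freqVec l := by
  ext i; fin_cases i <;> simp [freqVec]

lemma freqVec_neg (k : Freq) : freqVec (-k) = -freqVec k := by
  ext i; fin_cases i <;> simp [freqVec]

lemma freqVec_zero : freqVec 0 = 0 := by
  ext i; fin_cases i <;> simp [freqVec]

lemma norm_sq_freqVec (k : Freq) : ‖freqVec k‖ ^ 2 = (k 0 : ℝ) ^ 2 + (k 1 : ℝ) ^ 2 := by
  simp [EuclideanSpace.norm_sq_eq, freqVec]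

lemma one_le_wt (k : Freq) : 1 ≤ wt k := le_max_left _ _

lemma wt_pos (k : Freq) : 0 < wt k := lt_of_lt_of_le one_pos (one_le_wt k)

lemma norm_freqVec_le_wt (k : Freq) : ‖freqVec k‖ ≤ wt k := le_max_right _ _

lemma one_le_norm_freqVec {k : Freq} (hk : k ≠ 0) : 1 ≤ ‖freqVec k‖ := by
  have h : (1 : ℝ) ≤ ‖freqVec k‖ ^ 2 := by
    rw [norm_sq_freqVec]
    have : (1 : ℤ) ≤ k 0 ^ 2 + k 1 ^ 2 := by
      by_contra! hc
      apply hk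
      have h0 : k 0 = 0 := by nlinarith [sq_nonneg (k 0), sq_nonneg (k 1)]
      have h1 : k 1 = 0 := by nlinarith [sq_nonneg (k 0), sq_nonneg (k 1)]
      ext i; fin_cases i <;> simp [h0, h1]
    exact_mod_cast this
  nlinarith [norm_nonneg (freqVec k)]

lemma wt_eq {k : Freq} (hk : k ≠ 0) : wt k = ‖freqVec k‖ := max_eq_right (one_le_norm_freqVec hk)

lemma wt_add_le (k l : Freq) : wt (k + l) ≤ wt k + wt l := by
  refine max_le (by linarith [one_le_wt k, one_le_wt l]) ?_
  rw [freqVec_add]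
  exact (norm_add_le _ _).trans (add_le_add (norm_freqVec_le_wt k) (norm_freqVec_le_wt l))

lemma abs_coord_le_wt (k : Freq) (i : Fin 2) : |(k i : ℝ)| ≤ wt k := by
  have := norm_freqVec_le_wt k
  have h2 := norm_sq_freqVec k
  refine le_trans ?_ this
  apply abs_le_of_sq_le_sq _ (norm_nonneg _)
  rw [h2]; fin_cases i <;> simp <;> positivity

/-- Comparison with the lattice sum over sup norms, which are dominated by `wt` coordinatewise. The
origin, where the comparison fails, is a single term. The threshold is the dimension of the lattice.
-/
lemma summable_wt_rpow {p : ℝ} (hp : 2 < p) : Summable fun k : Freq => wt k ^ (-p) := by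
  refine Summable.of_norm_bounded_eventually
    (EisensteinSeries.summable_one_div_norm_rpow hp) ?_
  have : {k : Freq | k ≠ 0} ∈ Filter.cofinite := by
    simp [Filter.mem_cofinite]
  filter_upwards [this] with k hk
  have hk' : 0 < ‖k‖ := norm_pos_iff.mpr hk
  rw [Real.norm_of_nonneg (Real.rpow_nonneg (wt_pos k).le _)]
  refine Real.rpow_le_rpow_of_nonpos hk' ?_ (by linarith)
  rw [pi_norm_le_iff_of_nonneg (wt_pos k).le]
  intro i
  simpa [Int.norm_eq_abs] using abs_coord_le_wt k i

lemma wt_rpow_le_one (k : Freq) {p : ℝ} (hp : 0 ≤ p) : wt k ^ (-p) ≤ 1 :=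
  Real.rpow_le_one_of_one_le_of_nonpos (one_le_wt k) (by linarith)

lemma wt_rpow_pos (k : Freq) (p : ℝ) : 0 < wt k ^ p := Real.rpow_pos_of_pos (wt_pos k) p

lemma wt_rpow_mono (k : Freq) {p q : ℝ} (h : p ≤ q) : wt k ^ p ≤ wt k ^ q :=
  Real.rpow_le_rpow_of_exponent_le (one_le_wt k) h

/-- Products of decaying factors decay at the sum of the rates in one of the two variables. -/
lemma wt_rpow_mul_le (k l : Freq) {p q : ℝ} (hp : 0 ≤ p) (hq : 0 ≤ q) :
    wt k ^ (-p) * wt l ^ (-q) ≤ wt k ^ (-(p + q)) + wt l ^ (-(p + q)) := by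
  have e (m : Freq) : wt m ^ (-(p + q)) = wt m ^ (-p) * wt m ^ (-q) := by
    rw [← Real.rpow_add (wt_pos m)]; ring_nf
  rcases le_total (wt k) (wt l) with h | h
  · have h1 : wt l ^ (-q) ≤ wt k ^ (-q) := Real.rpow_le_rpow_of_nonpos (wt_pos k) h (by linarith)
    have := mul_le_mul_of_nonneg_left h1 (wt_rpow_pos k (-p)).le
    rw [← e] at this
    linarith [wt_rpow_pos l (-(p + q))]
  · have h1 : wt k ^ (-p) ≤ wt l ^ (-p) := Real.rpow_le_rpow_of_nonpos (wt_pos l) h (by linarith)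
    have := mul_le_mul_of_nonneg_right h1 (wt_rpow_pos l (-q)).le
    rw [← e l] at this
    linarith [wt_rpow_pos k (-(p + q))]

/-- At least half of `wt k` is carried by the larger of `wt l` and `wt (k - l)`. This is how a
weight on the output of a convolution is moved onto one of its factors. -/
lemma wt_rpow_le_add (k l : Freq) {σ : ℝ} (hσ : 0 ≤ σ) :
    wt k ^ σ ≤ 2 ^ σ * (wt l ^ σ + wt (k - l) ^ σ) := by
  have h : wt k ≤ wt l + wt (k - l) := by simpa using wt_add_le l (k - l)
  have h2 : wt k ≤ 2 * max (wt l) (wt (k - l)) := by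
    have := le_max_left (wt l) (wt (k - l)); have := le_max_right (wt l) (wt (k - l)); linarith
  calc wt k ^ σ ≤ (2 * max (wt l) (wt (k - l))) ^ σ :=
        Real.rpow_le_rpow (wt_pos k).le h2 hσ
    _ = 2 ^ σ * max (wt l) (wt (k - l)) ^ σ :=
        Real.mul_rpow (by norm_num) ((wt_pos l).le.trans (le_max_left _ _))
    _ ≤ _ := by
        refine mul_le_mul_of_nonneg_left ?_ (by positivity)
        rcases max_choice (wt l) (wt (k - l)) with e | e <;> rw [e]
        · linarith [wt_rpow_pos (k - l) σ]
        · linarith [wt_rpow_pos l σ]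

lemma summable_wt_rpow_sub {p : ℝ} (hp : 2 < p) (k : Freq) :
    Summable fun l : Freq => wt (k - l) ^ (-p) :=
  (Equiv.subLeft k).summable_iff.mpr (summable_wt_rpow hp)

lemma tsum_sub_left (f : Freq → ℝ) (k : Freq) : ∑' l, f (k - l) = ∑' l, f l :=
  (Equiv.subLeft k).tsum_eq f

/-- Convolution of two algebraically decaying sequences. -/
lemma conv_decay {p q σ : ℝ} (hσ : 0 ≤ σ) (hp : σ ≤ p) (hq : σ ≤ q) (hpq : 2 < p + q - σ) :
    ∃ C, 0 ≤ C ∧ ∀ k : Freq, (Summable fun l => wt l ^ (-p) * wt (k - l) ^ (-q)) ∧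
      ∑' l, wt l ^ (-p) * wt (k - l) ^ (-q) ≤ C * wt k ^ (-σ) := by
  set r := p + q - σ with hr
  set S := ∑' l : Freq, wt l ^ (-r) with hS
  have hS0 : 0 ≤ S := tsum_nonneg fun l => (wt_rpow_pos l _).le
  refine ⟨2 ^ σ * (4 * S), by positivity, fun k => ?_⟩
  -- The weight `wt k ^ σ` is charged to one factor, whose exponent stays nonnegative because `σ ≤
  -- p` and `σ ≤ q`. In both cases the remaining exponents add up to `r > 2`, so each term is
  -- dominated by two summable lattice terms.
  have key (l : Freq) : wt l ^ (-p) * wt (k - l) ^ (-q) ≤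
      wt k ^ (-σ) * (2 ^ σ * (2 * (wt l ^ (-r) + wt (k - l) ^ (-r)))) := by
    have h1 := wt_rpow_le_add k l hσ
    have e1 : wt l ^ σ * wt l ^ (-p) = wt l ^ (-(p - σ)) := by
      rw [← Real.rpow_add (wt_pos l)]; ring_nf
    have e2 : wt (k - l) ^ σ * wt (k - l) ^ (-q) = wt (k - l) ^ (-(q - σ)) := by
      rw [← Real.rpow_add (wt_pos _)]; ring_nf
    have h2 := wt_rpow_mul_le l (k - l) (p := p - σ) (q := q) (by linarith) (by linarith)
    have h3 := wt_rpow_mul_le l (k - l) (p := p) (q := q - σ) (by linarith) (by linarith)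
    rw [show p - σ + q = r by rw [hr]; ring] at h2
    rw [show p + (q - σ) = r by rw [hr]; ring] at h3
    have h4 : wt k ^ σ * (wt l ^ (-p) * wt (k - l) ^ (-q)) ≤
        2 ^ σ * (2 * (wt l ^ (-r) + wt (k - l) ^ (-r))) := by
      calc _ ≤ 2 ^ σ * (wt l ^ σ + wt (k - l) ^ σ) * (wt l ^ (-p) * wt (k - l) ^ (-q)) :=
            mul_le_mul_of_nonneg_right h1 (mul_pos (wt_rpow_pos _ _) (wt_rpow_pos _ _)).le
        _ = 2 ^ σ * (wt l ^ (-(p - σ)) * wt (k - l) ^ (-q) +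
              wt l ^ (-p) * wt (k - l) ^ (-(q - σ))) := by rw [← e1, ← e2]; ring
        _ ≤ _ := mul_le_mul_of_nonneg_left (by linarith) (by positivity)
    have e3 : wt k ^ (-σ) * wt k ^ σ = 1 := by rw [← Real.rpow_add (wt_pos k)]; simp
    calc _ = wt k ^ (-σ) * (wt k ^ σ * (wt l ^ (-p) * wt (k - l) ^ (-q))) := by
          rw [← mul_assoc, e3, one_mul]
      _ ≤ _ := mul_le_mul_of_nonneg_left h4 (wt_rpow_pos _ _).le
  have s1 := summable_wt_rpow hpq
  have s2 := summable_wt_rpow_sub hpq k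
  have s3 : Summable fun l => wt k ^ (-σ) * (2 ^ σ * (2 * (wt l ^ (-r) + wt (k - l) ^ (-r)))) :=
    (((s1.add s2).mul_left 2).mul_left _).mul_left _
  have s4 : Summable fun l => wt l ^ (-p) * wt (k - l) ^ (-q) :=
    Summable.of_nonneg_of_le (fun l => (mul_pos (wt_rpow_pos _ _) (wt_rpow_pos _ _)).le) key s3
  refine ⟨s4, (s4.tsum_le_tsum key s3).trans (le_of_eq ?_)⟩
  rw [tsum_mul_left, tsum_mul_left, tsum_mul_left, s1.tsum_add s2,
    tsum_sub_left (fun l => wt l ^ (-r)) k]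
  ring

/-! ### Carlson's and Ladyzhenskaya's inequalities for sequences -/

/-- The subtracted remainder makes the induction close: each of the two new terms `±(N + 1)` is
bounded by a telescoping difference. The base case `1 / τ ^ 2 ≤ 1 / τ` is where `1 ≤ τ` enters. -/
lemma sum_inv_sq_le {τ : ℝ} (hτ : 1 ≤ τ) (N : ℕ) :
    ∑ n ∈ Finset.Icc (-(N : ℤ)) N, 1 / (τ + |(n : ℝ)|) ^ 2 ≤ 3 / τ - 2 / (τ + N) := by
  induction N with
  | zero =>
    simp only [Nat.cast_zero, neg_zero, Finset.Icc_self, Finset.sum_singleton, Int.cast_zero,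
      abs_zero, add_zero]
    rw [← sub_div, div_le_div_iff₀ (by positivity) (by positivity)]
    nlinarith
  | succ N ih =>
    have e : Finset.Icc (-((N + 1 : ℕ) : ℤ)) ((N + 1 : ℕ) : ℤ) =
        insert (-((N : ℤ) + 1)) (insert ((N : ℤ) + 1) (Finset.Icc (-(N : ℤ)) N)) := by
      ext n; simp only [Finset.mem_Icc, Finset.mem_insert]; push_cast; omega
    rw [e, Finset.sum_insert, Finset.sum_insert]
    · push_cast
      rw [abs_neg, abs_of_nonneg (by positivity : (0 : ℝ) ≤ (N : ℝ) + 1)]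
      have h : 1 / (τ + ((N : ℝ) + 1)) ^ 2 ≤ 1 / (τ + N) - 1 / (τ + ((N : ℝ) + 1)) := by
        have h1 : 0 < τ + N := by positivity
        rw [div_sub_div _ _ h1.ne' (by positivity), div_le_div_iff₀ (by positivity) (by positivity)]
        nlinarith
      have e1 : 2 / (τ + N) = 2 * (1 / (τ + N)) := by ring
      have e2 : 2 / (τ + ((N : ℝ) + 1)) = 2 * (1 / (τ + ((N : ℝ) + 1))) := by ring
      rw [e1] at ih; rw [e2]; linarith
    · simp
    · simp only [Finset.mem_insert, Finset.mem_Icc]; omega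

/-- Carlson's inequality for finite sums over the integers. -/
lemma carlson (x : ℤ → ℝ) (N : ℕ) {p q : ℝ} (hp : 0 ≤ p) (hq : 0 ≤ q)
    (h1 : ∑ n ∈ Finset.Icc (-(N : ℤ)) N, x n ^ 2 ≤ p ^ 2)
    (h2 : ∑ n ∈ Finset.Icc (-(N : ℤ)) N, (1 + (n : ℝ) ^ 2) * x n ^ 2 ≤ 2 * q ^ 2) :
    (∑ n ∈ Finset.Icc (-(N : ℤ)) N, x n) ^ 2 ≤ 24 * (p * q) := by
  set S := Finset.Icc (-(N : ℤ)) N with hS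
  set P := ∑ n ∈ S, x n ^ 2 with hP
  set Q := ∑ n ∈ S, (1 + (n : ℝ) ^ 2) * x n ^ 2 with hQ
  have hP0 : 0 ≤ P := Finset.sum_nonneg fun n _ => sq_nonneg _
  have hPQ : P ≤ Q := Finset.sum_le_sum fun n _ => by
    nlinarith [sq_nonneg (x n), sq_nonneg ((n : ℝ) * x n)]
  rcases hP0.eq_or_lt with h0 | h0
  · have : ∀ n ∈ S, x n = 0 := fun n hn => by
      have := (Finset.sum_eq_zero_iff_of_nonneg (fun n _ => sq_nonneg (x n))).mp h0.symm n hn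
      exact pow_eq_zero_iff (two_ne_zero) |>.mp this
    rw [Finset.sum_eq_zero this, zero_pow two_ne_zero]; exact mul_nonneg (by norm_num) (mul_nonneg hp hq)
  -- Cauchy-Schwarz is applied with the weight `τ² + n²`; this choice of `τ` balances `τ² P` against
  -- `Q`. It satisfies `τ ≥ 1` because `P ≤ Q`.
  · set τ := Real.sqrt (Q / P) with hτ
    have hτ1 : 1 ≤ τ := by
      rw [hτ, Real.one_le_sqrt, le_div_iff₀ h0, one_mul]; exact hPQ
    have hτ0 : 0 < τ := by linarith
    have hτ2 : τ ^ 2 * P = Q := by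
      rw [hτ, Real.sq_sqrt (by positivity)]; field_simp
    have cs := Finset.sum_mul_sq_le_sq_mul_sq S (fun n => Real.sqrt (τ ^ 2 + (n : ℝ) ^ 2) * x n)
      (fun n => 1 / Real.sqrt (τ ^ 2 + (n : ℝ) ^ 2))
    have hpos (n : ℤ) : 0 < τ ^ 2 + (n : ℝ) ^ 2 := by positivity
    have e1 : ∑ n ∈ S, Real.sqrt (τ ^ 2 + (n : ℝ) ^ 2) * x n *
        (1 / Real.sqrt (τ ^ 2 + (n : ℝ) ^ 2)) = ∑ n ∈ S, x n := by
      refine Finset.sum_congr rfl fun n _ => ?_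
      have := (Real.sqrt_pos.mpr (hpos n)).ne'
      field_simp
    have e2 : ∑ n ∈ S, (Real.sqrt (τ ^ 2 + (n : ℝ) ^ 2) * x n) ^ 2 ≤ 2 * Q := by
      have : ∑ n ∈ S, (Real.sqrt (τ ^ 2 + (n : ℝ) ^ 2) * x n) ^ 2 =
          τ ^ 2 * P + ∑ n ∈ S, (n : ℝ) ^ 2 * x n ^ 2 := by
        rw [hP, Finset.mul_sum, ← Finset.sum_add_distrib]
        refine Finset.sum_congr rfl fun n _ => ?_
        rw [mul_pow, Real.sq_sqrt (hpos n).le]; ring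
      rw [this, hτ2]
      have : ∑ n ∈ S, (n : ℝ) ^ 2 * x n ^ 2 ≤ Q :=
        Finset.sum_le_sum fun n _ => by nlinarith [sq_nonneg (x n)]
      linarith
    have e3 : ∑ n ∈ S, (1 / Real.sqrt (τ ^ 2 + (n : ℝ) ^ 2)) ^ 2 ≤ 6 / τ := by
      calc _ ≤ ∑ n ∈ S, 2 * (1 / (τ + |(n : ℝ)|) ^ 2) := by
            refine Finset.sum_le_sum fun n _ => ?_
            rw [div_pow, Real.sq_sqrt (hpos n).le, one_pow, mul_one_div,
              div_le_div_iff₀ (hpos n) (by positivity)]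
            nlinarith [sq_nonneg (τ - |(n : ℝ)|), sq_abs (n : ℝ)]
        _ ≤ 2 * (3 / τ) := by
            rw [← Finset.mul_sum]
            have := sum_inv_sq_le hτ1 N
            have h3 : 0 ≤ 2 / (τ + N) := by positivity
            linarith
        _ = 6 / τ := by ring
    rw [e1] at cs
    have hQ0 : 0 ≤ Q := by linarith
    have h3 : (∑ n ∈ S, x n) ^ 2 ≤ 2 * Q * (6 / τ) :=
      cs.trans (mul_le_mul e2 e3 (Finset.sum_nonneg fun n _ => sq_nonneg _) (by positivity))
    have h4 : 2 * Q * (6 / τ) = 12 * (τ * P) := by rw [← hτ2]; field_simp; ring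
    have h5 : τ * P ≤ Real.sqrt 2 * (p * q) := by
      apply le_of_sq_le_sq _ (by positivity)
      calc (τ * P) ^ 2 = (τ ^ 2 * P) * P := by ring
        _ = Q * P := by rw [hτ2]
        _ ≤ (2 * q ^ 2) * p ^ 2 := mul_le_mul h2 h1 hP0 (by positivity)
        _ = _ := by rw [mul_pow, Real.sq_sqrt (by norm_num)]; ring
    have h6 : Real.sqrt 2 ≤ 2 := by
      rw [Real.sqrt_le_left (by norm_num)]; norm_num
    have h7 := mul_le_mul_of_nonneg_right h6 (mul_nonneg hp hq)
    clear_value τ P Q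
    linarith

lemma sum_piFinset_two (S : Finset ℤ) (f : Freq → ℝ) :
    ∑ l ∈ Fintype.piFinset (fun _ : Fin 2 => S), f l = ∑ m ∈ S, ∑ n ∈ S, f ![m, n] := by
  rw [← Finset.sum_product']
  refine Finset.sum_nbij' (fun l => (l 0, l 1)) (fun p => ![p.1, p.2]) ?_ ?_ ?_ ?_ ?_
  · intro l hl; rw [Fintype.mem_piFinset] at hl; exact Finset.mem_product.mpr ⟨hl 0, hl 1⟩
  · rintro ⟨m, n⟩ h
    have h' := Finset.mem_product.mp h
    rw [Fintype.mem_piFinset]; intro i; fin_cases i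
    · exact h'.1
    · exact h'.2
  · intro l _; ext i; fin_cases i <;> rfl
  · rintro ⟨m, n⟩ _; rfl
  · intro l _
    congr 1; ext i; fin_cases i <;> rfl

/-- Converts the one-dimensional weight of `carlson` into `wt`; the factor 2 is the one in front of
`q ^ 2` there. -/
lemma one_add_sq_le_wt (k : Freq) (i : Fin 2) : 1 + (k i : ℝ) ^ 2 ≤ 2 * wt k ^ 2 := by
  have h1 := one_le_wt k
  have h2 := abs_coord_le_wt k i
  have := pow_le_pow_left₀ (abs_nonneg _) h2 2
  rw [sq_abs] at this
  nlinarith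

lemma sum_image_le_of_forall {ι : Type*} (a : Freq → ℝ) {A : ℝ}
    (hA : ∀ s : Finset Freq, ∑ k ∈ s, a k ^ 2 ≤ A) (s : Finset ι) (φ : ι → Freq)
    (hφ : Function.Injective φ) : ∑ i ∈ s, a (φ i) ^ 2 ≤ A := by
  classical
  rw [← Finset.sum_image (f := fun k => a k ^ 2) (fun i _ j _ h => hφ h)]
  exact hA _

/-- Carlson's inequality for sequences with two indices: the `ℓ¹`-norm in one index
of the `ℓ²`-norms in the other. -/
lemma carlson_mixed (c : ℤ → ℤ → ℝ) (w : ℤ → ℤ → ℝ) (N : ℕ) {p q : ℝ} (hp : 0 ≤ p) (hq : 0 ≤ q)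
    (hw : ∀ m n : ℤ, 1 + (m : ℝ) ^ 2 ≤ 2 * w m n ^ 2)
    (h1 : ∑ m ∈ Finset.Icc (-(N : ℤ)) N, ∑ n ∈ Finset.Icc (-(N : ℤ)) N, c m n ^ 2 ≤ p ^ 2)
    (h2 : ∑ m ∈ Finset.Icc (-(N : ℤ)) N, ∑ n ∈ Finset.Icc (-(N : ℤ)) N,
      (w m n * c m n) ^ 2 ≤ q ^ 2) :
    (∑ m ∈ Finset.Icc (-(N : ℤ)) N, Real.sqrt (∑ n ∈ Finset.Icc (-(N : ℤ)) N, c m n ^ 2)) ^ 2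
      ≤ 24 * (p * q) := by
  refine carlson _ N hp hq ?_ ?_
  · refine le_trans (le_of_eq ?_) h1
    exact Finset.sum_congr rfl fun m _ => Real.sq_sqrt (Finset.sum_nonneg fun n _ => sq_nonneg _)
  · refine le_trans ?_ (mul_le_mul_of_nonneg_left h2 zero_le_two)
    rw [Finset.mul_sum]
    refine Finset.sum_le_sum fun m _ => ?_
    rw [Real.sq_sqrt (Finset.sum_nonneg fun n _ => sq_nonneg _), Finset.mul_sum, Finset.mul_sum]
    refine Finset.sum_le_sum fun n _ => ?_
    rw [mul_pow, ← mul_assoc]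
    exact mul_le_mul_of_nonneg_right (hw m n) (sq_nonneg _)

/-- The Fourier-side form of Ladyzhenskaya's inequality: a bound for the trilinear convolution. -/
lemma ladyzhenskaya (a c d : Freq → ℝ) (ha : ∀ k, 0 ≤ a k) (hc : ∀ k, 0 ≤ c k)
    (hd : ∀ k, 0 ≤ d k) {A p q p' q' : ℝ} (hA0 : 0 ≤ A) (hp : 0 ≤ p) (hq : 0 ≤ q)
    (hp' : 0 ≤ p') (hq' : 0 ≤ q')
    (hA : ∀ s : Finset Freq, ∑ k ∈ s, a k ^ 2 ≤ A ^ 2)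
    (hcp : ∀ s : Finset Freq, ∑ k ∈ s, c k ^ 2 ≤ p ^ 2)
    (hcq : ∀ s : Finset Freq, ∑ k ∈ s, (wt k * c k) ^ 2 ≤ q ^ 2)
    (hdp : ∀ s : Finset Freq, ∑ k ∈ s, d k ^ 2 ≤ p' ^ 2)
    (hdq : ∀ s : Finset Freq, ∑ k ∈ s, (wt k * d k) ^ 2 ≤ q' ^ 2)
    (s : Finset (Freq × Freq)) :
    (∑ x ∈ s, a (x.1 + x.2) * c x.1 * d x.2) ^ 2 ≤ 576 * A ^ 2 * ((p * q) * (p' * q')) := by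
  classical
  have hnn (x : Freq × Freq) : 0 ≤ a (x.1 + x.2) * c x.1 * d x.2 :=
    mul_nonneg (mul_nonneg (ha _) (hc _)) (hd _)
  -- All terms are nonnegative, so the sum may be enlarged to a product of boxes, where the four
  -- integer coordinates can be summed independently.
  obtain ⟨N, hN⟩ : ∃ N : ℕ, ∀ x ∈ s, ∀ i, (|x.1 i| ≤ (N : ℤ)) ∧ (|x.2 i| ≤ (N : ℤ)) := by
    refine ⟨s.sup fun x => ∑ i, ((x.1 i).natAbs + (x.2 i).natAbs), fun x hx i => ?_⟩
    have h1 := Finset.le_sup (f := fun x : Freq × Freq =>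
      ∑ i, ((x.1 i).natAbs + (x.2 i).natAbs)) hx
    have h2 := Finset.single_le_sum (f := fun i => (x.1 i).natAbs + (x.2 i).natAbs)
      (fun i _ => Nat.zero_le _) (Finset.mem_univ i)
    have h3 := h2.trans h1
    rw [← Int.natCast_natAbs, ← Int.natCast_natAbs]
    constructor <;> exact_mod_cast (by omega)
  set S := Finset.Icc (-(N : ℤ)) N with hS
  set box := Fintype.piFinset (fun _ : Fin 2 => S) with hbox
  have hsub : s ⊆ box ×ˢ box := by
    intro x hx
    simp only [Finset.mem_product, hbox, Fintype.mem_piFinset, hS, Finset.mem_Icc]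
    exact ⟨fun i => abs_le.mp (hN x hx i).1, fun i => abs_le.mp (hN x hx i).2⟩
  -- The two sequences are measured in opposite mixed norms: `c` is `ℓ¹` in its first index and `ℓ²`
  -- in its second, `d` the other way round.
  set X := ∑ m ∈ S, Real.sqrt (∑ n ∈ S, c ![m, n] ^ 2) with hX
  set Y := ∑ n ∈ S, Real.sqrt (∑ m ∈ S, d ![m, n] ^ 2) with hY
  have hX2 : X ^ 2 ≤ 24 * (p * q) := by
    refine carlson_mixed (fun m n => c ![m, n]) (fun m n => wt ![m, n]) N hp hq
      (fun m n => by simpa using one_add_sq_le_wt ![m, n] 0) ?_ ?_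
    · simpa only [hbox, sum_piFinset_two] using hcp box
    · simpa only [hbox, sum_piFinset_two] using hcq box
  have hY2 : Y ^ 2 ≤ 24 * (p' * q') := by
    refine carlson_mixed (fun n m => d ![m, n]) (fun n m => wt ![m, n]) N hp' hq'
      (fun n m => by simpa using one_add_sq_le_wt ![m, n] 1) ?_ ?_
    · rw [Finset.sum_comm]; simpa only [hbox, sum_piFinset_two] using hdp box
    · rw [Finset.sum_comm]; simpa only [hbox, sum_piFinset_two] using hdq box
  have hmain : ∑ x ∈ s, a (x.1 + x.2) * c x.1 * d x.2 ≤ A * (X * Y) := by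
    calc _ ≤ ∑ x ∈ box ×ˢ box, a (x.1 + x.2) * c x.1 * d x.2 :=
          Finset.sum_le_sum_of_subset_of_nonneg hsub fun x _ _ => hnn x
      _ = ∑ l₁ ∈ S, ∑ l₂ ∈ S, ∑ j₁ ∈ S, ∑ j₂ ∈ S,
            a (![l₁, l₂] + ![j₁, j₂]) * c ![l₁, l₂] * d ![j₁, j₂] := by
          rw [Finset.sum_product, hbox, sum_piFinset_two]
          refine Finset.sum_congr rfl fun l₁ _ => Finset.sum_congr rfl fun l₂ _ => ?_
          rw [sum_piFinset_two]
      -- The outer `ℓ¹` indices `l₁` and `j₂` are frozen. The sum of the two frequencies is then an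
      -- injective function of the inner pair `(l₂, j₁)`, so Cauchy-Schwarz over that pair bounds
      -- `a` by its full `ℓ²` norm and splits `c` from `d`.
      _ = ∑ l₁ ∈ S, ∑ j₂ ∈ S, ∑ z ∈ S ×ˢ S,
            a (![l₁, z.1] + ![z.2, j₂]) * (c ![l₁, z.1] * d ![z.2, j₂]) := by
          refine Finset.sum_congr rfl fun l₁ _ => ?_
          simp_rw [Finset.sum_product, mul_assoc]
          conv_rhs => rw [Finset.sum_comm]
          refine Finset.sum_congr rfl fun l₂ _ => ?_
          rw [Finset.sum_comm]
      _ ≤ ∑ l₁ ∈ S, ∑ j₂ ∈ S, A * (Real.sqrt (∑ n ∈ S, c ![l₁, n] ^ 2) *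
            Real.sqrt (∑ m ∈ S, d ![m, j₂] ^ 2)) := by
          refine Finset.sum_le_sum fun l₁ _ => Finset.sum_le_sum fun j₂ _ => ?_
          apply le_of_sq_le_sq _ (by positivity)
          refine (Finset.sum_mul_sq_le_sq_mul_sq _ _ _).trans ?_
          rw [mul_pow, mul_pow, Real.sq_sqrt (Finset.sum_nonneg fun n _ => sq_nonneg _),
            Real.sq_sqrt (Finset.sum_nonneg fun n _ => sq_nonneg _)]
          refine mul_le_mul ?_ (le_of_eq ?_) (Finset.sum_nonneg fun n _ => sq_nonneg _)
            (sq_nonneg _)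
          · refine sum_image_le_of_forall a hA _ (fun z : ℤ × ℤ => ![l₁, z.1] + ![z.2, j₂]) ?_
            rintro ⟨z, z'⟩ ⟨y, y'⟩ h
            have h0 := congrFun h 0
            have h1 := congrFun h 1
            simp at h0 h1
            simp [h0, h1]
          · simp_rw [mul_pow]
            rw [Finset.sum_mul_sum, Finset.sum_product]
      _ = A * (X * Y) := by
          rw [hX, hY, Finset.sum_mul_sum, Finset.mul_sum]
          simp_rw [Finset.mul_sum]
  have hX0 : 0 ≤ X := Finset.sum_nonneg fun n _ => Real.sqrt_nonneg _
  have hY0 : 0 ≤ Y := Finset.sum_nonneg fun n _ => Real.sqrt_nonneg _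
  calc _ ≤ (A * (X * Y)) ^ 2 := pow_le_pow_left₀ (Finset.sum_nonneg fun x _ => hnn x) hmain 2
    _ = A ^ 2 * (X ^ 2 * Y ^ 2) := by ring
    _ ≤ A ^ 2 * ((24 * (p * q)) * (24 * (p' * q'))) := by gcongr
    _ = _ := by ring

/-! ### The nonlinearity on Fourier coefficients -/

/-- The unit vector orthogonal to the frequency `k` (zero for `k = 0`). -/
def perp (k : Freq) : Plane := ‖freqVec k‖⁻¹ • !₂[-(k 1 : ℝ), (k 0 : ℝ)]

lemma perp_zero : perp 0 = 0 := by simp [perp, freqVec_zero]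

lemma perp_neg (k : Freq) : perp (-k) = -perp k := by
  ext i; fin_cases i <;> simp [perp, freqVec_neg]

lemma norm_perp_le (k : Freq) : ‖perp k‖ ≤ 1 := by
  have h : ‖(!₂[-(k 1 : ℝ), (k 0 : ℝ)] : Plane)‖ = ‖freqVec k‖ := by
    rw [← sq_eq_sq₀ (norm_nonneg _) (norm_nonneg _), norm_sq_freqVec]
    simp [EuclideanSpace.norm_sq_eq]; ring
  rw [perp, norm_smul, h, norm_inv, norm_norm]
  exact inv_mul_le_one

lemma inner_perp_self (k : Freq) : inner ℝ (perp k) (freqVec k) = 0 := by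
  simp [perp, freqVec, inner_smul_left, PiLp.inner_apply]; ring_nf; simp

lemma inner_plane (x y : Plane) : inner ℝ x y = x 0 * y 0 + x 1 * y 1 := by
  simp [PiLp.inner_apply]; ring

/-- The interaction coefficients of the Navier-Stokes nonlinearity. -/
def kernel (κ : ℝ) (k l : Freq) : ℂ :=
  ((κ * inner ℝ (perp l) (freqVec k) * inner ℝ (perp k) (perp (k - l)) : ℝ) : ℂ) * Complex.I

/-- In divergence form the derivative falls on the output frequency `k`. The loss is thus a factor
outside the sum over `l`, and what remains is a plain convolution, finite for any two `ℓ²`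
sequences. -/
lemma norm_kernel_le {κ : ℝ} (hκ : 0 ≤ κ) (k l : Freq) : ‖kernel κ k l‖ ≤ κ * wt k := by
  rw [kernel, norm_mul, Complex.norm_I, mul_one, Complex.norm_real, Real.norm_eq_abs, abs_mul,
    abs_mul, abs_of_nonneg hκ]
  have h1 : |inner ℝ (perp l) (freqVec k)| ≤ wt k :=
    (abs_real_inner_le_norm _ _).trans <|
      (mul_le_mul (norm_perp_le l) (norm_freqVec_le_wt k) (norm_nonneg _) zero_le_one).trans_eq
        (one_mul _)
  have h2 : |inner ℝ (perp k) (perp (k - l))| ≤ 1 :=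
    (abs_real_inner_le_norm _ _).trans <|
      mul_le_one₀ (norm_perp_le _) (norm_nonneg _) (norm_perp_le _)
  calc _ ≤ κ * wt k * 1 := mul_le_mul (mul_le_mul_of_nonneg_left h1 hκ) h2 (abs_nonneg _)
        (mul_nonneg hκ (wt_pos k).le)
    _ = _ := mul_one _

/-- The antisymmetry behind conservation of energy. As `perp l` is orthogonal to `l`, it sees `l -
k` as `-k`; the two sign changes in the other factor cancel. -/
lemma kernel_swap (κ : ℝ) (k l : Freq) : kernel κ (l - k) l = -kernel κ k l := by
  have h1 : inner ℝ (perp l) (freqVec (l - k)) = -inner ℝ (perp l) (freqVec k) := by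
    rw [freqVec_sub, inner_sub_right, inner_perp_self, zero_sub]
  have h2 : inner ℝ (perp (l - k)) (perp (l - k - l)) = inner ℝ (perp k) (perp (k - l)) := by
    rw [show l - k - l = -k by abel, show l - k = -(k - l) by abel, perp_neg, perp_neg,
      inner_neg_neg, real_inner_comm]
  rw [kernel, kernel, h1, h2]; push_cast; ring

/-- Square-summable sequences of Fourier coefficients, as a real Hilbert space. -/
abbrev Seq : Type := lp (fun _ : Freq => ℂ) 2

lemma summable_norm_sq (c : Seq) : Summable fun k => ‖c k‖ ^ 2 := by
  have := (lp.memℓp c).summable (by norm_num)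
  simpa using this

lemma norm_sq_eq_tsum (c : Seq) : ‖c‖ ^ 2 = ∑' k, ‖c k‖ ^ 2 := by
  have := lp.norm_rpow_eq_tsum (p := 2) (by norm_num) c
  simpa using this

lemma sum_norm_sq_le (c : Seq) (s : Finset Freq) : ∑ k ∈ s, ‖c k‖ ^ 2 ≤ ‖c‖ ^ 2 := by
  rw [norm_sq_eq_tsum]
  exact (summable_norm_sq c).sum_le_tsum s fun _ _ => sq_nonneg _

lemma norm_apply_le (c : Seq) (k : Freq) : ‖c k‖ ≤ ‖c‖ :=
  lp.norm_apply_le_norm (by norm_num) c k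

/-- Cauchy-Schwarz for series. -/
lemma summable_mul_and_tsum_le {ι : Type*} {f g : ι → ℝ} (hf : ∀ i, 0 ≤ f i) (hg : ∀ i, 0 ≤ g i)
    {A B : ℝ} (hA0 : 0 ≤ A) (hB0 : 0 ≤ B) (hA : ∀ s : Finset ι, ∑ i ∈ s, f i ^ 2 ≤ A ^ 2)
    (hB : ∀ s : Finset ι, ∑ i ∈ s, g i ^ 2 ≤ B ^ 2) :
    (Summable fun i => f i * g i) ∧ ∑' i, f i * g i ≤ A * B := by
  have key (s : Finset ι) : ∑ i ∈ s, f i * g i ≤ A * B := by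
    apply le_of_sq_le_sq _ (mul_nonneg hA0 hB0)
    refine (Finset.sum_mul_sq_le_sq_mul_sq _ _ _).trans ?_
    rw [mul_pow]
    exact mul_le_mul (hA s) (hB s) (Finset.sum_nonneg fun i _ => sq_nonneg _) (sq_nonneg _)
  have hs := summable_of_sum_le (fun i => mul_nonneg (hf i) (hg i)) key
  exact ⟨hs, hs.tsum_le_of_sum_le key⟩

/-- The convolution of the moduli of two sequences. -/
def conv (c d : Freq → ℂ) (k : Freq) : ℝ := ∑' l, ‖c l‖ * ‖d (k - l)‖

lemma sum_norm_sq_sub_le (c : Seq) (k : Freq) (s : Finset Freq) :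
    ∑ l ∈ s, ‖c (k - l)‖ ^ 2 ≤ ‖c‖ ^ 2 :=
  sum_image_le_of_forall (fun l => ‖c l‖) (sum_norm_sq_le c) s (fun l => k - l)
    sub_right_injective

lemma summable_conv (c d : Seq) (k : Freq) : Summable fun l => ‖c l‖ * ‖d (k - l)‖ :=
  (summable_mul_and_tsum_le (fun _ => norm_nonneg _) (fun _ => norm_nonneg _) (norm_nonneg c)
    (norm_nonneg d) (sum_norm_sq_le c) (sum_norm_sq_sub_le d k)).1

lemma conv_le (c d : Seq) (k : Freq) : conv c d k ≤ ‖c‖ * ‖d‖ :=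
  (summable_mul_and_tsum_le (fun _ => norm_nonneg _) (fun _ => norm_nonneg _) (norm_nonneg c)
    (norm_nonneg d) (sum_norm_sq_le c) (sum_norm_sq_sub_le d k)).2

lemma conv_comm (c d : Freq → ℂ) (k : Freq) : conv c d k = conv d c k := by
  rw [conv, ← (Equiv.subLeft k).tsum_eq]
  simp [conv, mul_comm]

/-- The `k`-th Fourier coefficient of the nonlinearity. -/
def bil (κ : ℝ) (k : Freq) (c d : Freq → ℂ) : ℂ := ∑' l, kernel κ k l * c l * d (k - l)

lemma norm_bil_term_le {κ : ℝ} (hκ : 0 ≤ κ) (k l : Freq) (c d : Freq → ℂ) :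
    ‖kernel κ k l * c l * d (k - l)‖ ≤ κ * wt k * (‖c l‖ * ‖d (k - l)‖) := by
  rw [norm_mul, norm_mul, mul_assoc]
  exact mul_le_mul_of_nonneg_right (norm_kernel_le hκ k l) (by positivity)

lemma summable_bil {κ : ℝ} (hκ : 0 ≤ κ) (k : Freq) (c d : Seq) :
    Summable fun l => kernel κ k l * c l * d (k - l) :=
  Summable.of_norm_bounded ((summable_conv c d k).mul_left (κ * wt k))
    fun l => norm_bil_term_le hκ k l c d

lemma norm_bil_le {κ : ℝ} (hκ : 0 ≤ κ) (k : Freq) (c d : Seq) :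
    ‖bil κ k c d‖ ≤ κ * wt k * conv c d k :=
  tsum_of_norm_bounded ((summable_conv c d k).mul_left (κ * wt k)).hasSum
    (fun l => norm_bil_term_le hκ k l c d) |>.trans_eq tsum_mul_left

/-- `bil` as a bounded bilinear map. -/
def bilCLM {κ : ℝ} (hκ : 0 ≤ κ) (k : Freq) : Seq →L[ℝ] Seq →L[ℝ] ℂ :=
  LinearMap.mkContinuous₂ (LinearMap.mk₂ ℝ (fun c d : Seq => bil κ k c d)
    (fun c c' d => by
      rw [bil, bil, bil, ← (summable_bil hκ k c d).tsum_add (summable_bil hκ k c' d)]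
      refine tsum_congr fun l => ?_
      rw [lp.coeFn_add, Pi.add_apply]; ring)
    (fun r c d => by
      rw [bil, bil, ← tsum_const_smul'']
      refine tsum_congr fun l => ?_
      rw [lp.coeFn_smul, Pi.smul_apply]; simp only [Complex.real_smul]; ring)
    (fun c d d' => by
      rw [bil, bil, bil, ← (summable_bil hκ k c d).tsum_add (summable_bil hκ k c d')]
      refine tsum_congr fun l => ?_
      rw [lp.coeFn_add, Pi.add_apply]; ring)
    (fun r c d => by
      rw [bil, bil, ← tsum_const_smul'']
      refine tsum_congr fun l => ?_
      rw [lp.coeFn_smul, Pi.smul_apply]; simp only [Complex.real_smul]; ring))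
    (κ * wt k) fun c d => by
      rw [LinearMap.mk₂_apply, mul_assoc]
      exact (norm_bil_le hκ k c d).trans
        (mul_le_mul_of_nonneg_left (conv_le c d k) (mul_nonneg hκ (wt_pos k).le))

/-- At a fixed frequency the nonlinearity is a bounded bilinear form on `ℓ²`, so the product rule
applies to a curve differentiable only in the `ℓ²` norm. This makes it possible to differentiate the
equation in time. -/
lemma hasDerivAt_bil {κ : ℝ} (hκ : 0 ≤ κ) (k : Freq) {U : ℝ → Seq} {U' : Seq} {t : ℝ}
    (h : HasDerivAt U U' t) : HasDerivAt (fun t => bil κ k (U t) (U t))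
      (bil κ k U' (U t) + bil κ k (U t) U') t := by
  have h1 : HasDerivAt (fun t => bilCLM hκ k (U t)) (bilCLM hκ k U') t :=
    (bilCLM hκ k).hasFDerivAt.comp_hasDerivAt t h
  exact h1.clm_apply h

/-- Evaluation of a sequence at a frequency. -/
def evalCLM (k : Freq) : Seq →L[ℝ] ℂ :=
  LinearMap.mkContinuous ⟨⟨fun c => c k, fun _ _ => rfl⟩, fun _ _ => rfl⟩ 1
    fun c => (norm_apply_le c k).trans_eq (one_mul _).symm

lemma hasDerivAt_coeff {U : ℝ → Seq} {U' : Seq} {t : ℝ} (h : HasDerivAt U U' t) (k : Freq) :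
    HasDerivAt (fun t => U t k) (U' k) t :=
  (evalCLM k).hasFDerivAt.comp_hasDerivAt t h

/-! ### Damped scalar equations and parabolic smoothing -/

/-- Damping: solutions of `y' = -λ y + f` forget their initial value exponentially fast. -/
lemma norm_le_of_damped {y f : ℝ → ℂ} {lam a b D F : ℝ} (hl : 0 < lam)
    (hy : ∀ t ∈ Icc a b, HasDerivAt y (-(lam * y t) + f t) t)
    (hf : ∀ t ∈ Icc a b, ‖f t‖ ≤ F) (hD : ‖y a‖ ≤ D) {t : ℝ} (ht : t ∈ Icc a b) :
    ‖y t‖ ≤ D * Real.exp (-(lam * (t - a))) + F / lam := by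
  have hexp (x : ℝ) : HasDerivAt (fun s : ℝ => Real.exp (lam * (s - a)))
      (lam * Real.exp (lam * (x - a))) x := by
    have h : HasDerivAt (fun s : ℝ => lam * (s - a)) lam x := by
      simpa using ((hasDerivAt_id x).sub_const a).const_mul lam
    simpa [mul_comm] using h.exp
  -- The integrating factor removes the damping term; the norm of the product is then compared with
  -- the explicit solution `hB` of the bounding equation.
  have hY : ∀ s ∈ Icc a b, HasDerivAt (fun s => (Real.exp (lam * (s - a))) • y s)
      (Real.exp (lam * (s - a)) • f s) s := fun s hs => by
    refine ((hexp s).smul (hy s hs)).congr_deriv ?_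
    simp only [Complex.real_smul]; push_cast; ring
  have hB (x : ℝ) : HasDerivAt (fun s : ℝ => D + F / lam * (Real.exp (lam * (s - a)) - 1))
      (F * Real.exp (lam * (x - a))) x := by
    refine (((hexp x).sub_const 1).const_mul (F / lam)).const_add D |>.congr_deriv ?_
    have := hl.ne'
    field_simp
  have key := image_norm_le_of_norm_deriv_right_le_deriv_boundary
    (f := fun s => (Real.exp (lam * (s - a))) • y s) (a := a) (b := b)
    (fun s hs => (hY s hs).continuousAt.continuousWithinAt)
    (fun s hs => (hY s (Ico_subset_Icc_self hs)).hasDerivWithinAt) (by simpa using hD) hB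
    (fun s hs => by
      rw [norm_smul, Real.norm_of_nonneg (Real.exp_pos _).le, mul_comm]
      exact mul_le_mul_of_nonneg_right (hf s (Ico_subset_Icc_self hs)) (Real.exp_pos _).le) ht
  simp only [norm_smul, Real.norm_of_nonneg (Real.exp_pos _).le] at key
  have hF : 0 ≤ F := (norm_nonneg _).trans (hf t ht)
  have he : Real.exp (-(lam * (t - a))) * Real.exp (lam * (t - a)) = 1 := by
    rw [← Real.exp_add]; simp
  have he0 := Real.exp_pos (-(lam * (t - a)))
  calc ‖y t‖ = Real.exp (-(lam * (t - a))) * (Real.exp (lam * (t - a)) * ‖y t‖) := by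
        rw [← mul_assoc, he, one_mul]
    _ ≤ Real.exp (-(lam * (t - a))) * (D + F / lam * (Real.exp (lam * (t - a)) - 1)) :=
        mul_le_mul_of_nonneg_left key he0.le
    _ = D * Real.exp (-(lam * (t - a))) + F / lam *
        (Real.exp (-(lam * (t - a))) * Real.exp (lam * (t - a)) - Real.exp (-(lam * (t - a)))) := by
        ring
    _ ≤ _ := by
        rw [he]
        have : 0 ≤ F / lam := by positivity
        nlinarith

/-- A single term of the exponential series suffices: with `n ≥ p`, the `n`-th one is of order `wt k
^ (2 * n)`, and `wt k ≥ 1`. -/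
lemma exp_neg_le_wt {μ : ℝ} (hμ : 0 < μ) (p : ℝ) :
    ∃ C, 0 ≤ C ∧ ∀ k : Freq, Real.exp (-(μ * wt k ^ 2)) ≤ C * wt k ^ (-p) := by
  obtain ⟨n, hn⟩ := exists_nat_ge p
  refine ⟨n.factorial / μ ^ n, by positivity, fun k => ?_⟩
  have h1 : (μ * wt k ^ 2) ^ n / n.factorial ≤ Real.exp (μ * wt k ^ 2) :=
    Real.pow_div_factorial_le_exp _ (by have := wt_pos k; positivity) n
  have h2 : wt k ^ p ≤ (wt k ^ 2) ^ n := by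
    rw [← pow_mul, ← Real.rpow_natCast]
    refine Real.rpow_le_rpow_of_exponent_le (one_le_wt k) ?_
    push_cast
    have : (0 : ℝ) ≤ n := Nat.cast_nonneg n
    linarith
  have hw := wt_rpow_pos k p
  rw [Real.exp_neg, Real.rpow_neg (wt_pos k).le, inv_le_iff_one_le_mul₀ (Real.exp_pos _)]
  have h3 : μ ^ n * wt k ^ p / n.factorial ≤ Real.exp (μ * wt k ^ 2) := by
    refine le_trans ?_ h1
    rw [mul_pow]
    gcongr
  calc (1 : ℝ) = n.factorial / μ ^ n * (wt k ^ p)⁻¹ * (μ ^ n * wt k ^ p / n.factorial) := by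
        field_simp
    _ ≤ _ := mul_le_mul_of_nonneg_left h3 (by positivity)

/-- Parabolic smoothing for a family of damped equations, locally uniformly in time. -/
lemma decay_of_ode {μ : ℝ} (hμ : 0 < μ) {y f : ℝ → Freq → ℂ} {φ : Freq → ℝ} (hφ : ∀ k, 0 ≤ φ k)
    (hy : ∀ t k, HasDerivAt (fun s => y s k)
      (-(((μ * ‖freqVec k‖ ^ 2 : ℝ) : ℂ) * y t k) + f t k) t)
    (h0 : ∀ t, y t 0 = 0) (hb : ∀ T, ∃ C, ∀ t, |t| ≤ T → ∀ k, ‖y t k‖ ≤ C)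
    (hf : ∀ T, ∃ C, ∀ t, |t| ≤ T → ∀ k, ‖f t k‖ ≤ C * φ k) (p : ℝ) :
    ∀ T, ∃ C, 0 ≤ C ∧ ∀ t, |t| ≤ T → ∀ k,
      ‖y t k‖ ≤ C * (wt k ^ (-2 : ℝ) * φ k + wt k ^ (-p)) := by
  intro T
  -- The damped equation is solved from `t - 1` to `t`, which leaves `[-T, T]` by at most one unit.
  -- The crude bound at `t - 1` is multiplied by `exp (-μ wt k ^ 2)`, smaller than any power of `wt
  -- k`.
  obtain ⟨D, hD⟩ := hb (T + 1)
  obtain ⟨F, hF⟩ := hf (T + 1)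
  obtain ⟨K, hK0, hK⟩ := exp_neg_le_wt hμ p
  refine ⟨max (|D| * K) (|F| / μ), le_max_of_le_left (by positivity), fun t ht k => ?_⟩
  have hR : 0 ≤ wt k ^ (-2 : ℝ) * φ k := mul_nonneg (wt_rpow_pos _ _).le (hφ k)
  have hP := wt_rpow_pos k (-p)
  -- The zero frequency is not damped, since `wt 0 = 1` but `freqVec 0 = 0`; there the coefficient
  -- vanishes.
  by_cases hk : k = 0
  · subst hk; rw [h0, norm_zero]
    exact mul_nonneg (le_max_of_le_left (by positivity)) (by linarith)
  have ht' := abs_le.mp ht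
  have hw := wt_pos k
  have hl : 0 < μ * wt k ^ 2 := by positivity
  have := norm_le_of_damped (a := t - 1) (b := t) (t := t) (y := fun s => y s k)
    (f := fun s => f s k) (D := |D|) (F := |F| * φ k) hl
    (fun s hs => by simpa [wt_eq hk] using hy s k)
    (fun s hs => (hF s (abs_le.mpr ⟨by linarith [hs.1], by linarith [hs.2]⟩) k).trans
      (mul_le_mul_of_nonneg_right (le_abs_self F) (hφ k)))
    ((hD (t - 1) (abs_le.mpr ⟨by linarith, by linarith⟩) k).trans (le_abs_self D))
    ⟨by linarith, le_rfl⟩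
  refine this.trans ?_
  rw [show t - (t - 1) = 1 by ring, mul_one]
  have e : |F| * φ k / (μ * wt k ^ 2) = |F| / μ * (wt k ^ (-2 : ℝ) * φ k) := by
    rw [Real.rpow_neg hw.le, Real.rpow_two]; field_simp
  have h1 : |D| * Real.exp (-(μ * wt k ^ 2)) ≤ |D| * K * wt k ^ (-p) := by
    rw [mul_assoc]; exact mul_le_mul_of_nonneg_left (hK k) (abs_nonneg D)
  rw [e]
  have h2 := mul_le_mul_of_nonneg_right (le_max_left (|D| * K) (|F| / μ)) hP.le
  have h3 := mul_le_mul_of_nonneg_right (le_max_right (|D| * K) (|F| / μ)) hR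
  linarith

/-- Decay of the convolution of two decaying sequences. -/
lemma conv_le_of_decay {p q σ : ℝ} (hσ : 0 ≤ σ) (hp : σ ≤ p) (hq : σ ≤ q)
    (hpq : 2 < p + q - σ) : ∃ K, 0 ≤ K ∧ ∀ (c d : Freq → ℂ) (M N : ℝ), 0 ≤ M →
      (∀ k, ‖c k‖ ≤ M * wt k ^ (-p)) → (∀ k, ‖d k‖ ≤ N * wt k ^ (-q)) →
      ∀ k, conv c d k ≤ M * N * K * wt k ^ (-σ) := by
  obtain ⟨K, hK0, hK⟩ := conv_decay hσ hp hq hpq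
  refine ⟨K, hK0, fun c d M N hM hc hd k => ?_⟩
  have hN : 0 ≤ N := by
    have := (norm_nonneg _).trans (hd 0)
    exact nonneg_of_mul_nonneg_left this (wt_rpow_pos _ _)
  have hle (l : Freq) : ‖c l‖ * ‖d (k - l)‖ ≤ M * N * (wt l ^ (-p) * wt (k - l) ^ (-q)) :=
    calc _ ≤ (M * wt l ^ (-p)) * (N * wt (k - l) ^ (-q)) :=
          mul_le_mul (hc l) (hd _) (norm_nonneg _) ((norm_nonneg _).trans (hc l))
      _ = _ := by ring
  have hs := (hK k).1.mul_left (M * N)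
  have hs' : Summable fun l => ‖c l‖ * ‖d (k - l)‖ :=
    Summable.of_nonneg_of_le (fun _ => by positivity) hle hs
  calc conv c d k ≤ _ := hs'.tsum_le_tsum hle hs
    _ = M * N * ∑' l, wt l ^ (-p) * wt (k - l) ^ (-q) := tsum_mul_left
    _ ≤ M * N * (K * wt k ^ (-σ)) := mul_le_mul_of_nonneg_left (hK k).2 (by positivity)
    _ = _ := by ring

/-! ### Fourier trajectories and the energy inequality -/

/-- Trajectories of the Navier-Stokes equation in Fourier space, with velocity `W`. -/
structure IsFlow (κ μ : ℝ) (G : Seq) (U W : ℝ → Seq) : Prop where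
  hasDeriv : ∀ t, HasDerivAt U (W t) t
  eqn : ∀ t k, W t k = G k - ((μ * ‖freqVec k‖ ^ 2 : ℝ) : ℂ) * U t k - bil κ k (U t) (U t)
  zero : ∀ t, U t 0 = 0
  skew : ∀ t k, U t (-k) = -conj (U t k)
  reg : ∀ t, Summable fun k => (wt k ^ 2 * ‖U t k‖) ^ 2

/-- The `H¹`-norm of a sequence of Fourier coefficients. -/
def h1 (c : Freq → ℂ) : ℝ := Real.sqrt (∑' k, (wt k * ‖c k‖) ^ 2)

lemma h1_nonneg (c : Freq → ℂ) : 0 ≤ h1 c := Real.sqrt_nonneg _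

lemma h1_sq (c : Freq → ℂ) : h1 c ^ 2 = ∑' k, (wt k * ‖c k‖) ^ 2 :=
  Real.sq_sqrt (tsum_nonneg fun _ => sq_nonneg _)

lemma sum_le_h1_sq {c : Freq → ℂ} (h : Summable fun k => (wt k * ‖c k‖) ^ 2) (s : Finset Freq) :
    ∑ k ∈ s, (wt k * ‖c k‖) ^ 2 ≤ h1 c ^ 2 := by
  rw [h1_sq]; exact h.sum_le_tsum s fun _ _ => sq_nonneg _

lemma summable_h1_of_h2 {c : Freq → ℂ} (h : Summable fun k => (wt k ^ 2 * ‖c k‖) ^ 2) :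
    Summable fun k => (wt k * ‖c k‖) ^ 2 := by
  refine Summable.of_nonneg_of_le (fun _ => sq_nonneg _) (fun k => ?_) h
  have := one_le_wt k
  have h2 : wt k ≤ wt k ^ 2 := by nlinarith
  have := wt_pos k
  gcongr

/-- Two derivatives in `ℓ²` suffice in dimension two: `‖c k‖` is the product of `wt k ^ 2 * ‖c k‖`
and `wt k ^ (-2)`, and both squares are summable. -/
lemma summable_norm_of_h2 {c : Freq → ℂ} (h : Summable fun k => (wt k ^ 2 * ‖c k‖) ^ 2) :
    Summable fun k => ‖c k‖ := by
  have h4 : Summable fun k : Freq => wt k ^ (-4 : ℝ) := summable_wt_rpow (by norm_num)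
  refine Summable.of_nonneg_of_le (fun _ => norm_nonneg _) (fun k => ?_) (h.add h4)
  have hw := wt_pos k
  rw [Real.rpow_neg hw.le, show (4 : ℝ) = (4 : ℕ) by norm_num, Real.rpow_natCast]
  have : ‖c k‖ = (wt k ^ 2 * ‖c k‖) * (wt k ^ 2)⁻¹ := by field_simp
  have e : (wt k ^ 4)⁻¹ = ((wt k ^ 2)⁻¹) ^ 2 := by rw [inv_pow]; ring_nf
  rw [e]
  nlinarith [sq_nonneg ((wt k ^ 2 * ‖c k‖) - (wt k ^ 2)⁻¹), sq_nonneg (wt k ^ 2 * ‖c k‖),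
    sq_nonneg (wt k ^ 2)⁻¹]

lemma wt_norm_le_h1 {c : Freq → ℂ} (h : Summable fun k => (wt k * ‖c k‖) ^ 2) (k : Freq) :
    wt k * ‖c k‖ ≤ h1 c := by
  apply le_of_sq_le_sq _ (h1_nonneg c)
  simpa using sum_le_h1_sq h {k}

/-- The terms of the trilinear form `⟨B(c, c), c⟩`. -/
def triTerm (κ : ℝ) (c : Freq → ℂ) (x : Freq × Freq) : ℂ :=
  kernel κ x.1 x.2 * c x.2 * c (x.1 - x.2) * conj (c x.1)

/-- The kernel's factor `wt k` is absorbed by the coefficient at `k`, leaving a product of two `ℓ¹`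
sequences. Absolute summability is what permits rearranging the double sum. -/
lemma summable_triTerm {κ : ℝ} (hκ : 0 ≤ κ) {c : Freq → ℂ}
    (h : Summable fun k => (wt k ^ 2 * ‖c k‖) ^ 2) : Summable (triTerm κ c) := by
  have h1s := summable_norm_of_h2 h
  have hp : Summable fun x : Freq × Freq => ‖c x.2‖ * ‖c (x.1 - x.2)‖ := by
    have := h1s.mul_of_nonneg h1s (fun _ => norm_nonneg _) (fun _ => norm_nonneg _)
    let e : Freq × Freq ≃ Freq × Freq :=
      ⟨fun x => (x.2, x.1 - x.2), fun x => (x.2 + x.1, x.1), fun x => by simp, fun x => by simp⟩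
    exact e.summable_iff.mpr this
  refine Summable.of_norm_bounded (hp.mul_left (κ * h1 c)) fun x => ?_
  rw [triTerm, norm_mul, RCLike.norm_conj]
  calc _ ≤ κ * wt x.1 * (‖c x.2‖ * ‖c (x.1 - x.2)‖) * ‖c x.1‖ :=
        mul_le_mul_of_nonneg_right (norm_bil_term_le hκ _ _ _ _) (norm_nonneg _)
    _ = κ * (wt x.1 * ‖c x.1‖) * (‖c x.2‖ * ‖c (x.1 - x.2)‖) := by ring
    _ ≤ _ := by
        refine mul_le_mul_of_nonneg_right (mul_le_mul_of_nonneg_left ?_ hκ) (by positivity)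
        exact wt_norm_le_h1 (summable_h1_of_h2 h) _

/-- The involution `(k, l) ↦ (l - k, l)` changes the sign of every term of the trilinear sum, by
`kernel_swap` and the reality condition `hc`. So the sum equals its own negative. -/
lemma hasSum_bil_self {κ : ℝ} (hκ : 0 ≤ κ) {c : Freq → ℂ}
    (h : Summable fun k => (wt k ^ 2 * ‖c k‖) ^ 2) (hc : ∀ k, c (-k) = -conj (c k)) :
    HasSum (fun k => conj (c k) * bil κ k c c) 0 := by
  have hs := summable_triTerm hκ h
  have h0 : ∑' x, triTerm κ c x = 0 := by
    let e : Freq × Freq ≃ Freq × Freq :=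
      ⟨fun x => (x.2 - x.1, x.2), fun x => (x.2 - x.1, x.2), fun x => by simp, fun x => by simp⟩
    have h1 : ∑' x, triTerm κ c (e x) = ∑' x, triTerm κ c x := e.tsum_eq _
    have h2 (x : Freq × Freq) : triTerm κ c (e x) = -triTerm κ c x := by
      obtain ⟨k, l⟩ := x
      simp only [triTerm, e, Equiv.coe_fn_mk, kernel_swap]
      rw [show l - k - l = -k by abel, show l - k = -(k - l) by abel, hc, hc, map_neg,
        Complex.conj_conj]
      ring
    simp_rw [h2, tsum_neg] at h1
    exact self_eq_neg.mp h1.symm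
  have h3 := hs.hasSum.prod_fiberwise fun k => (hs.prod_factor k).hasSum
  rw [h0] at h3
  convert h3 using 2 with k
  rw [bil, mul_comm, ← tsum_mul_right]
  rfl

lemma real_inner_mul_complex (x y : ℂ) : inner ℝ x y = (conj x * y).re := by
  rw [Complex.inner, mul_comm]

section Flow

variable {κ μ : ℝ} {G : Seq} {U W : ℝ → Seq}

lemma IsFlow.inner_coeff (h : IsFlow κ μ G U W) (t : ℝ) (k : Freq) :
    inner ℝ (U t k) (W t k) = inner ℝ (U t k) (G k) - μ * (wt k * ‖U t k‖) ^ 2 -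
      (conj (U t k) * bil κ k (U t) (U t)).re := by
  have e : (conj (U t k) * (((μ * ‖freqVec k‖ ^ 2 : ℝ) : ℂ) * U t k)).re =
      μ * (wt k * ‖U t k‖) ^ 2 := by
    rw [mul_left_comm, ← Complex.normSq_eq_conj_mul_self, ← Complex.ofReal_mul,
      Complex.ofReal_re, Complex.normSq_eq_norm_sq]
    -- The weights `wt k` and `‖freqVec k‖` differ only at `k = 0`, where the coefficient is zero.
    by_cases hk : k = 0
    · subst hk; rw [h.zero]; simp
    · rw [wt_eq hk]; ring
  rw [h.eqn t k, inner_sub_right, inner_sub_right, real_inner_mul_complex (U t k) (bil _ _ _ _),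
    real_inner_mul_complex (U t k) (_ * _), e]

/-- The energy inequality. -/
lemma IsFlow.energy (h : IsFlow κ μ G U W) (hκ : 0 ≤ κ) (t : ℝ) :
    inner ℝ (U t) (W t) ≤ ‖U t‖ * ‖G‖ - μ * h1 (U t) ^ 2 := by
  have h1' : HasSum (fun k => inner ℝ (U t k) (W t k)) (inner ℝ (U t) (W t)) := lp.hasSum_inner _ _
  have h2 : HasSum (fun k => inner ℝ (U t k) (G k)) (inner ℝ (U t) G) := lp.hasSum_inner _ _
  have h3 : HasSum (fun k => (wt k * ‖U t k‖) ^ 2) (h1 (U t) ^ 2) := by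
    rw [h1_sq]; exact (summable_h1_of_h2 (h.reg t)).hasSum
  have h4 := Complex.hasSum_re (hasSum_bil_self hκ (h.reg t) (h.skew t))
  have h5 := (h2.sub (h3.mul_left μ)).sub h4
  simp_rw [← h.inner_coeff t] at h5
  rw [h1'.unique h5]
  simp only [Complex.zero_re, sub_zero]
  linarith [real_inner_le_norm (U t) G]

/-- `ladyzhenskaya` passed from finite sets to series and reindexed by `(k, l) ↦ (l, k - l)`; the
constant is `24 = √576`. -/
lemma tsum_mul_conv_le {a : Freq → ℝ} (ha : ∀ k, 0 ≤ a k) {A : ℝ} (hA0 : 0 ≤ A)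
    (hA : ∀ s : Finset Freq, ∑ k ∈ s, a k ^ 2 ≤ A ^ 2) (c d : Seq)
    (hc : Summable fun k => (wt k * ‖c k‖) ^ 2) (hd : Summable fun k => (wt k * ‖d k‖) ^ 2) :
    (Summable fun k => a k * conv c d k) ∧ ∑' k, a k * conv c d k ≤
      24 * A * Real.sqrt ((‖c‖ * h1 c) * (‖d‖ * h1 d)) := by
  have hq := h1_nonneg c
  have hq' := h1_nonneg d
  set B := 24 * A * Real.sqrt ((‖c‖ * h1 c) * (‖d‖ * h1 d)) with hB
  have key (s : Finset (Freq × Freq)) : ∑ x ∈ s, a (x.1 + x.2) * ‖c x.1‖ * ‖d x.2‖ ≤ B := by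
    apply le_of_sq_le_sq _ (by positivity)
    refine (ladyzhenskaya a (fun k => ‖c k‖) (fun k => ‖d k‖) ha (fun _ => norm_nonneg _)
      (fun _ => norm_nonneg _) hA0 (norm_nonneg c) (h1_nonneg c) (norm_nonneg d) (h1_nonneg d) hA
      (sum_norm_sq_le c) (sum_le_h1_sq hc) (sum_norm_sq_le d) (sum_le_h1_sq hd) s).trans_eq ?_
    rw [hB, mul_pow, Real.sq_sqrt (by positivity)]; ring
  have hn (x : Freq × Freq) : 0 ≤ a (x.1 + x.2) * ‖c x.1‖ * ‖d x.2‖ :=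
    mul_nonneg (mul_nonneg (ha _) (norm_nonneg _)) (norm_nonneg _)
  have hs := summable_of_sum_le hn key
  have hle := hs.tsum_le_of_sum_le key
  let e : Freq × Freq ≃ Freq × Freq :=
    ⟨fun x => (x.2, x.1 - x.2), fun x => (x.2 + x.1, x.1), fun x => by simp, fun x => by simp⟩
  have hs2 := e.summable_iff.mpr hs
  have ht2 := e.tsum_eq fun x : Freq × Freq => a (x.1 + x.2) * ‖c x.1‖ * ‖d x.2‖
  have h3 := hs2.hasSum.prod_fiberwise fun k => (hs2.prod_factor k).hasSum
  have e3 (k : Freq) : (∑' l, ((fun x : Freq × Freq => a (x.1 + x.2) * ‖c x.1‖ * ‖d x.2‖) ∘ e)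
      (k, l)) = a k * conv c d k := by
    rw [conv, ← tsum_mul_left]
    refine tsum_congr fun l => ?_
    simp only [e, Function.comp, Equiv.coe_fn_mk, add_sub_cancel]; ring
  simp_rw [e3] at h3
  refine ⟨h3.summable, ?_⟩
  rw [h3.tsum_eq]
  exact (le_of_eq ht2).trans hle

/-! ### Truncated enstrophy and the bound in `H¹` -/

/-- The weight `wt`, cut off at height `N`. -/
def cutWt (N : ℕ) (k : Freq) : ℝ := min (wt k) N

lemma cutWt_nonneg (N : ℕ) (k : Freq) : 0 ≤ cutWt N k := le_min (wt_pos k).le (Nat.cast_nonneg N)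

lemma cutWt_le_wt (N : ℕ) (k : Freq) : cutWt N k ≤ wt k := min_le_left _ _

lemma cutWt_le (N : ℕ) (k : Freq) : cutWt N k ≤ N := min_le_right _ _

/-- Capping the weight at a constant keeps it subadditive, so it still distributes over
convolutions. At the same time it becomes a bounded multiplier on `ℓ²`, so the truncated enstrophy
is differentiable along a curve differentiable only in `ℓ²`. -/
lemma cutWt_le_add (N : ℕ) (k l : Freq) : cutWt N k ≤ cutWt N l + cutWt N (k - l) := by
  have h : wt k ≤ wt l + wt (k - l) := by simpa using wt_add_le l (k - l)
  have h1 := wt_pos l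
  have h2 := wt_pos (k - l)
  have h3 : (0 : ℝ) ≤ N := Nat.cast_nonneg N
  unfold cutWt
  rcases le_total (wt l) N with h4 | h4 <;> rcases le_total (wt (k - l)) N with h5 | h5 <;>
    simp only [min_eq_left, min_eq_right, h4, h5]
  · exact (min_le_left _ _).trans h
  · exact (min_le_right _ _).trans (by linarith)
  · exact (min_le_right _ _).trans (by linarith)
  · exact (min_le_right _ _).trans (by linarith)

lemma memℓp_cut (N : ℕ) (c : Seq) : Memℓp (fun k => (cutWt N k) • c k) 2 := by
  apply memℓp_gen
  have : Summable fun k => (N : ℝ) ^ 2 * ‖c k‖ ^ 2 := (summable_norm_sq c).mul_left _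
  refine Summable.of_nonneg_of_le (fun _ => by positivity) (fun k => ?_) this
  rw [norm_smul, Real.norm_of_nonneg (cutWt_nonneg N k)]
  simp only [ENNReal.toReal_ofNat, Real.rpow_two, mul_pow]
  have := cutWt_nonneg N k
  have := cutWt_le N k
  gcongr

/-- Multiplication by the cut-off weight. -/
def cut (N : ℕ) : Seq →L[ℝ] Seq :=
  LinearMap.mkContinuous
    ⟨⟨fun c => ⟨fun k => (cutWt N k) • c k, memℓp_cut N c⟩, fun c d => by
      ext k; exact smul_add _ _ _⟩, fun r c => by
      ext k; exact smul_comm (cutWt N k) r (c k)⟩ N fun c => by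
      apply le_of_sq_le_sq _ (by positivity)
      rw [norm_sq_eq_tsum, mul_pow, norm_sq_eq_tsum, ← tsum_mul_left]
      have hle (k : Freq) : ‖(cutWt N k) • c k‖ ^ 2 ≤ (N : ℝ) ^ 2 * ‖c k‖ ^ 2 := by
        rw [norm_smul, Real.norm_of_nonneg (cutWt_nonneg N k), mul_pow]
        have := cutWt_nonneg N k
        have := cutWt_le N k
        gcongr
      have hs := (summable_norm_sq c).mul_left ((N : ℝ) ^ 2)
      exact (Summable.of_nonneg_of_le (fun _ => sq_nonneg _) hle hs).tsum_le_tsum hle hs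

lemma cut_apply (N : ℕ) (c : Seq) (k : Freq) : cut N c k = (cutWt N k) • c k := rfl

lemma norm_cut_apply (N : ℕ) (c : Seq) (k : Freq) : ‖cut N c k‖ = cutWt N k * ‖c k‖ := by
  rw [cut_apply, norm_smul, Real.norm_of_nonneg (cutWt_nonneg N k)]

/-- A Leibniz rule: subadditivity places the weight on either factor, and the two resulting
convolutions coincide by symmetry. -/
lemma cutWt_mul_conv_le (N : ℕ) (c : Seq) (k : Freq) :
    cutWt N k * conv c c k ≤ 2 * conv c (cut N c) k := by
  have s1 := summable_conv c (cut N c) k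
  have s2 := summable_conv (cut N c) c k
  rw [two_mul]
  nth_rw 2 [conv_comm]
  rw [conv, conv, conv, ← s2.tsum_add s1, ← tsum_mul_left]
  refine ((summable_conv c c k).mul_left _).tsum_le_tsum (fun l => ?_) (s2.add s1)
  rw [norm_cut_apply, norm_cut_apply]
  have := mul_le_mul_of_nonneg_right (cutWt_le_add N k l)
    (mul_nonneg (norm_nonneg (c l)) (norm_nonneg (c (k - l))))
  linarith

/-- The dissipation `2 μ X²` is spent exactly: `μ X²` on the force and `μ X² / 2` in each of two
applications of Young's inequality to the nonlinear term, which has order `3 / 2` in `X`. -/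
lemma young_absorb {μ K X g s : ℝ} (hμ : 0 < μ) (hX : 0 ≤ X) (hs : 0 ≤ s) :
    2 * (X * g - μ * X ^ 2 + K * (X * Real.sqrt (s * X))) ≤
      g ^ 2 / μ + 2 * K ^ 4 / μ ^ 3 * s ^ 2 := by
  set r := Real.sqrt (s * X) with hr
  have hr2 : r ^ 2 = s * X := Real.sq_sqrt (by positivity)
  have h1 : 2 * (X * g) ≤ μ * X ^ 2 + g ^ 2 / μ := by
    have : 0 ≤ (μ * X - g) ^ 2 / μ := by positivity
    have e : (μ * X - g) ^ 2 / μ = μ * X ^ 2 - 2 * (X * g) + g ^ 2 / μ := by field_simp; ring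
    linarith
  have h2 : 2 * (K * (X * r)) ≤ μ / 2 * X ^ 2 + 2 * K ^ 2 / μ * r ^ 2 := by
    have : 0 ≤ (μ * X - 2 * K * r) ^ 2 / (2 * μ) := by positivity
    have e : (μ * X - 2 * K * r) ^ 2 / (2 * μ) =
        μ / 2 * X ^ 2 - 2 * (K * (X * r)) + 2 * K ^ 2 / μ * r ^ 2 := by field_simp; ring
    linarith
  have h3 : 2 * K ^ 2 / μ * (s * X) ≤ μ / 2 * X ^ 2 + 2 * K ^ 4 / μ ^ 3 * s ^ 2 := by
    have : 0 ≤ (μ * X - 2 * K ^ 2 / μ * s) ^ 2 / (2 * μ) := by positivity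
    have e : (μ * X - 2 * K ^ 2 / μ * s) ^ 2 / (2 * μ) =
        μ / 2 * X ^ 2 - 2 * K ^ 2 / μ * (s * X) + 2 * K ^ 4 / μ ^ 3 * s ^ 2 := by
      field_simp; ring
    linarith
  rw [hr2] at h2
  linarith

/-- The cut-off enstrophy inequality. -/
lemma IsFlow.cut_energy (h : IsFlow κ μ G U W) (hκ : 0 ≤ κ) (hμ : 0 < μ) (N : ℕ) (t : ℝ) :
    2 * inner ℝ (cut N (U t)) (cut N (W t)) ≤ ‖G‖ ^ 2 / μ +
      2 * (48 * κ) ^ 4 / μ ^ 3 * (‖U t‖ * h1 (U t) * ‖cut N (U t)‖) ^ 2 := by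
  set c := U t with hc
  have hr2 : Summable fun k => (wt k ^ 2 * ‖c k‖) ^ 2 := h.reg t
  have hr1 := summable_h1_of_h2 hr2
  have hle (k : Freq) : wt k * ‖cut N c k‖ ≤ wt k ^ 2 * ‖c k‖ := by
    rw [norm_cut_apply, pow_two, mul_assoc]
    have := wt_pos k
    have := cutWt_le_wt N k
    gcongr
  have hrd : Summable fun k => (wt k * ‖cut N c k‖) ^ 2 :=
    Summable.of_nonneg_of_le (fun _ => sq_nonneg _)
      (fun k => pow_le_pow_left₀ (by have := wt_pos k; positivity) (hle k) 2) hr2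
  set X := h1 (cut N c) with hX
  have hX0 : 0 ≤ X := h1_nonneg _
  have ha0 (k : Freq) : 0 ≤ wt k * ‖cut N c k‖ := mul_nonneg (wt_pos k).le (norm_nonneg _)
  obtain ⟨st, ht⟩ := tsum_mul_conv_le ha0 hX0 (sum_le_h1_sq hrd) c (cut N c) hr1 hrd
  obtain ⟨sg, hg⟩ := summable_mul_and_tsum_le ha0 (fun k => norm_nonneg (G k)) hX0
    (norm_nonneg G) (sum_le_h1_sq hrd) (sum_norm_sq_le G)
  have hsum : HasSum (fun k => inner ℝ (cut N c k) (cut N (W t) k))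
      (inner ℝ (cut N c) (cut N (W t))) := lp.hasSum_inner _ _
  have hXsum : HasSum (fun k => (wt k * ‖cut N c k‖) ^ 2) (X ^ 2) := by
    rw [hX, h1_sq]; exact hrd.hasSum
  have hterm (k : Freq) : inner ℝ (cut N c k) (cut N (W t) k) ≤
      (wt k * ‖cut N c k‖) * ‖G k‖ - μ * (wt k * ‖cut N c k‖) ^ 2 +
        2 * κ * ((wt k * ‖cut N c k‖) * conv c (cut N c) k) := by
    rw [cut_apply, cut_apply, inner_smul_left, inner_smul_right, h.inner_coeff, ← hc,
      norm_smul, Real.norm_of_nonneg (cutWt_nonneg N k)]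
    simp only [conj_trivial]
    set m := cutWt N k with hm
    have hm0 : 0 ≤ m := cutWt_nonneg N k
    have hmw : m ≤ wt k := cutWt_le_wt N k
    have hn := norm_nonneg (c k)
    have hw := wt_pos k
    have t1 : m * (m * inner ℝ (c k) (G k)) ≤ wt k * (m * ‖c k‖) * ‖G k‖ := by
      calc m * (m * inner ℝ (c k) (G k)) ≤ m * (m * (‖c k‖ * ‖G k‖)) := by
            have := real_inner_le_norm (c k) (G k); gcongr
        _ ≤ wt k * (m * (‖c k‖ * ‖G k‖)) := by gcongr
        _ = _ := by ring
    -- No cancellation is used here. The kernel's `wt k` and one truncated weight go to the test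
    -- coefficient, forming a term of `X`; the other truncated weight is distributed over the
    -- convolution.
    have t3 : -(m * (m * (conj (c k) * bil κ k c c).re)) ≤
        2 * κ * ((wt k * (m * ‖c k‖)) * conv c (cut N c) k) := by
      have b1 : -(conj (c k) * bil κ k c c).re ≤ ‖c k‖ * (κ * wt k * conv c c k) := by
        refine (neg_le_abs _).trans ((Complex.abs_re_le_norm _).trans ?_)
        rw [norm_mul, RCLike.norm_conj]
        exact mul_le_mul_of_nonneg_left (norm_bil_le hκ k c c) hn
      have b2 := cutWt_mul_conv_le N c k
      rw [← hm] at b2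
      calc _ = m * m * -(conj (c k) * bil κ k c c).re := by ring
        _ ≤ m * m * (‖c k‖ * (κ * wt k * conv c c k)) := by gcongr
        _ = κ * (wt k * (m * ‖c k‖)) * (m * conv c c k) := by ring
        _ ≤ κ * (wt k * (m * ‖c k‖)) * (2 * conv c (cut N c) k) := by gcongr
        _ = _ := by ring
    have e : m * (m * (inner ℝ (c k) (G k) - μ * (wt k * ‖c k‖) ^ 2 -
        (conj (c k) * bil κ k c c).re)) = m * (m * inner ℝ (c k) (G k)) -
        μ * (wt k * (m * ‖c k‖)) ^ 2 - m * (m * (conj (c k) * bil κ k c c).re) := by ring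
    rw [e]; linarith
  have hrhs := (sg.hasSum.sub (hXsum.mul_left μ)).add (st.hasSum.mul_left (2 * κ))
  have hfin := hasSum_le hterm hsum hrhs
  -- The constant is `48 κ = 2 κ · 24`, the 24 coming from `tsum_mul_conv_le`.
  have hfin2 : inner ℝ (cut N c) (cut N (W t)) ≤ X * ‖G‖ - μ * X ^ 2 +
      48 * κ * (X * Real.sqrt ((‖c‖ * h1 c * ‖cut N c‖) * X)) := by
    have e : (‖c‖ * h1 c) * (‖cut N c‖ * X) = (‖c‖ * h1 c * ‖cut N c‖) * X := by ring
    rw [e] at ht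
    have := mul_le_mul_of_nonneg_left ht (mul_nonneg zero_le_two hκ)
    linarith
  have := young_absorb (K := 48 * κ) (g := ‖G‖) (s := ‖c‖ * h1 c * ‖cut N c‖) hμ hX0
    (mul_nonneg (mul_nonneg (norm_nonneg _) (h1_nonneg _)) (norm_nonneg _))
  linarith

/-- A Gronwall inequality whose integrating factor is the exponential of a function `z`. -/
lemma gronwall_exp {y z y' z' : ℝ → ℝ} {a b C₁ C₂ C₃ M : ℝ}
    (hy : ∀ t, HasDerivAt y (y' t) t) (hz : ∀ t, HasDerivAt z (z' t) t) (hC₁ : 0 ≤ C₁)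
    (hy0 : ∀ t, 0 ≤ y t) (hle : ∀ t ∈ Icc a b, y' t ≤ C₁ + C₂ * (C₃ - z' t) * y t)
    (hM : ∀ t ∈ Icc a b, |C₂ * (z t - C₃ * t)| ≤ M) {t : ℝ} (ht : t ∈ Icc a b) :
    y t ≤ Real.exp M * (y a * Real.exp M + C₁ * Real.exp M * (b - a)) := by
  have hder (s : ℝ) : HasDerivAt (fun s => y s * Real.exp (C₂ * (z s - C₃ * s)))
      ((y' s + C₂ * (z' s - C₃) * y s) * Real.exp (C₂ * (z s - C₃ * s))) s := by
    have h1 : HasDerivAt (fun s => C₂ * (z s - C₃ * s)) (C₂ * (z' s - C₃)) s := by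
      simpa using ((hz s).sub ((hasDerivAt_id s).const_mul C₃)).const_mul C₂
    refine ((hy s).mul h1.exp).congr_deriv ?_
    ring
  have hbd : ∀ s ∈ Icc a b, deriv (fun s => y s * Real.exp (C₂ * (z s - C₃ * s))) s ≤
      C₁ * Real.exp M := fun s hs => by
    rw [(hder s).deriv]
    have h1 : y' s + C₂ * (z' s - C₃) * y s ≤ C₁ := by have := hle s hs; linarith
    have h2 := Real.exp_le_exp.mpr ((le_abs_self _).trans (hM s hs))
    calc _ ≤ C₁ * Real.exp (C₂ * (z s - C₃ * s)) :=
          mul_le_mul_of_nonneg_right h1 (Real.exp_pos _).le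
      _ ≤ _ := mul_le_mul_of_nonneg_left h2 hC₁
  have hab : a ≤ b := ht.1.trans ht.2
  have key := (convex_Icc a b).image_sub_le_mul_sub_of_deriv_le
    (f := fun s => y s * Real.exp (C₂ * (z s - C₃ * s)))
    (fun s _ => (hder s).continuousAt.continuousWithinAt)
    (fun s _ => (hder s).differentiableAt.differentiableWithinAt)
    (fun s hs => hbd s (interior_subset hs)) a ⟨le_rfl, hab⟩ t ht ht.1
  have ha := Real.exp_le_exp.mpr ((le_abs_self _).trans (hM a ⟨le_rfl, hab⟩))
  have ht' := Real.exp_le_exp.mpr ((neg_le_abs _).trans (hM t ht))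
  have h1 : C₁ * Real.exp M * (t - a) ≤ C₁ * Real.exp M * (b - a) :=
    mul_le_mul_of_nonneg_left (by linarith [ht.2]) (mul_nonneg hC₁ (Real.exp_pos _).le)
  have h2 := mul_le_mul_of_nonneg_left ha (hy0 a)
  have h3 : y t * Real.exp (C₂ * (z t - C₃ * t)) ≤
      y a * Real.exp M + C₁ * Real.exp M * (b - a) := by linarith
  have h4 : 0 ≤ y t * Real.exp (C₂ * (z t - C₃ * t)) := mul_nonneg (hy0 t) (Real.exp_pos _).le
  calc y t = Real.exp (-(C₂ * (z t - C₃ * t))) * (y t * Real.exp (C₂ * (z t - C₃ * t))) := by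
        rw [mul_left_comm, ← Real.exp_add]; simp
    _ ≤ Real.exp M * (y t * Real.exp (C₂ * (z t - C₃ * t))) :=
        mul_le_mul_of_nonneg_right ht' h4
    _ ≤ _ := mul_le_mul_of_nonneg_left h3 (Real.exp_pos _).le

lemma IsFlow.norm_bounded (h : IsFlow κ μ G U W) (T : ℝ) : ∃ R, 0 ≤ R ∧ ∀ t, |t| ≤ T → ‖U t‖ ≤ R := by
  have hc : Continuous U := continuous_iff_continuousAt.mpr fun t => (h.hasDeriv t).continuousAt
  obtain ⟨R, hR⟩ := (isCompact_Icc (a := -T) (b := T)).exists_bound_of_continuousOn hc.continuousOn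
  exact ⟨|R|, abs_nonneg R, fun t ht => (hR t (abs_le.mp ht)).trans (le_abs_self R)⟩

lemma norm_cut_le_h1 {c : Seq} (hc : Summable fun k => (wt k * ‖c k‖) ^ 2) (N : ℕ) :
    ‖cut N c‖ ≤ h1 c := by
  apply le_of_sq_le_sq _ (h1_nonneg c)
  rw [norm_sq_eq_tsum, h1_sq]
  refine (summable_norm_sq _).tsum_le_tsum (fun k => ?_) hc
  rw [norm_cut_apply]
  have := cutWt_nonneg N k
  have := cutWt_le_wt N k
  gcongr

lemma sum_le_of_norm_cut_le {c : Seq} {C : ℝ} (h : ∀ N, ‖cut N c‖ ^ 2 ≤ C) (s : Finset Freq) :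
    ∑ k ∈ s, (wt k * ‖c k‖) ^ 2 ≤ C := by
  obtain ⟨N, hN⟩ : ∃ N : ℕ, ∀ k ∈ s, wt k ≤ N := by
    obtain ⟨M, hM⟩ := (s.image wt).exists_le
    obtain ⟨N, hN⟩ := exists_nat_ge M
    exact ⟨N, fun k hk => (hM _ (Finset.mem_image_of_mem _ hk)).trans hN⟩
  refine le_trans (le_of_eq ?_) ((sum_norm_sq_le (cut N c) s).trans (h N))
  refine Finset.sum_congr rfl fun k hk => ?_
  rw [norm_cut_apply, cutWt, min_eq_left (hN k hk)]

/-- Trajectories are bounded in `H¹`, locally uniformly in time. -/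
theorem IsFlow.h1_bounded (h : IsFlow κ μ G U W) (hκ : 0 ≤ κ) (hμ : 0 < μ) (T : ℝ) :
    ∃ C, 0 ≤ C ∧ ∀ t, |t| ≤ T → h1 (U t) ≤ C := by
  obtain ⟨R, hR0, hR⟩ := h.norm_bounded T
  set K := 2 * (48 * κ) ^ 4 / μ ^ 3 with hK
  have hK0 : 0 ≤ K := by positivity
  -- With `z = ‖U‖²` the energy inequality gives `2 μ h1² ≤ C₃ - z'`, so the growth rate `K R² h1²`
  -- in the enstrophy inequality is at most `C₂ (C₃ - z')`. This is an exact derivative whose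
  -- primitive is bounded by `M` on `[-T, T]`, so `h1²` never has to be integrated in time.
  set C₂ := K * R ^ 2 / (2 * μ) with hC₂
  have hC₂0 : 0 ≤ C₂ := by positivity
  set C₃ := 2 * (R * ‖G‖) with hC₃
  have hC₃0 : 0 ≤ C₃ := by positivity
  set M := C₂ * (R ^ 2 + C₃ * T) with hM
  set y₀ := h1 (U (-T)) ^ 2 with hy₀
  set B := Real.exp M * (y₀ * Real.exp M + ‖G‖ ^ 2 / μ * Real.exp M * (T - -T)) with hB
  -- The bound `B` depends on neither `N` nor `t`: the initial truncated enstrophy is at most `y₀`,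
  -- finite because the trajectory is regular at the single time `-T`. Hence the truncation can be
  -- removed afterwards.
  have key (t : ℝ) (ht : |t| ≤ T) (N : ℕ) : ‖cut N (U t)‖ ^ 2 ≤ B := by
    have hT : 0 ≤ T := (abs_nonneg t).trans ht
    have hz (s : ℝ) : HasDerivAt (fun s => ‖U s‖ ^ 2) (2 * inner ℝ (U s) (W s)) s :=
      (h.hasDeriv s).norm_sq
    have hy (s : ℝ) : HasDerivAt (fun s => ‖cut N (U s)‖ ^ 2)
        (2 * inner ℝ (cut N (U s)) (cut N (W s))) s :=
      ((cut N).hasFDerivAt.comp_hasDerivAt s (h.hasDeriv s)).norm_sq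
    have := gronwall_exp (a := -T) (b := T) (C₁ := ‖G‖ ^ 2 / μ) (C₂ := C₂) (C₃ := C₃) (M := M)
      hy hz (by positivity) (fun s => sq_nonneg _) (fun s hs => ?_) (fun s hs => ?_)
      (abs_le.mp ht)
    · refine this.trans ?_
      have h0 := norm_cut_le_h1 (summable_h1_of_h2 (h.reg (-T))) N
      rw [hB, hy₀]
      gcongr
    · refine (h.cut_energy hκ hμ N s).trans ?_
      have e1 := h.energy hκ s
      have e2 := hR s (abs_le.mpr hs)
      have e3 : 2 * μ * h1 (U s) ^ 2 ≤ C₃ - 2 * inner ℝ (U s) (W s) := by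
        have := mul_le_mul_of_nonneg_right e2 (norm_nonneg G)
        linarith
      have e4 : ‖U s‖ ^ 2 ≤ R ^ 2 := pow_le_pow_left₀ (norm_nonneg _) e2 2
      have e5 : C₂ * (2 * μ * h1 (U s) ^ 2) = K * (R ^ 2 * h1 (U s) ^ 2) := by
        rw [hC₂]; field_simp
      have e6 := mul_le_mul_of_nonneg_left e3 hC₂0
      rw [e5] at e6
      have e7 : (‖U s‖ * h1 (U s) * ‖cut N (U s)‖) ^ 2 =
        ‖U s‖ ^ 2 * h1 (U s) ^ 2 * ‖cut N (U s)‖ ^ 2 := by ring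
      rw [e7]
      have e8 : K * (‖U s‖ ^ 2 * h1 (U s) ^ 2 * ‖cut N (U s)‖ ^ 2) ≤
          K * (R ^ 2 * h1 (U s) ^ 2) * ‖cut N (U s)‖ ^ 2 := by
        rw [← mul_assoc]; gcongr
      have e9 := mul_le_mul_of_nonneg_right e6 (sq_nonneg ‖cut N (U s)‖)
      linarith
    · have e2 := pow_le_pow_left₀ (norm_nonneg _) (hR s (abs_le.mpr hs)) 2
      have e3 : |‖U s‖ ^ 2 - C₃ * s| ≤ R ^ 2 + C₃ * T := by
        refine (abs_sub _ _).trans ?_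
        rw [abs_of_nonneg (sq_nonneg _), abs_mul, abs_of_nonneg hC₃0]
        have := abs_le.mpr hs
        gcongr
      rw [abs_mul, abs_of_nonneg hC₂0]
      exact mul_le_mul_of_nonneg_left e3 hC₂0
  refine ⟨Real.sqrt B, Real.sqrt_nonneg B, fun t ht => ?_⟩
  refine Real.sqrt_le_sqrt ?_
  exact (summable_h1_of_h2 (h.reg t)).tsum_le_of_sum_le (sum_le_of_norm_cut_le (key t ht))

/-! ### Bootstrap of decay rates for solution, velocity and force -/

/-- Algebraic decay at rate `p`, locally uniformly in time. -/
def Decays (p : ℝ) (y : ℝ → Freq → ℂ) : Prop :=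
  ∀ T, ∃ C, 0 ≤ C ∧ ∀ t, |t| ≤ T → ∀ k, ‖y t k‖ ≤ C * wt k ^ (-p)

/-- Subadditivity moves `wt k` onto one factor, and Cauchy-Schwarz finishes. Thus an `H¹` bound
makes the coefficients of the nonlinearity bounded in `k`, despite the derivative in it. -/
lemma wt_mul_conv_le {c : Seq} (hc : Summable fun k => (wt k * ‖c k‖) ^ 2) (k : Freq) :
    wt k * conv c c k ≤ 2 * (h1 c * ‖c‖) := by
  obtain ⟨s1, t1⟩ := summable_mul_and_tsum_le (fun l => mul_nonneg (wt_pos l).le (norm_nonneg (c l)))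
    (fun l => norm_nonneg (c (k - l))) (h1_nonneg c) (norm_nonneg c) (sum_le_h1_sq hc)
    (sum_norm_sq_sub_le c k)
  have s2 : Summable fun l => ‖c l‖ * (wt (k - l) * ‖c (k - l)‖) := by
    have := (Equiv.subLeft k).summable_iff.mpr s1
    refine this.congr fun l => ?_
    simp [Function.comp, mul_comm]
  have t2 : ∑' l, ‖c l‖ * (wt (k - l) * ‖c (k - l)‖) = ∑' l, wt l * ‖c l‖ * ‖c (k - l)‖ := by
    rw [← (Equiv.subLeft k).tsum_eq]
    refine tsum_congr fun l => ?_
    simp [mul_comm]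
  calc wt k * conv c c k = ∑' l, wt k * (‖c l‖ * ‖c (k - l)‖) := tsum_mul_left.symm
    _ ≤ ∑' l, (wt l * ‖c l‖ * ‖c (k - l)‖ + ‖c l‖ * (wt (k - l) * ‖c (k - l)‖)) := by
        refine ((summable_conv c c k).mul_left _).tsum_le_tsum (fun l => ?_) (s1.add s2)
        have h : wt k ≤ wt l + wt (k - l) := by simpa using wt_add_le l (k - l)
        have := mul_le_mul_of_nonneg_right h
          (mul_nonneg (norm_nonneg (c l)) (norm_nonneg (c (k - l))))
        linarith
    _ ≤ _ := by rw [s1.tsum_add s2, t2]; linarith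

lemma wt_mul_rpow (k : Freq) (p : ℝ) : wt k * wt k ^ (-p) = wt k ^ (-(p - 1)) := by
  rw [show -(p - 1) = 1 + -p by ring, Real.rpow_add (wt_pos k), Real.rpow_one]

/-- Decay of the nonlinearity. -/
lemma bil_decay (hκ : 0 ≤ κ) {p q σ : ℝ} (hσ : 0 ≤ σ) (hp : σ ≤ p) (hq : σ ≤ q)
    (hpq : 2 < p + q - σ) {U V : ℝ → Seq} (hU : Decays p fun t => U t)
    (hV : Decays q fun t => V t) : Decays (σ - 1) fun t k => bil κ k (U t) (V t) := by
  obtain ⟨K, hK0, hK⟩ := conv_le_of_decay hσ hp hq hpq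
  intro T
  obtain ⟨M, hM0, hM⟩ := hU T
  obtain ⟨N, hN0, hN⟩ := hV T
  refine ⟨κ * (M * N * K), by positivity, fun t ht k => ?_⟩
  have hw := wt_pos k
  calc _ ≤ κ * wt k * conv (U t) (V t) k := norm_bil_le hκ _ _ _
    _ ≤ κ * wt k * (M * N * K * wt k ^ (-σ)) :=
        mul_le_mul_of_nonneg_left (hK _ _ M N hM0 (hM t ht) (hN t ht) k) (by positivity)
    _ = κ * (M * N * K) * (wt k * wt k ^ (-σ)) := by ring
    _ = _ := by rw [wt_mul_rpow]

lemma norm_bil_comm_le (hκ : 0 ≤ κ) (k : Freq) (c d : Seq) :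
    ‖bil κ k d c‖ ≤ κ * wt k * conv c d k := by
  rw [conv_comm]; exact norm_bil_le hκ k d c

lemma IsFlow.ode (h : IsFlow κ μ G U W) (t : ℝ) (k : Freq) : HasDerivAt (fun s => U s k)
    (-(((μ * ‖freqVec k‖ ^ 2 : ℝ) : ℂ) * U t k) + (G k - bil κ k (U t) (U t))) t := by
  refine (hasDerivAt_coeff (h.hasDeriv t) k).congr_deriv ?_
  rw [h.eqn]; ring

/-- Differentiating the equation at one frequency eliminates the constant force. Only the
coefficients of `W` are differentiated; no derivative of `W` in `ℓ²` is claimed. -/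
lemma IsFlow.ode_velocity (h : IsFlow κ μ G U W) (hκ : 0 ≤ κ) (t : ℝ) (k : Freq) :
    HasDerivAt (fun s => W s k) (-(((μ * ‖freqVec k‖ ^ 2 : ℝ) : ℂ) * W t k) +
      -(bil κ k (W t) (U t) + bil κ k (U t) (W t))) t := by
  have e : (fun s => W s k) = fun s => G k - ((μ * ‖freqVec k‖ ^ 2 : ℝ) : ℂ) * U s k -
      bil κ k (U s) (U s) := funext fun s => h.eqn s k
  rw [e]
  refine (((hasDerivAt_coeff (h.hasDeriv t) k).const_mul _).const_sub (G k) |>.sub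
    (hasDerivAt_bil hκ k (h.hasDeriv t))).congr_deriv ?_
  ring

lemma IsFlow.velocity_zero (h : IsFlow κ μ G U W) (t : ℝ) : W t 0 = 0 := by
  have h1 := hasDerivAt_coeff (h.hasDeriv t) 0
  simp_rw [h.zero] at h1
  exact h1.unique (hasDerivAt_const t 0)

lemma IsFlow.coeff_bounded (h : IsFlow κ μ G U W) (T : ℝ) :
    ∃ C, ∀ t, |t| ≤ T → ∀ k, ‖U t k‖ ≤ C := by
  obtain ⟨R, -, hR⟩ := h.norm_bounded T
  exact ⟨R, fun t ht k => (norm_apply_le _ k).trans (hR t ht)⟩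

/-- By the `H¹` bound the whole forcing `G - B(U, U)` is bounded in `k`, and the damping gains two
powers over it. -/
lemma IsFlow.decays_two (h : IsFlow κ μ G U W) (hκ : 0 ≤ κ) (hμ : 0 < μ) :
    Decays 2 fun t => U t := by
  intro T
  have hdec := decay_of_ode hμ (φ := fun _ => 1) (fun _ => zero_le_one) h.ode h.zero
    h.coeff_bounded (fun T => ?_) 2 T
  · obtain ⟨C, hC0, hC⟩ := hdec
    refine ⟨C * 2, by positivity, fun t ht k => (hC t ht k).trans_eq ?_⟩
    ring
  · obtain ⟨R, hR0, hR⟩ := h.norm_bounded T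
    obtain ⟨Q, hQ0, hQ⟩ := h.h1_bounded hκ hμ T
    refine ⟨‖G‖ + κ * (2 * (Q * R)), fun t ht k => ?_⟩
    rw [mul_one]
    refine (norm_sub_le _ _).trans (add_le_add (norm_apply_le G k) ?_)
    refine (norm_bil_le hκ _ _ _).trans ?_
    rw [mul_assoc]
    refine mul_le_mul_of_nonneg_left ?_ hκ
    refine (wt_mul_conv_le (summable_h1_of_h2 (h.reg t)) k).trans ?_
    have := hR t ht
    have := hQ t ht
    gcongr

/-- The convolution of two sequences of rate `a` is estimated at rate `a - 1 / 2`, because rate `a`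
itself would require `a > 2` and fails at the starting value. The kernel loses one power and the
damping gains two, a net gain of one half. -/
lemma IsFlow.decays_succ (h : IsFlow κ μ G U W) (hκ : 0 ≤ κ) (hμ : 0 < μ) {a : ℝ} (ha : 2 ≤ a)
    (hU : Decays a fun t => U t) {g : ℝ} (hG : ∀ k, ‖G k‖ ≤ g * wt k ^ (-(a - 3 / 2))) :
    Decays (a + 1 / 2) fun t => U t := by
  have hB := bil_decay hκ (σ := a - 1 / 2) (by linarith) (by linarith) (by linarith)
    (by linarith) hU hU
  intro T
  have hdec := decay_of_ode hμ (φ := fun k => wt k ^ (-(a - 3 / 2)))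
    (fun k => (wt_rpow_pos k _).le) h.ode h.zero h.coeff_bounded (fun T => ?_) (a + 1 / 2) T
  · obtain ⟨C, hC0, hC⟩ := hdec
    refine ⟨C * 2, by positivity, fun t ht k => (hC t ht k).trans_eq ?_⟩
    rw [← Real.rpow_add (wt_pos k), show (-2 : ℝ) + -(a - 3 / 2) = -(a + 1 / 2) by ring]; ring
  · obtain ⟨B, hB0, hB⟩ := hB T
    refine ⟨g + B, fun t ht k => (norm_sub_le _ _).trans ?_⟩
    have := hB t ht k
    rw [show a - 1 / 2 - 1 = a - 3 / 2 by ring] at this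
    linarith [hG k]

/-- The solution gains two derivatives over the force. -/
lemma IsFlow.decays_of_force (h : IsFlow κ μ G U W) (hκ : 0 ≤ κ) (hμ : 0 < μ) {b : ℕ} {g : ℝ}
    (hG : ∀ k, ‖G k‖ ≤ g * wt k ^ (-(b : ℝ))) : Decays (b + 2) fun t => U t := by
  have hg : 0 ≤ g := nonneg_of_mul_nonneg_left ((norm_nonneg _).trans (hG 0)) (wt_rpow_pos _ _)
  -- Half steps from rate 2. The step from `n` to `n + 1` needs the force to decay at rate `(n + 1)
  -- / 2`, which is at most `b` as long as `n + 1 ≤ 2 * b`.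
  have key (n : ℕ) (hn : n ≤ 2 * b) : Decays (2 + n / 2) fun t => U t := by
    induction n with
    | zero => simpa using h.decays_two hκ hμ
    | succ n ih =>
      have h1 : ((n + 1 : ℕ) : ℝ) ≤ 2 * b := by exact_mod_cast hn
      push_cast at h1
      have := h.decays_succ hκ hμ (by have : (0 : ℝ) ≤ n := n.cast_nonneg; linarith)
        (ih (by omega)) (g := g) fun k => (hG k).trans
          (mul_le_mul_of_nonneg_left (wt_rpow_mono k (by linarith)) hg)
      convert this using 1
      push_cast; ring
  convert key (2 * b) le_rfl using 1
  push_cast; ring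

lemma wt_sq_mul_rpow (k : Freq) : wt k ^ 2 * wt k ^ (-2 : ℝ) = 1 := by
  rw [← Real.rpow_two, ← Real.rpow_add (wt_pos k)]; norm_num

lemma IsFlow.norm_velocity_le (h : IsFlow κ μ G U W) (hμ : 0 < μ) (t : ℝ) (k : Freq) :
    ‖W t k‖ ≤ ‖G k‖ + μ * (wt k ^ 2 * ‖U t k‖) + ‖bil κ k (U t) (U t)‖ := by
  rw [h.eqn]
  refine (norm_sub_le _ _).trans (add_le_add ((norm_sub_le _ _).trans (add_le_add le_rfl ?_)) le_rfl)
  rw [norm_mul, Complex.norm_real, Real.norm_of_nonneg (by positivity), mul_assoc]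
  have := norm_freqVec_le_wt k
  gcongr

/-- The velocity of a trajectory under a square-integrable force has some regularity. -/
lemma IsFlow.velocity_decays_one (h : IsFlow κ μ G U W) (hκ : 0 ≤ κ) (hμ : 0 < μ) :
    Decays 1 fun t => W t := by
  have hU2 := h.decays_two hκ hμ
  have hB : Decays (1 / 2) fun t k => bil κ k (U t) (U t) := by
    have := bil_decay hκ (σ := 3 / 2) (by norm_num) (by norm_num) (by norm_num) (by norm_num)
      hU2 hU2
    convert this using 1; norm_num
  -- A square-summable force has no pointwise rate, so its own modulus is kept in the profile `φ`;
  -- the added power is the decay available for the nonlinearity at this stage.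
  set φ : Freq → ℝ := fun k => ‖G k‖ + wt k ^ (-(1 / 2) : ℝ) with hφ
  have hφ0 (k : Freq) : 0 ≤ φ k := add_nonneg (norm_nonneg _) (wt_rpow_pos _ _).le
  have hU : ∀ T, ∃ C, 0 ≤ C ∧ ∀ t, |t| ≤ T → ∀ k, wt k ^ 2 * ‖U t k‖ ≤ C * φ k := by
    intro T
    have hdec := decay_of_ode hμ hφ0 h.ode h.zero h.coeff_bounded (fun T => ?_) (5 / 2) T
    · obtain ⟨C, hC0, hC⟩ := hdec
      refine ⟨C * 2, by positivity, fun t ht k => ?_⟩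
      have h1 := mul_le_mul_of_nonneg_left (hC t ht k) (sq_nonneg (wt k))
      have e : wt k ^ (-(5 / 2) : ℝ) = wt k ^ (-2 : ℝ) * wt k ^ (-(1 / 2) : ℝ) := by
        rw [← Real.rpow_add (wt_pos k)]; norm_num
      rw [e, ← mul_add, mul_left_comm, ← mul_assoc (wt k ^ 2), wt_sq_mul_rpow, one_mul] at h1
      have h2 : φ k + wt k ^ (-(1 / 2) : ℝ) ≤ 2 * φ k := by
        simp only [hφ]; linarith [norm_nonneg (G k)]
      have := mul_le_mul_of_nonneg_left h2 hC0
      linarith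
    · obtain ⟨B, hB0, hB⟩ := hB T
      refine ⟨1 + B, fun t ht k => (norm_sub_le _ _).trans ?_⟩
      have h1 := hB t ht k
      have h2 := wt_rpow_pos k (-(1 / 2))
      have h3 := mul_nonneg hB0 (norm_nonneg (G k))
      simp only [hφ]
      linarith
  have hW : ∀ T, ∃ C, 0 ≤ C ∧ ∀ t, |t| ≤ T → ∀ k, ‖W t k‖ ≤ C * φ k := by
    intro T
    obtain ⟨C, hC0, hC⟩ := hU T
    obtain ⟨B, hB0, hB⟩ := hB T
    refine ⟨1 + μ * C + B, by positivity, fun t ht k => ?_⟩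
    refine (h.norm_velocity_le hμ t k).trans ?_
    have h1 := mul_le_mul_of_nonneg_left (hC t ht k) hμ.le
    have h2 : ‖bil κ k (U t) (U t)‖ ≤ B * φ k :=
      (hB t ht k).trans (mul_le_mul_of_nonneg_left (le_add_of_nonneg_left (norm_nonneg _)) hB0)
    have h3 : ‖G k‖ ≤ φ k := le_add_of_nonneg_right (wt_rpow_pos _ _).le
    linarith
  -- Mere boundedness of the convolution of `W` and `U` is sought, hence `σ = 0`. The part of `φ`
  -- with a rate is summable against `U` since `1 / 2 + 2 > 2`; the part `‖G k‖` is handled by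
  -- Cauchy-Schwarz.
  obtain ⟨K, hK0, hK⟩ := conv_decay (p := 1 / 2) (q := 2) (σ := 0) le_rfl (by norm_num)
    (by norm_num) (by norm_num)
  have hconv : ∀ T, ∃ C, 0 ≤ C ∧ ∀ t, |t| ≤ T → ∀ k, conv (W t) (U t) k ≤ C := by
    intro T
    obtain ⟨C, hC0, hC⟩ := hW T
    obtain ⟨M, hM0, hM⟩ := hU2 T
    obtain ⟨R, hR0, hR⟩ := h.norm_bounded T
    refine ⟨C * (‖G‖ * R + M * K), by positivity, fun t ht k => ?_⟩
    have s1 := summable_conv G (U t) k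
    have s2 := (hK k).1.mul_left M
    have hle (l : Freq) : ‖W t l‖ * ‖U t (k - l)‖ ≤ C * (‖G l‖ * ‖U t (k - l)‖ +
        M * (wt l ^ (-(1 / 2) : ℝ) * wt (k - l) ^ (-2 : ℝ))) := by
      have h1 := mul_le_mul_of_nonneg_right (hC t ht l) (norm_nonneg (U t (k - l)))
      have h2 := mul_le_mul_of_nonneg_left (hM t ht (k - l))
        (mul_nonneg hC0 (wt_rpow_pos l (-(1 / 2))).le)
      simp only [hφ] at h1
      linarith
    refine ((summable_conv (W t) (U t) k).tsum_le_tsum hle ((s1.add s2).mul_left C)).trans ?_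
    rw [tsum_mul_left, s1.tsum_add s2, tsum_mul_left]
    refine mul_le_mul_of_nonneg_left (add_le_add ?_ ?_) hC0
    · exact (conv_le G (U t) k).trans (mul_le_mul_of_nonneg_left (hR t ht) (norm_nonneg G))
    · refine mul_le_mul_of_nonneg_left ?_ hM0
      simpa using (hK k).2
  intro T
  -- The forcing of the velocity equation grows at most like `wt k`; the gain of two powers leaves
  -- rate 1.
  have hdec := decay_of_ode hμ (φ := wt) (fun k => (wt_pos k).le) (h.ode_velocity hκ)
    h.velocity_zero (fun T => ?_) (fun T => ?_) 1 T
  · obtain ⟨C, hC0, hC⟩ := hdec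
    refine ⟨C * 2, by positivity, fun t ht k => (hC t ht k).trans_eq ?_⟩
    have := wt_mul_rpow k 2
    rw [mul_comm (wt k ^ (-2 : ℝ)), this]; norm_num; ring
  · obtain ⟨C, hC0, hC⟩ := hW T
    refine ⟨C * (‖G‖ + 1), fun t ht k => (hC t ht k).trans ?_⟩
    exact mul_le_mul_of_nonneg_left
      (add_le_add (norm_apply_le G k) (wt_rpow_le_one k (by norm_num))) hC0
  · obtain ⟨C, hC0, hC⟩ := hconv T
    refine ⟨2 * κ * C, fun t ht k => ?_⟩
    rw [norm_neg]
    refine (norm_add_le _ _).trans ((add_le_add (norm_bil_le hκ k _ _)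
      (norm_bil_comm_le hκ k _ _)).trans ?_)
    have := mul_le_mul_of_nonneg_left (hC t ht k) (mul_nonneg hκ (wt_pos k).le)
    linarith

/-- The velocity of a trajectory is one derivative smoother than the force. -/
lemma IsFlow.velocity_decays_succ (h : IsFlow κ μ G U W) (hκ : 0 ≤ κ) (hμ : 0 < μ) {b : ℕ}
    (hb : 1 ≤ b) {g : ℝ} (hG : ∀ k, ‖G k‖ ≤ g * wt k ^ (-(b : ℝ))) :
    Decays (b + 1) fun t => W t := by
  have hb' : (1 : ℝ) ≤ b := by exact_mod_cast hb
  have hU := h.decays_of_force hκ hμ hG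
  have hB : Decays (b + 2 - 1) fun t k => bil κ k (U t) (U t) :=
    bil_decay hκ (by linarith) le_rfl le_rfl (by linarith) hU hU
  have hW : Decays b fun t => W t := by
    intro T
    obtain ⟨C, hC0, hC⟩ := hU T
    obtain ⟨B, hB0, hB⟩ := hB T
    refine ⟨|g| + μ * C + B, by positivity, fun t ht k => ?_⟩
    refine (h.norm_velocity_le hμ t k).trans ?_
    have h1 := mul_le_mul_of_nonneg_left (hC t ht k) (sq_nonneg (wt k))
    have e : wt k ^ (-((b : ℝ) + 2)) = wt k ^ (-2 : ℝ) * wt k ^ (-(b : ℝ)) := by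
      rw [← Real.rpow_add (wt_pos k)]; ring_nf
    rw [e, mul_left_comm, ← mul_assoc (wt k ^ 2), wt_sq_mul_rpow, one_mul] at h1
    have h2 := mul_le_mul_of_nonneg_left h1 hμ.le
    have h3 : ‖bil κ k (U t) (U t)‖ ≤ B * wt k ^ (-(b : ℝ)) :=
      (hB t ht k).trans (mul_le_mul_of_nonneg_left (wt_rpow_mono k (by linarith)) hB0)
    have h4 := mul_le_mul_of_nonneg_right (le_abs_self g) (wt_rpow_pos k (-(b : ℝ))).le
    linarith [hG k]
  -- With rates `b` and `b + 2` and `σ = b`, summability demands `b + 2 > 2`. This excludes `b = 0`,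
  -- which is covered by `IsFlow.velocity_decays_one`.
  have h1 : Decays (b - 1) fun t k => bil κ k (W t) (U t) :=
    bil_decay hκ (by linarith) le_rfl (by linarith) (by linarith) hW hU
  have h2 : Decays (b - 1) fun t k => bil κ k (U t) (W t) :=
    bil_decay hκ (by linarith) (by linarith) le_rfl (by linarith) hU hW
  intro T
  have hdec := decay_of_ode hμ (φ := fun k => wt k ^ (-((b : ℝ) - 1)))
    (fun k => (wt_rpow_pos k _).le) (h.ode_velocity hκ) h.velocity_zero (fun T => ?_)
    (fun T => ?_) (b + 1) T
  · obtain ⟨C, hC0, hC⟩ := hdec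
    refine ⟨C * 2, by positivity, fun t ht k => (hC t ht k).trans_eq ?_⟩
    rw [← Real.rpow_add (wt_pos k), show (-2 : ℝ) + -((b : ℝ) - 1) = -(b + 1) by ring]; ring
  · obtain ⟨C, hC0, hC⟩ := hW T
    refine ⟨C, fun t ht k => (hC t ht k).trans ?_⟩
    exact mul_le_of_le_one_right hC0 (wt_rpow_le_one k (by positivity))
  · obtain ⟨C, hC0, hC⟩ := h1 T
    obtain ⟨D, hD0, hD⟩ := h2 T
    refine ⟨C + D, fun t ht k => ?_⟩
    rw [norm_neg]
    refine (norm_add_le _ _).trans ((add_le_add (hC t ht k) (hD t ht k)).trans_eq ?_)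
    ring

/-- If a trajectory passes through `0`, then the force is rapidly decreasing. -/
theorem IsFlow.force_decays (h : IsFlow κ μ G U W) (hκ : 0 ≤ κ) (hμ : 0 < μ) (h0 : U 0 = 0)
    (b : ℕ) : ∃ g, ∀ k, ‖G k‖ ≤ g * wt k ^ (-(b : ℝ)) := by
  -- At the instant when the trajectory is at `0`, the linear and the quadratic term both vanish.
  have e (k : Freq) : W 0 k = G k := by
    have hz (l : Freq) : (0 : Seq) l = 0 := rfl
    rw [h.eqn, h0, bil]
    simp [hz]
  induction b with
  | zero => exact ⟨‖G‖, fun k => by simpa using norm_apply_le G k⟩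
  | succ b ih =>
    obtain ⟨g, hg⟩ := ih
    have key : Decays ((b : ℝ) + 1) fun t => W t := by
      rcases Nat.eq_zero_or_pos b with rfl | hb
      · simpa using h.velocity_decays_one hκ hμ
      · exact h.velocity_decays_succ hκ hμ hb hg
    obtain ⟨C, -, hC⟩ := key 0
    refine ⟨C, fun k => ?_⟩
    have := hC 0 (by simp) k
    simp only [e] at this
    exact_mod_cast this

theorem IsFlow.rapidly_decreasing (h : IsFlow κ μ G U W) (hκ : 0 ≤ κ) (hμ : 0 < μ)
    (hG : ∀ b : ℕ, ∃ g, ∀ k, ‖G k‖ ≤ g * wt k ^ (-(b : ℝ))) (b : ℕ) :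
    ∃ C, ∀ k, ‖U 0 k‖ ≤ C * wt k ^ (-(b : ℝ)) := by
  obtain ⟨g, hg⟩ := hG b
  obtain ⟨C, hC0, hC⟩ := h.decays_of_force hκ hμ hg 0
  exact ⟨C, fun k => (hC 0 (by simp) k).trans
    (mul_le_mul_of_nonneg_left (wt_rpow_mono k (by linarith)) hC0)⟩

end Flow

/-! ### Complex exponentials on the periodic box -/

lemma isCompact_box (L : ℝ) : IsCompact (box L) := by
  have h : box L = (EuclideanSpace.equiv (Fin 2) ℝ).toHomeomorph ⁻¹' (univ.pi fun _ => Icc 0 L) := by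
    ext x
    simp only [box, mem_ofPred_eq, mem_preimage, mem_univ_pi]
    rfl
  rw [h, Homeomorph.isCompact_preimage]
  exact isCompact_univ_pi fun _ => isCompact_Icc

instance (L : ℝ) : IsFiniteMeasure (volume.restrict (box L)) :=
  ⟨by rw [Measure.restrict_apply_univ]; exact (isCompact_box L).measure_lt_top⟩

lemma integral_box_prod (L : ℝ) (f : Fin 2 → ℝ → ℂ) :
    ∫ x in box L, ∏ i, f i (x i) = ∏ i, ∫ y in Icc 0 L, f i y := by
  have h : box L = (WithLp.ofLp : Plane → Fin 2 → ℝ) ⁻¹' (univ.pi fun _ => Icc 0 L) := by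
    ext x
    simp only [box, mem_ofPred_eq, mem_preimage, mem_univ_pi]
  rw [h, (PiLp.volume_preserving_ofLp (Fin 2)).setIntegral_preimage_emb
    (MeasurableEquiv.toLp 2 (Fin 2 → ℝ)).symm.measurableEmbedding
    (fun y : Fin 2 → ℝ => ∏ i, f i (y i)), volume_pi, Measure.restrict_pi_pi]
  exact integral_fintype_prod_eq_prod (𝕜 := ℂ) f

lemma phase_eq (L : ℝ) (k : Freq) (x : Plane) :
    phase L k x = 2 * Real.pi / L * inner ℝ (freqVec k) x := by
  simp [phase, inner_plane, freqVec]

lemma phase_sub (L : ℝ) (k l : Freq) (x : Plane) :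
    phase L (k - l) x = phase L k x - phase L l x := by
  rw [phase_eq, phase_eq, phase_eq, freqVec_sub, inner_sub_left]; ring

lemma phase_neg (L : ℝ) (k : Freq) (x : Plane) : phase L (-k) x = -phase L k x := by
  rw [phase_eq, phase_eq, freqVec_neg, inner_neg_left]; ring

lemma phase_zero (L : ℝ) (x : Plane) : phase L 0 x = 0 := by
  rw [phase_eq, freqVec_zero, inner_zero_left, mul_zero]

lemma contDiff_phase (L : ℝ) (k : Freq) : ContDiff ℝ ∞ (phase L k) := by
  have : phase L k = fun x => 2 * Real.pi / L * inner ℝ (freqVec k) x := funext (phase_eq L k)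
  rw [this]
  exact contDiff_const.mul (contDiff_const.inner ℝ contDiff_id)

lemma continuous_phase (L : ℝ) (k : Freq) : Continuous (phase L k) := (contDiff_phase L k).continuous

/-- The complex exponential `exp(i κ₀ k · x)`. -/
def expMode (L : ℝ) (k : Freq) (x : Plane) : ℂ := Complex.exp (phase L k x * Complex.I)

lemma norm_expMode (L : ℝ) (k : Freq) (x : Plane) : ‖expMode L k x‖ = 1 :=
  Complex.norm_exp_ofReal_mul_I _

lemma continuous_expMode (L : ℝ) (k : Freq) : Continuous (expMode L k) := by
  have := continuous_phase L k
  unfold expMode; fun_prop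

lemma conj_expMode (L : ℝ) (k : Freq) (x : Plane) : conj (expMode L k x) = expMode L (-k) x := by
  rw [expMode, expMode, ← Complex.exp_conj, map_mul, Complex.conj_I, Complex.conj_ofReal, phase_neg]
  push_cast; ring_nf

lemma expMode_mul (L : ℝ) (k l : Freq) (x : Plane) :
    expMode L k x * expMode L l x = expMode L (k + l) x := by
  have h := phase_sub L (k + l) l x
  rw [add_sub_cancel_right] at h
  rw [expMode, expMode, expMode, ← Complex.exp_add, h]
  push_cast; ring_nf

lemma expMode_eq (L : ℝ) (k : Freq) (x : Plane) : expMode L k x =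
    Real.cos (phase L k x) + Real.sin (phase L k x) * Complex.I := by
  rw [expMode, Complex.exp_mul_I, Complex.ofReal_cos, Complex.ofReal_sin]

lemma integral_exp_Icc {L : ℝ} (hL : 0 < L) (n : ℤ) :
    ∫ y in Icc 0 L, Complex.exp (2 * Real.pi / L * n * Complex.I * (y : ℂ)) =
      if n = 0 then (L : ℂ) else 0 := by
  rw [integral_Icc_eq_integral_Ioc, ← intervalIntegral.integral_of_le hL.le]
  split_ifs with h
  · subst h; simp
  · have hc : (2 * Real.pi / L * n * Complex.I : ℂ) ≠ 0 := by
      have h1 : (L : ℂ) ≠ 0 := by exact_mod_cast hL.ne'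
      have h2 : (Real.pi : ℂ) ≠ 0 := by exact_mod_cast Real.pi_ne_zero
      have h3 : (n : ℂ) ≠ 0 := by exact_mod_cast h
      simp [h1, h2, h3]
    rw [integral_exp_mul_complex hc]
    have e : (2 * Real.pi / L * n * Complex.I * (L : ℂ)) = n * (2 * Real.pi * Complex.I) := by
      have h1 : (L : ℂ) ≠ 0 := by exact_mod_cast hL.ne'
      field_simp
    rw [e, Complex.exp_int_mul_two_pi_mul_I]; simp

lemma integral_expMode {L : ℝ} (hL : 0 < L) (k : Freq) :
    ∫ x in box L, expMode L k x = if k = 0 then (L : ℂ) ^ 2 else 0 := by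
  have e (x : Plane) : expMode L k x =
      ∏ i, Complex.exp (2 * Real.pi / L * (k i : ℤ) * Complex.I * ((x i : ℝ) : ℂ)) := by
    rw [expMode, phase, ← Complex.exp_sum]
    congr 1
    simp only [Fin.sum_univ_two]
    push_cast; ring
  simp_rw [e]
  rw [integral_box_prod L
    (fun i y => Complex.exp (2 * Real.pi / L * (k i : ℤ) * Complex.I * (y : ℂ)))]
  simp_rw [integral_exp_Icc hL]
  rw [Fin.prod_univ_two]
  by_cases h0 : k = 0
  · subst h0; simp [pow_two]
  · rw [if_neg h0]
    by_cases h1 : k 0 = 0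
    · have h2 : k 1 ≠ 0 := fun h2 => h0 (by ext i; fin_cases i <;> simp [h1, h2])
      simp [h2]
    · simp [h1]

/-- The normalized exponentials as bounded continuous functions. -/
def expBCF (L : ℝ) (k : Freq) : Plane →ᵇ ℂ :=
  BoundedContinuousFunction.ofNormedAddCommGroup (fun x => (L : ℂ)⁻¹ * expMode L k x)
    (continuous_const.mul (continuous_expMode L k)) |L|⁻¹
    fun x => by rw [norm_mul, norm_expMode]; simp

/-- The normalized exponentials in the complex space `L²(Ω)`. -/
def expLp (L : ℝ) (k : Freq) : Lp ℂ 2 (volume.restrict (box L)) :=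
  BoundedContinuousFunction.toLp 2 (volume.restrict (box L)) ℂ (expBCF L k)

lemma coeFn_expLp (L : ℝ) (k : Freq) :
    expLp L k =ᵐ[volume.restrict (box L)] fun x => (L : ℂ)⁻¹ * expMode L k x :=
  BoundedContinuousFunction.coeFn_toLp 2 _ ℂ (expBCF L k)

lemma inner_expLp (L : ℝ) (k : Freq) (w : Lp ℂ 2 (volume.restrict (box L))) :
    inner ℂ (expLp L k) w = (L : ℂ)⁻¹ * ∫ x in box L, expMode L (-k) x * w x := by
  rw [L2.inner_def, ← integral_const_mul]
  refine integral_congr_ae ?_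
  filter_upwards [coeFn_expLp L k] with x hx
  rw [hx, RCLike.inner_apply, map_mul, conj_expMode, map_inv₀, Complex.conj_ofReal]; ring

lemma orthonormal_expLp {L : ℝ} (hL : 0 < L) : Orthonormal ℂ (expLp L) := by
  classical
  have h1 : (L : ℂ) ≠ 0 := by exact_mod_cast hL.ne'
  rw [orthonormal_iff_ite]
  intro k l
  have : ∫ x in box L, expMode L (-k) x * expLp L l x =
      (L : ℂ)⁻¹ * ∫ x in box L, expMode L (l - k) x := by
    rw [← integral_const_mul]
    refine integral_congr_ae ?_
    filter_upwards [coeFn_expLp L l] with x hx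
    rw [hx, mul_left_comm, expMode_mul]; ring_nf
  rw [inner_expLp, this, integral_expMode hL]
  by_cases h : k = l
  · subst h; simp only [sub_self, if_true]; field_simp
  · have : l - k ≠ 0 := fun h' => h (sub_eq_zero.mp h').symm
    simp [h, this]

/-- Expansion of a vector in the closed span of an orthonormal family. -/
lemma _root_.Orthonormal.hasSum_of_mem_closure_span {𝕜 E ι : Type*} [RCLike 𝕜]
    [NormedAddCommGroup E] [InnerProductSpace 𝕜 E] [CompleteSpace E] {v : ι → E}
    (hv : Orthonormal 𝕜 v) {x : E} (hx : x ∈ (Submodule.span 𝕜 (range v)).topologicalClosure) :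
    HasSum (fun i => inner 𝕜 (v i) x • v i) x := by
  set K := (Submodule.span 𝕜 (range v)).topologicalClosure with hK
  have hmem (i : ι) : v i ∈ K :=
    Submodule.le_topologicalClosure _ (Submodule.subset_span ⟨i, rfl⟩)
  have : CompleteSpace K :=
    (Submodule.isClosed_topologicalClosure _).completeSpace_coe
  have hv' : Orthonormal 𝕜 fun i => (⟨v i, hmem i⟩ : K) :=
    ⟨fun i => hv.1 i, fun i j hij => hv.2 hij⟩
  have hbot : (Submodule.span 𝕜 (range fun i => (⟨v i, hmem i⟩ : K)))ᗮ = ⊥ := by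
    rw [eq_bot_iff]
    intro y hy
    rw [Submodule.mem_orthogonal] at hy
    -- The orthogonal complement of `y` is closed and contains every `v i`, hence all of `K`,
    -- including `y` itself.
    have h1 : K ≤ (Submodule.span 𝕜 {(y : E)})ᗮ := by
      refine Submodule.topologicalClosure_minimal _ (Submodule.span_le.mpr ?_)
        (Submodule.isClosed_orthogonal _)
      rintro _ ⟨i, rfl⟩
      rw [SetLike.mem_coe, Submodule.mem_orthogonal_singleton_iff_inner_left]
      exact hy _ (Submodule.subset_span ⟨i, rfl⟩)
    have h2 := h1 y.2
    rw [Submodule.mem_orthogonal_singleton_iff_inner_left, inner_self_eq_zero] at h2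
    exact (Submodule.mem_bot _).mpr (Subtype.ext h2)
  let b := HilbertBasis.mkOfOrthogonalEqBot hv' hbot
  have hb (i : ι) : ((b i : K) : E) = v i := by
    simp only [b, HilbertBasis.coe_mkOfOrthogonalEqBot]
  have h3 := (b.hasSum_repr ⟨x, hx⟩).mapL K.subtypeL
  change HasSum _ x at h3
  convert h3 using 2 with i
  rw [b.repr_apply_apply]
  change _ = ((inner 𝕜 ((b i : K) : E) x • (b i : K) : K) : E)
  rw [Submodule.coe_smul, hb]

/-! ### Fourier coefficients of vector fields -/

/-- The `i`-th component of a vector field, as a complex-valued function. -/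
def comp (L : ℝ) (i : Fin 2) : L2 L →L[ℝ] Lp ℂ 2 (volume.restrict (box L)) :=
  (Complex.ofRealCLM.comp (EuclideanSpace.proj i : Plane →L[ℝ] ℝ)).compLpL 2 _

lemma coeFn_comp (L : ℝ) (i : Fin 2) (v : L2 L) :
    comp L i v =ᵐ[volume.restrict (box L)] fun x => ((v x i : ℝ) : ℂ) :=
  ContinuousLinearMap.coeFn_compLpL _ v

/-- The Fourier coefficients of the components of a vector field. -/
def coef (L : ℝ) (i : Fin 2) (k : Freq) : L2 L →L[ℝ] ℂ :=
  ((innerSL ℂ (expLp L k)).restrictScalars ℝ).comp (comp L i)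

lemma coef_apply (L : ℝ) (i : Fin 2) (k : Freq) (v : L2 L) :
    coef L i k v = inner ℂ (expLp L k) (comp L i v) := rfl

lemma coef_eq_integral (L : ℝ) (i : Fin 2) (k : Freq) (v : L2 L) :
    coef L i k v = (L : ℂ)⁻¹ * ∫ x in box L, expMode L (-k) x * (v x i : ℝ) := by
  rw [coef_apply, inner_expLp]
  congr 1
  refine integral_congr_ae ?_
  filter_upwards [coeFn_comp L i v] with x hx
  rw [hx]

lemma exists_mem_span_of_mem_span {L : ℝ} (hL : 0 < L) {F : Plane → ℂ}
    (hF : F ∈ Submodule.span ℂ (range (expMode L))) :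
    ∃ w ∈ Submodule.span ℂ (range (expLp L)), w =ᵐ[volume.restrict (box L)] F := by
  have h1 : (L : ℂ) ≠ 0 := by exact_mod_cast hL.ne'
  induction hF using Submodule.span_induction with
  | mem F hF =>
    obtain ⟨k, rfl⟩ := hF
    refine ⟨(L : ℂ) • expLp L k, Submodule.smul_mem _ _ (Submodule.subset_span ⟨k, rfl⟩), ?_⟩
    filter_upwards [Lp.coeFn_smul (L : ℂ) (expLp L k), coeFn_expLp L k] with x hx hx'
    rw [hx, Pi.smul_apply, hx', smul_eq_mul]; field_simp
  | zero => exact ⟨0, Submodule.zero_mem _, Lp.coeFn_zero _ _ _⟩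
  | add F F' _ _ ih ih' =>
    obtain ⟨w, hw, e⟩ := ih
    obtain ⟨w', hw', e'⟩ := ih'
    exact ⟨w + w', Submodule.add_mem _ hw hw', (Lp.coeFn_add w w').trans (e.add e')⟩
  | smul c F _ ih =>
    obtain ⟨w, hw, e⟩ := ih
    exact ⟨c • w, Submodule.smul_mem _ c hw, (Lp.coeFn_smul c w).trans (e.const_smul c)⟩

lemma cos_eq_expMode (L : ℝ) (k : Freq) (x : Plane) :
    ((Real.cos (phase L k x) : ℝ) : ℂ) = 2⁻¹ * (expMode L k x + expMode L (-k) x) := by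
  rw [expMode_eq, expMode_eq, phase_neg, Real.cos_neg, Real.sin_neg]; push_cast; ring

lemma sin_eq_expMode (L : ℝ) (k : Freq) (x : Plane) :
    ((Real.sin (phase L k x) : ℝ) : ℂ) =
      -(2⁻¹ * Complex.I) * (expMode L k x - expMode L (-k) x) := by
  rw [expMode_eq, expMode_eq, phase_neg, Real.cos_neg, Real.sin_neg]
  push_cast
  linear_combination (Complex.sin (phase L k x)) * Complex.I_sq

lemma component_mem_span {L : ℝ} {f : Plane → Plane} (hf : IsTrigPoly L f) (i : Fin 2) :
    (fun x => ((f x i : ℝ) : ℂ)) ∈ Submodule.span ℂ (range (expMode L)) := by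
  obtain ⟨s, a, b, h⟩ := hf
  have e : (fun x => ((f x i : ℝ) : ℂ)) = ∑ k ∈ s,
      (((2⁻¹ * (a k i : ℝ)) : ℂ) • (expMode L k + expMode L (-k)) +
        (-(2⁻¹ * Complex.I) * (b k i : ℝ)) • (expMode L k - expMode L (-k))) := by
    funext x
    rw [h x]
    simp only [Finset.sum_apply, Pi.add_apply, Pi.smul_apply, Pi.sub_apply, smul_eq_mul,
      WithLp.ofLp_sum, WithLp.ofLp_add, WithLp.ofLp_smul, Complex.ofReal_sum, Complex.ofReal_add,
      Complex.ofReal_mul]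
    refine Finset.sum_congr rfl fun k _ => ?_
    rw [cos_eq_expMode, sin_eq_expMode]; ring
  rw [e]
  have hm (k : Freq) : expMode L k ∈ Submodule.span ℂ (range (expMode L)) :=
    Submodule.subset_span ⟨k, rfl⟩
  exact Submodule.sum_mem _ fun k _ => Submodule.add_mem _
    (Submodule.smul_mem _ _ (Submodule.add_mem _ (hm _) (hm _)))
    (Submodule.smul_mem _ _ (Submodule.sub_mem _ (hm _) (hm _)))

/-- A closed subspace containing all solenoidal trigonometric polynomials contains `H`. -/
lemma H_le_of_forall {L : ℝ} {K : Submodule ℝ (L2 L)} (hK : IsClosed (K : Set (L2 L)))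
    (h : ∀ v ∈ solenoidalTrigPolys L, v ∈ K) : H L ≤ K :=
  Submodule.topologicalClosure_minimal _ (Submodule.span_le.mpr h) hK

/-- Completeness of the exponentials in the whole space `L²(Ω)` is not needed: the condition is
closed and holds for trigonometric polynomials, whose closure is `H`. -/
lemma comp_mem_closure_span {L : ℝ} (hL : 0 < L) (u : H L) (i : Fin 2) :
    comp L i u ∈ (Submodule.span ℂ (range (expLp L))).topologicalClosure := by
  let K : Submodule ℝ (L2 L) :=
    ((Submodule.span ℂ (range (expLp L))).topologicalClosure.restrictScalars ℝ).comap
      (comp L i).toLinearMap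
  have hK : IsClosed (K : Set (L2 L)) :=
    (Submodule.isClosed_topologicalClosure (Submodule.span ℂ (range (expLp L)))).preimage
      (comp L i).continuous
  refine H_le_of_forall hK (fun v hv => ?_) u.2
  obtain ⟨f, hf, -, -, hvf⟩ := hv
  obtain ⟨w, hw, e⟩ := exists_mem_span_of_mem_span hL (component_mem_span hf i)
  have : comp L i v = w := by
    refine Lp.ext ?_
    filter_upwards [coeFn_comp L i v, hvf, e] with x h1 h2 h3
    rw [h1, h2, h3]
  change comp L i v ∈ (Submodule.span ℂ (range (expLp L))).topologicalClosure
  rw [this]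
  exact Submodule.le_topologicalClosure _ hw

/-- The Fourier expansion of the elements of `H`. -/
lemma hasSum_coef {L : ℝ} (hL : 0 < L) (u : H L) (i : Fin 2) :
    HasSum (fun k => coef L i k u • expLp L k) (comp L i u) :=
  (orthonormal_expLp hL).hasSum_of_mem_closure_span (comp_mem_closure_span hL u i)

/-- The Fourier coefficients of `v · a`. -/
def pair (L : ℝ) (k : Freq) (a : Plane) : L2 L →L[ℝ] ℂ := ∑ i, a i • coef L i k

lemma pair_apply (L : ℝ) (k : Freq) (a : Plane) (v : L2 L) :
    pair L k a v = a 0 * coef L 0 k v + a 1 * coef L 1 k v := by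
  simp [pair, Fin.sum_univ_two]

lemma integrable_coord {L : ℝ} (v : L2 L) (i : Fin 2) :
    Integrable (fun x => v x i) (volume.restrict (box L)) :=
  (EuclideanSpace.proj i : Plane →L[ℝ] ℝ).integrable_comp
    ((Lp.memLp v).integrable (by norm_num))

lemma integrable_mul_of_bound {L : ℝ} {c : Plane → ℂ} (hc : Continuous c) {C : ℝ}
    (hC : ∀ x, ‖c x‖ ≤ C) {f : Plane → ℂ} (hf : Integrable f (volume.restrict (box L))) :
    Integrable (fun x => c x * f x) (volume.restrict (box L)) :=
  hf.bdd_mul hc.aestronglyMeasurable (Filter.Eventually.of_forall hC)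

lemma integrable_inner_smul {L : ℝ} (v : L2 L) {c : Plane → ℝ} (hc : Continuous c)
    (hC : ∀ x, |c x| ≤ 1) (a : Plane) :
    Integrable (fun x => inner ℝ (v x) (c x • a)) (volume.restrict (box L)) := by
  have h1 : Integrable (fun x => inner ℝ (v x) a) (volume.restrict (box L)) :=
    ((Lp.memLp v).integrable (by norm_num)).inner_const a
  simp_rw [inner_smul_right]
  exact h1.bdd_mul hc.aestronglyMeasurable (Filter.Eventually.of_forall hC)

/-- Rewrites a complex coefficient through the real test fields `cos · a` and `sin · a`, the form in
which the weak derivatives and the Leray projection can be tested. -/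
lemma pair_eq (L : ℝ) (k : Freq) (a : Plane) (v : L2 L) : pair L k a v = (L : ℂ)⁻¹ *
    (((∫ x in box L, inner ℝ (v x) (Real.cos (phase L k x) • a) : ℝ) : ℂ) -
      ((∫ x in box L, inner ℝ (v x) (Real.sin (phase L k x) • a) : ℝ) : ℂ) * Complex.I) := by
  have hint (i : Fin 2) : Integrable (fun x => expMode L (-k) x * ((v x i : ℝ) : ℂ))
      (volume.restrict (box L)) :=
    integrable_mul_of_bound (continuous_expMode L (-k)) (fun x => (norm_expMode L (-k) x).le)
      (integrable_coord v i).ofReal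
  have i1 := integrable_inner_smul v (c := fun x => Real.cos (phase L k x))
    (Real.continuous_cos.comp (continuous_phase L k)) (fun x => Real.abs_cos_le_one _) a
  have i2 := integrable_inner_smul v (c := fun x => Real.sin (phase L k x))
    (Real.continuous_sin.comp (continuous_phase L k)) (fun x => Real.abs_sin_le_one _) a
  rw [pair_apply, coef_eq_integral, coef_eq_integral, mul_left_comm, mul_left_comm (a 1 : ℂ),
    ← mul_add, ← integral_const_mul, ← integral_const_mul,
    ← integral_add ((hint 0).const_mul _) ((hint 1).const_mul _), ← integral_complex_ofReal,
    ← integral_complex_ofReal, ← integral_mul_const,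
    ← integral_sub i1.ofReal (i2.ofReal.mul_const _)]
  congr 2
  funext x
  rw [inner_plane, inner_plane, expMode_eq, phase_neg, Real.cos_neg, Real.sin_neg]
  simp only [PiLp.smul_apply, smul_eq_mul]
  push_cast; ring

lemma pair_neg_left (L : ℝ) (k : Freq) (a : Plane) (v : L2 L) :
    pair L k (-a) v = -pair L k a v := by
  rw [pair_apply, pair_apply]; simp; ring

lemma pair_neg_freq (L : ℝ) (k : Freq) (a : Plane) (v : L2 L) :
    pair L (-k) a v = conj (pair L k a v) := by
  rw [pair_eq, pair_eq]
  simp only [phase_neg, Real.cos_neg, Real.sin_neg, neg_smul, inner_neg_right, integral_neg,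
    map_mul, map_sub, map_inv₀, Complex.conj_ofReal, Complex.conj_I]
  push_cast; ring

/-! ### Weak derivatives on Fourier coefficients -/

/-- The derivative of the phase. -/
def phaseCLM (L : ℝ) (k : Freq) : Plane →L[ℝ] ℝ := (2 * Real.pi / L) • innerSL ℝ (freqVec k)

lemma phaseCLM_apply (L : ℝ) (k : Freq) (x : Plane) : phaseCLM L k x = phase L k x := by
  rw [phase_eq]; rfl

lemma hasFDerivAt_phase (L : ℝ) (k : Freq) (x : Plane) :
    HasFDerivAt (phase L k) (phaseCLM L k) x := by
  have : phase L k = phaseCLM L k := funext fun x => (phaseCLM_apply L k x).symm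
  rw [this]; exact (phaseCLM L k).hasFDerivAt

lemma phase_basisVec (L : ℝ) (k : Freq) (i : Fin 2) :
    phase L k (basisVec i) = 2 * Real.pi / L * k i := by
  fin_cases i <;> simp [phase, basisVec]

lemma hasFDerivAt_cos (L : ℝ) (k : Freq) (a x : Plane) :
    HasFDerivAt (fun x => Real.cos (phase L k x) • a)
      ((-Real.sin (phase L k x) • phaseCLM L k).smulRight a) x :=
  (hasFDerivAt_phase L k x).cos.smul_const a

lemma hasFDerivAt_sin (L : ℝ) (k : Freq) (a x : Plane) :
    HasFDerivAt (fun x => Real.sin (phase L k x) • a)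
      ((Real.cos (phase L k x) • phaseCLM L k).smulRight a) x :=
  (hasFDerivAt_phase L k x).sin.smul_const a

lemma partialDeriv_cos (L : ℝ) (k : Freq) (a : Plane) (i : Fin 2) :
    partialDeriv i (fun x => Real.cos (phase L k x) • a) =
      fun x => Real.sin (phase L k x) • (-(2 * Real.pi / L * k i) • a) := by
  funext x
  rw [partialDeriv, (hasFDerivAt_cos L k a x).fderiv]
  simp only [ContinuousLinearMap.smulRight_apply, smul_apply, phaseCLM_apply,
    phase_basisVec, smul_smul, smul_eq_mul]
  ring_nf

lemma partialDeriv_sin (L : ℝ) (k : Freq) (a : Plane) (i : Fin 2) :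
    partialDeriv i (fun x => Real.sin (phase L k x) • a) =
      fun x => Real.cos (phase L k x) • ((2 * Real.pi / L * k i) • a) := by
  funext x
  rw [partialDeriv, (hasFDerivAt_sin L k a x).fderiv]
  simp only [ContinuousLinearMap.smulRight_apply, smul_apply, phaseCLM_apply,
    phase_basisVec, smul_smul, smul_eq_mul]

lemma contDiff_cos (L : ℝ) (k : Freq) (a : Plane) :
    ContDiff ℝ ∞ fun x => Real.cos (phase L k x) • a :=
  (Real.contDiff_cos.comp (contDiff_phase L k)).smul contDiff_const

lemma contDiff_sin (L : ℝ) (k : Freq) (a : Plane) :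
    ContDiff ℝ ∞ fun x => Real.sin (phase L k x) • a :=
  (Real.contDiff_sin.comp (contDiff_phase L k)).smul contDiff_const

lemma phase_add_period {L : ℝ} (hL : 0 < L) (k : Freq) (i : Fin 2) (x : Plane) :
    phase L k (x + L • basisVec i) = phase L k x + k i * (2 * Real.pi) := by
  rw [← phaseCLM_apply, map_add, map_smul, phaseCLM_apply, phaseCLM_apply, phase_basisVec,
    smul_eq_mul]
  have := hL.ne'
  field_simp

lemma isPeriodic_cos {L : ℝ} (hL : 0 < L) (k : Freq) (a : Plane) :
    IsPeriodic L fun x => Real.cos (phase L k x) • a := fun i x => by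
  simp only [phase_add_period hL, Real.cos_add_int_mul_two_pi]

lemma isPeriodic_sin {L : ℝ} (hL : 0 < L) (k : Freq) (a : Plane) :
    IsPeriodic L fun x => Real.sin (phase L k x) • a := fun i x => by
  simp only [phase_add_period hL, Real.sin_add_int_mul_two_pi]

lemma laplacian_eq_sum_partialDeriv {φ : Plane → Plane} (hφ : ContDiff ℝ ∞ φ) (x : Plane) :
    Laplacian.laplacian φ x = ∑ i, partialDeriv i (partialDeriv i φ) x := by
  rw [InnerProductSpace.laplacian_eq_iteratedFDeriv_orthonormalBasis φ
    (EuclideanSpace.basisFun (Fin 2) ℝ)]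
  refine Finset.sum_congr rfl fun i _ => ?_
  have hb : EuclideanSpace.basisFun (Fin 2) ℝ i = basisVec i := by
    simp [basisVec]
  have hd : DifferentiableAt ℝ (fderiv ℝ φ) x :=
    ((hφ.fderiv_right (m := 1) (by norm_cast)).differentiable one_ne_zero).differentiableAt
  rw [iteratedFDeriv_two_apply, hb]
  simp only [Matrix.cons_val_zero, Matrix.cons_val_one]
  have : partialDeriv i φ = fun y => fderiv ℝ φ y (basisVec i) := rfl
  rw [this, partialDeriv, fderiv_clm_apply hd (differentiableAt_const _)]
  simp

lemma sum_sq_freq (k : Freq) (c : ℝ) :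
    ∑ i, (c * k i) * (c * k i) = c ^ 2 * ‖freqVec k‖ ^ 2 := by
  rw [norm_sq_freqVec, Fin.sum_univ_two]; ring

lemma laplacian_cos (L : ℝ) (k : Freq) (a x : Plane) :
    Laplacian.laplacian (fun x => Real.cos (phase L k x) • a) x =
      (-((2 * Real.pi / L) ^ 2 * ‖freqVec k‖ ^ 2)) • (Real.cos (phase L k x) • a) := by
  rw [laplacian_eq_sum_partialDeriv (contDiff_cos L k a)]
  simp_rw [partialDeriv_cos, partialDeriv_sin, ← sum_sq_freq, Fin.sum_univ_two, smul_smul,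
    ← add_smul]
  congr 1; ring

lemma laplacian_sin (L : ℝ) (k : Freq) (a x : Plane) :
    Laplacian.laplacian (fun x => Real.sin (phase L k x) • a) x =
      (-((2 * Real.pi / L) ^ 2 * ‖freqVec k‖ ^ 2)) • (Real.sin (phase L k x) • a) := by
  rw [laplacian_eq_sum_partialDeriv (contDiff_sin L k a)]
  simp_rw [partialDeriv_sin, partialDeriv_cos, ← sum_sq_freq, Fin.sum_univ_two, smul_smul,
    ← add_smul]
  congr 1; ring

lemma pair_weakLaplacian {L : ℝ} (hL : 0 < L) {u l : L2 L} (h : IsWeakLaplacian L u l) (k : Freq)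
    (a : Plane) :
    pair L k a l = (-((2 * Real.pi / L) ^ 2 * ‖freqVec k‖ ^ 2) : ℝ) * pair L k a u := by
  rw [pair_eq, pair_eq, ← h _ (contDiff_cos L k a) (isPeriodic_cos hL k a),
    ← h _ (contDiff_sin L k a) (isPeriodic_sin hL k a)]
  simp_rw [laplacian_cos, laplacian_sin]
  simp_rw [inner_smul_right _ _ (-((2 * Real.pi / L) ^ 2 * ‖freqVec k‖ ^ 2)), integral_const_mul]
  push_cast; ring

lemma pair_weakPartial {L : ℝ} (hL : 0 < L) {i : Fin 2} {v w : L2 L} (h : IsWeakPartial L i v w)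
    (k : Freq) (a : Plane) :
    pair L k a w = ((2 * Real.pi / L * k i : ℝ) : ℂ) * Complex.I * pair L k a v := by
  have h1 := h _ (contDiff_cos L k a) (isPeriodic_cos hL k a)
  have h2 := h _ (contDiff_sin L k a) (isPeriodic_sin hL k a)
  rw [partialDeriv_cos] at h1
  rw [partialDeriv_sin] at h2
  have e (r c : ℝ) (x : Plane) : inner ℝ (v x) (r • c • a) = c * inner ℝ (v x) (r • a) := by
    rw [smul_comm, inner_smul_right]
  simp_rw [e, integral_const_mul] at h1 h2
  rw [pair_eq, pair_eq, neg_eq_iff_eq_neg.mp h1.symm, neg_eq_iff_eq_neg.mp h2.symm]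
  push_cast
  linear_combination ((L : ℂ)⁻¹ * (2 * Real.pi / L * k i) *
    ((∫ x in box L, inner ℝ (v x) (Real.sin (phase L k x) • a) : ℝ) : ℂ)) * Complex.I_sq

/-! ### Solenoidal and mean-zero conditions on coefficients -/

/-- Unnormalized Fourier coefficients of scalar functions. -/
def fourierInt (L : ℝ) (k : Freq) (F : Plane → ℂ) : ℂ := ∫ x in box L, expMode L (-k) x * F x

lemma integrable_box_of_continuous (L : ℝ) {F : Plane → ℂ} (hF : Continuous F) :
    Integrable F (volume.restrict (box L)) :=
  hF.continuousOn.integrableOn_compact (isCompact_box L)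

lemma fourierInt_add (L : ℝ) (k : Freq) {F F' : Plane → ℂ} (hF : Continuous F)
    (hF' : Continuous F') : fourierInt L k (fun x => F x + F' x) =
      fourierInt L k F + fourierInt L k F' := by
  have := continuous_expMode L (-k)
  simp only [fourierInt, mul_add]
  exact integral_add (integrable_box_of_continuous L (this.mul hF))
    (integrable_box_of_continuous L (this.mul hF'))

lemma fourierInt_const_mul (L : ℝ) (k : Freq) (c : ℂ) (F : Plane → ℂ) :
    fourierInt L k (fun x => c * F x) = c * fourierInt L k F := by
  rw [fourierInt, fourierInt, ← integral_const_mul]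
  congr 1; funext x; ring

lemma fourierInt_sum {ι : Type*} (L : ℝ) (k : Freq) (s : Finset ι) {F : ι → Plane → ℂ}
    (hF : ∀ m, Continuous (F m)) :
    fourierInt L k (fun x => ∑ m ∈ s, F m x) = ∑ m ∈ s, fourierInt L k (F m) := by
  have := continuous_expMode L (-k)
  simp only [fourierInt, Finset.mul_sum]
  exact integral_finsetSum _ fun m _ => integrable_box_of_continuous L (this.mul (hF m))

/-- By orthogonality the integral vanishes unless `m = k`. This replaces integration by parts for
trigonometric polynomials. -/
lemma mul_fourierInt_expMode {L : ℝ} (hL : 0 < L) (k m : Freq) (i : Fin 2) :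
    (k i : ℂ) * fourierInt L k (expMode L m) = m i * fourierInt L k (expMode L m) := by
  have : fourierInt L k (expMode L m) = ∫ x in box L, expMode L (m - k) x := by
    simp only [fourierInt, expMode_mul]
    congr 1; funext x; congr 1; abel
  rw [this, integral_expMode hL]
  split_ifs with h
  · rw [sub_eq_zero.mp h]
  · simp

lemma continuous_cosC (L : ℝ) (m : Freq) :
    Continuous fun x => ((Real.cos (phase L m x) : ℝ) : ℂ) :=
  Complex.continuous_ofReal.comp (Real.continuous_cos.comp (continuous_phase L m))

lemma continuous_sinC (L : ℝ) (m : Freq) :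
    Continuous fun x => ((Real.sin (phase L m x) : ℝ) : ℂ) :=
  Complex.continuous_ofReal.comp (Real.continuous_sin.comp (continuous_phase L m))

lemma fourierInt_cos (L : ℝ) (k m : Freq) :
    fourierInt L k (fun x => ((Real.cos (phase L m x) : ℝ) : ℂ)) =
      2⁻¹ * (fourierInt L k (expMode L m) + fourierInt L k (expMode L (-m))) := by
  simp_rw [cos_eq_expMode]
  rw [fourierInt_const_mul, fourierInt_add L k (continuous_expMode L m) (continuous_expMode L (-m))]

lemma fourierInt_sin (L : ℝ) (k m : Freq) :
    fourierInt L k (fun x => ((Real.sin (phase L m x) : ℝ) : ℂ)) =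
      -(2⁻¹ * Complex.I) * (fourierInt L k (expMode L m) - fourierInt L k (expMode L (-m))) := by
  simp_rw [sin_eq_expMode, sub_eq_add_neg]
  have h := fourierInt_const_mul L k (-1) (expMode L (-m))
  simp only [neg_one_mul] at h
  rw [fourierInt_const_mul, fourierInt_add L k (F' := fun x => -expMode L (-m) x)
    (continuous_expMode L m) (continuous_expMode L (-m)).neg, h]

lemma mul_fourierInt_cos {L : ℝ} (hL : 0 < L) (k m : Freq) (i : Fin 2) :
    Complex.I * k i * fourierInt L k (fun x => ((Real.cos (phase L m x) : ℝ) : ℂ)) =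
      -(m i * fourierInt L k (fun x => ((Real.sin (phase L m x) : ℝ) : ℂ))) := by
  have h1 := mul_fourierInt_expMode hL k m i
  have h2 := mul_fourierInt_expMode hL k (-m) i
  rw [Pi.neg_apply, Int.cast_neg] at h2
  rw [fourierInt_cos, fourierInt_sin]
  linear_combination (2⁻¹ * Complex.I) * h1 + (2⁻¹ * Complex.I) * h2

lemma mul_fourierInt_sin {L : ℝ} (hL : 0 < L) (k m : Freq) (i : Fin 2) :
    Complex.I * k i * fourierInt L k (fun x => ((Real.sin (phase L m x) : ℝ) : ℂ)) =
      m i * fourierInt L k (fun x => ((Real.cos (phase L m x) : ℝ) : ℂ)) := by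
  have h1 := mul_fourierInt_expMode hL k m i
  have h2 := mul_fourierInt_expMode hL k (-m) i
  rw [Pi.neg_apply, Int.cast_neg] at h2
  rw [fourierInt_cos, fourierInt_sin]
  linear_combination 2⁻¹ * h1 - 2⁻¹ * h2 - (2⁻¹ * k i * (fourierInt L k (expMode L m) -
    fourierInt L k (expMode L (-m)))) * Complex.I_sq

lemma partialDeriv_trigPoly (L : ℝ) (s : Finset Freq) (a b : Freq → Plane) (i : Fin 2) (x : Plane) :
    partialDeriv i (fun x => ∑ m ∈ s, (Real.cos (phase L m x) • a m +
      Real.sin (phase L m x) • b m)) x = ∑ m ∈ s, (2 * Real.pi / L * m i) •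
        (-(Real.sin (phase L m x) • a m) + Real.cos (phase L m x) • b m) := by
  have h := HasFDerivAt.fun_sum (u := s) (x := x)
    (A := fun m x => Real.cos (phase L m x) • a m + Real.sin (phase L m x) • b m) fun m _ =>
      (hasFDerivAt_cos L m (a m) x).add (hasFDerivAt_sin L m (b m) x)
  rw [partialDeriv, HasFDerivAt.fderiv h]
  rw [sum_apply]
  refine Finset.sum_congr rfl fun m _ => ?_
  simp only [add_apply, ContinuousLinearMap.smulRight_apply, smul_apply, phaseCLM_apply,
    phase_basisVec, smul_eq_mul, smul_add, smul_neg, smul_smul]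
  rw [← neg_smul]
  ring_nf

lemma coef_of_ae_eq {L : ℝ} {v : L2 L} {f : Plane → Plane}
    (h : v =ᵐ[volume.restrict (box L)] f) (i : Fin 2) (k : Freq) :
    coef L i k v = (L : ℂ)⁻¹ * fourierInt L k fun x => ((f x i : ℝ) : ℂ) := by
  rw [coef_eq_integral]
  congr 1
  refine integral_congr_ae ?_
  filter_upwards [h] with x hx
  rw [hx]

/-- The amplitudes `a` and `b` are not determined by `f`, since `k` and `-k` give the same functions
up to sign, so they cannot be compared one by one. Instead the Fourier integral of the divergence,
which is zero, is expanded. -/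
lemma divergence_free_trigPoly {L : ℝ} (hL : 0 < L) {f : Plane → Plane} (hf : IsTrigPoly L f)
    (hdiv : ∀ x, divergence f x = 0) (k : Freq) :
    ∑ i, (k i : ℂ) * fourierInt L k (fun x => ((f x i : ℝ) : ℂ)) = 0 := by
  obtain ⟨s, a, b, h⟩ := hf
  have hcomp (i : Fin 2) : fourierInt L k (fun x => ((f x i : ℝ) : ℂ)) = ∑ m ∈ s,
      (a m i * fourierInt L k (fun x => ((Real.cos (phase L m x) : ℝ) : ℂ)) +
        b m i * fourierInt L k (fun x => ((Real.sin (phase L m x) : ℝ) : ℂ))) := by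
    have e : (fun x => ((f x i : ℝ) : ℂ)) = fun x => ∑ m ∈ s,
        ((a m i : ℂ) * ((Real.cos (phase L m x) : ℝ) : ℂ) +
          (b m i : ℂ) * ((Real.sin (phase L m x) : ℝ) : ℂ)) := by
      funext x
      rw [h x]
      simp only [WithLp.ofLp_sum, WithLp.ofLp_add, WithLp.ofLp_smul, Finset.sum_apply, Pi.add_apply,
        Pi.smul_apply, smul_eq_mul, Complex.ofReal_sum, Complex.ofReal_add, Complex.ofReal_mul]
      refine Finset.sum_congr rfl fun m _ => ?_
      ring
    have hc (m : Freq) : Continuous fun x => (a m i : ℂ) * ((Real.cos (phase L m x) : ℝ) : ℂ) :=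
      continuous_const.mul (continuous_cosC L m)
    have hs (m : Freq) : Continuous fun x => (b m i : ℂ) * ((Real.sin (phase L m x) : ℝ) : ℂ) :=
      continuous_const.mul (continuous_sinC L m)
    have hcs (m : Freq) : Continuous fun x => (a m i : ℂ) * ((Real.cos (phase L m x) : ℝ) : ℂ) +
        (b m i : ℂ) * ((Real.sin (phase L m x) : ℝ) : ℂ) := (hc m).add (hs m)
    rw [e, fourierInt_sum L k s hcs]
    refine Finset.sum_congr rfl fun m _ => ?_
    rw [fourierInt_add L k (hc m) (hs m), fourierInt_const_mul, fourierInt_const_mul]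
  have hzero : fourierInt L k (fun x => ∑ i, ∑ m ∈ s, ((m i * b m i : ℂ) *
      ((Real.cos (phase L m x) : ℝ) : ℂ) + (-(m i * a m i) : ℂ) *
        ((Real.sin (phase L m x) : ℝ) : ℂ))) = 0 := by
    have hpi : (2 * Real.pi / L : ℝ) ≠ 0 := by positivity
    have e (x : Plane) : ∑ i, ∑ m ∈ s, ((m i * b m i : ℂ) * ((Real.cos (phase L m x) : ℝ) : ℂ) +
        (-(m i * a m i) : ℂ) * ((Real.sin (phase L m x) : ℝ) : ℂ)) = 0 := by
      have h1 := hdiv x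
      rw [divergence, funext h] at h1
      simp_rw [partialDeriv_trigPoly] at h1
      have h2 : (2 * Real.pi / L) * ∑ i : Fin 2, ∑ m ∈ s, ((m i * b m i : ℝ) *
          (Real.cos (phase L m x)) + (-(m i * a m i) : ℝ) * (Real.sin (phase L m x))) = 0 := by
        rw [← h1, Finset.mul_sum]
        refine Finset.sum_congr rfl fun i _ => ?_
        simp only [WithLp.ofLp_sum, WithLp.ofLp_add, WithLp.ofLp_neg, WithLp.ofLp_smul,
          Finset.sum_apply, Pi.add_apply, Pi.neg_apply, Pi.smul_apply, smul_eq_mul, Finset.mul_sum]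
        refine Finset.sum_congr rfl fun m _ => ?_
        ring
      have h3 := (mul_eq_zero.mp h2).resolve_left hpi
      exact_mod_cast congrArg (fun r : ℝ => (r : ℂ)) h3
    simp_rw [e]
    simp [fourierInt]
  have hc (i : Fin 2) (m : Freq) : Continuous fun x =>
      (m i * b m i : ℂ) * ((Real.cos (phase L m x) : ℝ) : ℂ) :=
    continuous_const.mul (continuous_cosC L m)
  have hs (i : Fin 2) (m : Freq) : Continuous fun x =>
      (-(m i * a m i) : ℂ) * ((Real.sin (phase L m x) : ℝ) : ℂ) :=
    continuous_const.mul (continuous_sinC L m)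
  have hcs (i : Fin 2) (m : Freq) : Continuous fun x =>
      (m i * b m i : ℂ) * ((Real.cos (phase L m x) : ℝ) : ℂ) +
        (-(m i * a m i) : ℂ) * ((Real.sin (phase L m x) : ℝ) : ℂ) := (hc i m).add (hs i m)
  rw [fourierInt_sum L k Finset.univ fun i => continuous_finsetSum s fun m _ => hcs i m] at hzero
  have hfin : Complex.I * ∑ i, (k i : ℂ) * fourierInt L k (fun x => ((f x i : ℝ) : ℂ)) = 0 := by
    rw [← hzero, Finset.mul_sum]
    refine Finset.sum_congr rfl fun i _ => ?_
    rw [hcomp, fourierInt_sum L k s (hcs i), Finset.mul_sum,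
      Finset.mul_sum]
    refine Finset.sum_congr rfl fun m _ => ?_
    rw [fourierInt_add L k (hc i m) (hs i m), fourierInt_const_mul, fourierInt_const_mul]
    have h1 := mul_fourierInt_cos hL k m i
    have h2 := mul_fourierInt_sin hL k m i
    linear_combination (a m i : ℂ) * h1 + (b m i : ℂ) * h2
  exact (mul_eq_zero.mp hfin).resolve_left Complex.I_ne_zero

/-- Elements of `H` are divergence free. -/
lemma pair_freqVec {L : ℝ} (hL : 0 < L) (u : H L) (k : Freq) : pair L k (freqVec k) u = 0 := by
  have hK : IsClosed ((LinearMap.ker (pair L k (freqVec k)).toLinearMap : Submodule ℝ (L2 L)) :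
      Set (L2 L)) := (pair L k (freqVec k)).isClosed_ker
  refine H_le_of_forall hK (fun v hv => ?_) u.2
  obtain ⟨f, hf, hdiv, -, hvf⟩ := hv
  change pair L k (freqVec k) v = 0
  have := divergence_free_trigPoly hL hf hdiv k
  rw [Fin.sum_univ_two] at this
  rw [pair_apply, coef_of_ae_eq hvf, coef_of_ae_eq hvf]
  have e0 : freqVec k 0 = k 0 := rfl
  have e1 : freqVec k 1 = k 1 := rfl
  rw [e0, e1]
  push_cast
  linear_combination (L : ℂ)⁻¹ * this

/-- Elements of `H` have mean zero. -/
lemma coef_zero {L : ℝ} (u : H L) (i : Fin 2) : coef L i 0 u = 0 := by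
  have hK : IsClosed ((LinearMap.ker (coef L i 0).toLinearMap : Submodule ℝ (L2 L)) :
      Set (L2 L)) := (coef L i 0).isClosed_ker
  refine H_le_of_forall hK (fun v hv => ?_) u.2
  obtain ⟨f, hf, -, hmean, hvf⟩ := hv
  change coef L i 0 v = 0
  have hint : Integrable f (volume.restrict (box L)) :=
    ((Lp.memLp v).integrable (by norm_num)).congr hvf
  have h1 := (EuclideanSpace.proj i : Plane →L[ℝ] ℝ).integral_comp_comm hint
  rw [hmean, map_zero] at h1
  have h2 : ∫ x in box L, ((f x i : ℝ) : ℂ) = 0 := by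
    rw [integral_complex_ofReal]
    exact_mod_cast h1
  rw [coef_of_ae_eq hvf, fourierInt]
  have e (x : Plane) : expMode L (-0) x = 1 := by simp [expMode, phase_zero]
  simp_rw [e, one_mul]
  rw [h2, mul_zero]

/-- The Fourier coefficients of an element of `H` are multiples of `perp k`. -/
lemma coef_eq_perp_mul {L : ℝ} (hL : 0 < L) (u : H L) (i : Fin 2) (k : Freq) :
    coef L i k u = perp k i * pair L k (perp k) u := by
  by_cases hk : k = 0
  · subst hk; rw [coef_zero, perp_zero]; simp
  have hn : (‖freqVec k‖ : ℂ) ≠ 0 := by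
    have := one_le_norm_freqVec hk
    exact_mod_cast (by linarith : ‖freqVec k‖ ≠ 0)
  have hs : (‖freqVec k‖ : ℂ) ^ 2 = (k 0 : ℂ) ^ 2 + (k 1 : ℂ) ^ 2 := by
    exact_mod_cast congrArg (fun r : ℝ => (r : ℂ)) (norm_sq_freqVec k)
  have hd := pair_freqVec hL u k
  rw [pair_apply] at hd ⊢
  have f0 : freqVec k 0 = k 0 := rfl
  have f1 : freqVec k 1 = k 1 := rfl
  have e0 : perp k 0 = ‖freqVec k‖⁻¹ * -(k 1 : ℝ) := rfl
  have e1 : perp k 1 = ‖freqVec k‖⁻¹ * (k 0 : ℝ) := rfl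
  rw [f0, f1] at hd
  push_cast at hd
  -- For `k ≠ 0`, `perp k` and the normalized `freqVec k` form an orthonormal basis. The claim is
  -- the expansion of the coefficient vector in it: `hd` kills the longitudinal part, `hi` is the
  -- normalization.
  have hi : (‖freqVec k‖ : ℂ)⁻¹ ^ 2 * ((k 0 : ℂ) ^ 2 + (k 1 : ℂ) ^ 2) = 1 := by
    rw [← hs, ← mul_pow, inv_mul_cancel₀ hn, one_pow]
  fin_cases i
  · simp only [Fin.zero_eta, e0, e1]
    push_cast
    linear_combination (-(coef L 0 k u)) * hi + (‖freqVec k‖ : ℂ)⁻¹ ^ 2 * (k 0) * hd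
  · simp only [Fin.mk_one, e0, e1]
    push_cast
    linear_combination (-(coef L 1 k u)) * hi + (‖freqVec k‖ : ℂ)⁻¹ ^ 2 * (k 1) * hd

lemma abs_perp_le (k : Freq) (i : Fin 2) : |perp k i| ≤ 1 :=
  (PiLp.norm_apply_le (perp k) i).trans (norm_perp_le k)

lemma norm_pair_perp_le (L : ℝ) (k : Freq) (v : L2 L) :
    ‖pair L k (perp k) v‖ ≤ ‖coef L 0 k v‖ + ‖coef L 1 k v‖ := by
  rw [pair_apply]
  refine (norm_add_le _ _).trans (add_le_add ?_ ?_) <;>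
  · rw [norm_mul, Complex.norm_real]
    exact mul_le_of_le_one_left (norm_nonneg _) (abs_perp_le k _)

lemma sum_pair_sq_le {L : ℝ} (hL : 0 < L) (v : L2 L) (s : Finset Freq) :
    ∑ k ∈ s, ‖pair L k (perp k) v‖ ^ 2 ≤ (2 * (‖comp L 0‖ + ‖comp L 1‖) * ‖v‖) ^ 2 := by
  have hb (i : Fin 2) : ∑ k ∈ s, ‖coef L i k v‖ ^ 2 ≤ (‖comp L i‖ * ‖v‖) ^ 2 :=
    ((orthonormal_expLp hL).sum_inner_products_le (x := comp L i v)).trans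
      (pow_le_pow_left₀ (norm_nonneg _) ((comp L i).le_opNorm v) 2)
  have hle : ∑ k ∈ s, ‖pair L k (perp k) v‖ ^ 2 ≤
      ∑ k ∈ s, (2 * ‖coef L 0 k v‖ ^ 2 + 2 * ‖coef L 1 k v‖ ^ 2) := by
    refine Finset.sum_le_sum fun k _ => ?_
    have h1 := pow_le_pow_left₀ (norm_nonneg _) (norm_pair_perp_le L k v) 2
    nlinarith [sq_nonneg (‖coef L 0 k v‖ - ‖coef L 1 k v‖)]
  rw [Finset.sum_add_distrib, ← Finset.mul_sum, ← Finset.mul_sum] at hle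
  have h0 := hb 0
  have h1 := hb 1
  have h2 : 0 ≤ ‖comp L 0‖ * ‖v‖ := by positivity
  have h3 : 0 ≤ ‖comp L 1‖ * ‖v‖ := by positivity
  nlinarith

/-! ### The Navier-Stokes equation in Fourier space -/

/-- The sequence of solenoidal Fourier coefficients of a vector field. -/
def toSeq {L : ℝ} (hL : 0 < L) : L2 L →L[ℝ] Seq :=
  LinearMap.mkContinuous
    ⟨⟨fun v => ⟨fun k => pair L k (perp k) v, memℓp_gen <| by
        simpa using summable_of_sum_le (fun k => sq_nonneg _) (sum_pair_sq_le hL v)⟩,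
      fun v w => by ext k; exact map_add (pair L k (perp k)) v w⟩,
      fun r v => by ext k; exact map_smul (pair L k (perp k)) r v⟩
    (2 * (‖comp L 0‖ + ‖comp L 1‖)) fun v => by
      apply le_of_sq_le_sq _ (by positivity)
      rw [norm_sq_eq_tsum]
      have h := sum_pair_sq_le hL v
      exact (summable_of_sum_le (fun k => sq_nonneg _) h).tsum_le_of_sum_le h

lemma toSeq_apply {L : ℝ} (hL : 0 < L) (v : L2 L) (k : Freq) :
    toSeq hL v k = pair L k (perp k) v := rfl

lemma pair_perp_zero (L : ℝ) (v : L2 L) : pair L 0 (perp 0) v = 0 := by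
  rw [pair_apply, perp_zero]; simp

lemma toSeq_neg {L : ℝ} (hL : 0 < L) (v : L2 L) (k : Freq) :
    toSeq hL v (-k) = -conj (toSeq hL v k) := by
  rw [toSeq_apply, toSeq_apply, perp_neg, pair_neg_left, pair_neg_freq]

/-- The Leray projection does not change the pairing with solenoidal trigonometric polynomials. -/
lemma integral_inner_leray {L : ℝ} {φ : Plane → Plane} (hc : Continuous φ) {C : ℝ}
    (hC : ∀ x, ‖φ x‖ ≤ C) (ht : IsTrigPoly L φ) (hd : ∀ x, divergence φ x = 0)
    (hm : ∫ x in box L, φ x = 0) (l : L2 L) :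
    ∫ x in box L, inner ℝ ((leray L l : L2 L) x) (φ x) = ∫ x in box L, inner ℝ (l x) (φ x) := by
  let F : Plane →ᵇ Plane := BoundedContinuousFunction.ofNormedAddCommGroup φ hc C hC
  let Φ : L2 L := BoundedContinuousFunction.toLp 2 (volume.restrict (box L)) ℝ F
  have hΦ : Φ =ᵐ[volume.restrict (box L)] φ :=
    BoundedContinuousFunction.coeFn_toLp 2 (volume.restrict (box L)) ℝ F
  have hmem : Φ ∈ H L := Submodule.le_topologicalClosure _
    (Submodule.subset_span ⟨φ, ht, hd, hm, hΦ⟩)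
  have h := Submodule.inner_orthogonalProjectionOnto_eq_of_mem_left (K := H L) ⟨Φ, hmem⟩ l
  change inner ℝ Φ (leray L l : L2 L) = inner ℝ Φ l at h
  have e (w : L2 L) : inner ℝ Φ w = ∫ x in box L, inner ℝ (w x) (φ x) := by
    rw [L2.inner_def]
    refine integral_congr_ae ?_
    filter_upwards [hΦ] with x hx
    rw [hx, real_inner_comm]
  rwa [e, e] at h

lemma integral_cos_sin {L : ℝ} (hL : 0 < L) {k : Freq} (hk : k ≠ 0) :
    ∫ x in box L, Real.cos (phase L k x) = 0 ∧ ∫ x in box L, Real.sin (phase L k x) = 0 := by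
  have hi : Integrable (expMode L k) (volume.restrict (box L)) :=
    integrable_box_of_continuous L (continuous_expMode L k)
  have h := integral_expMode hL k
  rw [if_neg hk] at h
  have h1 := Complex.reCLM.integral_comp_comm hi
  have h2 := Complex.imCLM.integral_comp_comm hi
  rw [h] at h1 h2
  constructor
  · rw [map_zero] at h1
    rw [← h1]
    congr 1; funext x
    simp only [Complex.reCLM_apply, expMode, Complex.exp_ofReal_mul_I_re]
  · rw [map_zero] at h2
    rw [← h2]
    congr 1; funext x
    simp only [Complex.imCLM_apply, expMode, Complex.exp_ofReal_mul_I_im]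

lemma perp_divergence (k : Freq) (r c : ℝ) : ∑ i, (r • ((c * k i) • perp k)) i = 0 := by
  have h := inner_perp_self k
  rw [inner_plane] at h
  have f0 : freqVec k 0 = k 0 := rfl
  have f1 : freqVec k 1 = k 1 := rfl
  rw [f0, f1] at h
  simp only [PiLp.smul_apply, smul_eq_mul, Fin.sum_univ_two]
  linear_combination r * c * h

lemma pair_perp_leray {L : ℝ} (hL : 0 < L) (k : Freq) (l : L2 L) :
    pair L k (perp k) (leray L l) = pair L k (perp k) l := by
  by_cases hk : k = 0
  · subst hk; rw [pair_perp_zero, pair_perp_zero]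
  obtain ⟨hc0, hs0⟩ := integral_cos_sin hL hk
  have hbd (r : ℝ) (hr : |r| ≤ 1) : ‖r • perp k‖ ≤ 1 := by
    rw [norm_smul]; exact mul_le_one₀ hr (norm_nonneg _) (norm_perp_le k)
  rw [pair_eq, pair_eq, integral_inner_leray (contDiff_cos L k (perp k)).continuous
    (fun x => hbd _ (Real.abs_cos_le_one _)) ⟨{k}, fun _ => perp k, 0, fun x => by simp⟩ ?_ ?_,
    integral_inner_leray (contDiff_sin L k (perp k)).continuous
    (fun x => hbd _ (Real.abs_sin_le_one _)) ⟨{k}, 0, fun _ => perp k, fun x => by simp⟩ ?_ ?_]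
  · intro x
    simp_rw [divergence, partialDeriv_sin]
    exact perp_divergence k _ _
  · rw [integral_smul_const, hs0, zero_smul]
  · intro x
    simp_rw [divergence, partialDeriv_cos, ← neg_mul]
    exact perp_divergence k _ _
  · rw [integral_smul_const, hc0, zero_smul]

lemma pair_basisVec (L : ℝ) (k : Freq) (m : Fin 2) (v : L2 L) :
    pair L k (basisVec m) v = coef L m k v := by
  rw [pair_apply]; fin_cases m <;> simp [basisVec]

/-- The Stokes operator in Fourier space. -/
lemma pair_stokes {L : ℝ} (hL : 0 < L) {u f : H L} (h : IsStokes L u f) (k : Freq) :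
    pair L k (perp k) f = (((2 * Real.pi / L) ^ 2 * ‖freqVec k‖ ^ 2 : ℝ) : ℂ) *
      pair L k (perp k) u := by
  obtain ⟨l, hl, rfl⟩ := h
  rw [Submodule.coe_neg, map_neg, pair_perp_leray hL, pair_weakLaplacian hL hl]
  push_cast; ring

/-- Since `perp l` is orthogonal to `l`, the frequency `k` may be replaced by `k - l`. This
identifies the divergence form, suited to estimates, with the convective form that the transform of
`(u · ∇)v` produces. -/
lemma kernel_eq (κ : ℝ) (k l : Freq) : kernel κ k l = κ * Complex.I *
    ((perp l 0 * (k - l) 0 + perp l 1 * (k - l) 1) *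
      (perp k 0 * perp (k - l) 0 + perp k 1 * perp (k - l) 1)) := by
  have h : inner ℝ (perp l) (freqVec k) = inner ℝ (perp l) (freqVec (k - l)) := by
    rw [freqVec_sub, inner_sub_right, inner_perp_self, sub_zero]
  have f0 : freqVec (k - l) 0 = (k - l) 0 := rfl
  have f1 : freqVec (k - l) 1 = (k - l) 1 := rfl
  rw [kernel, h, inner_plane, inner_plane, f0, f1]
  push_cast; ring

/-- The Fourier coefficients of the product of a component of an element of `H` with a
square-integrable function. -/
lemma exists_product_expansion {L : ℝ} (hL : 0 < L) (u : H L) (D : L2 L) (i m : Fin 2) (k : Freq) :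
    Integrable (fun x => expMode L (-k) x * (((u : L2 L) x i : ℝ) * (D x m : ℝ)))
      (volume.restrict (box L)) ∧
    HasSum (fun l => coef L i l u * coef L m (k - l) D)
      (∫ x in box L, expMode L (-k) x * (((u : L2 L) x i : ℝ) * (D x m : ℝ))) := by
  have hmem : MemLp (fun x => expMode L k x * comp L m D x) 2 (volume.restrict (box L)) :=
    (Lp.memLp (comp L m D)).of_le
      ((continuous_expMode L k).aestronglyMeasurable.mul (Lp.aestronglyMeasurable _))
      (Filter.Eventually.of_forall fun x => by rw [norm_mul, norm_expMode, one_mul])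
  -- The integral is the inner product of `Ψ` with a component of `u`, so only `u` has to be
  -- expanded in exponentials and `D` may be any square-integrable field.
  set Ψ : Lp ℂ 2 (volume.restrict (box L)) := hmem.toLp _ with hΨ
  have hΨx : Ψ =ᵐ[volume.restrict (box L)] fun x => expMode L k x * ((D x m : ℝ) : ℂ) := by
    filter_upwards [hmem.coeFn_toLp, coeFn_comp L m D] with x h1 h2
    rw [h1, h2]
  have hae : (fun x => inner ℂ (Ψ x) (comp L i u x)) =ᵐ[volume.restrict (box L)]
      fun x => expMode L (-k) x * (((u : L2 L) x i : ℝ) * (D x m : ℝ)) := by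
    filter_upwards [hΨx, coeFn_comp L i u] with x h1 h2
    rw [h1, h2, RCLike.inner_apply, map_mul, conj_expMode, Complex.conj_ofReal]; ring
  have hin (l : Freq) : inner ℂ Ψ (expLp L l) = coef L m (k - l) D := by
    rw [L2.inner_def, coef_eq_integral, ← integral_const_mul]
    refine integral_congr_ae ?_
    filter_upwards [hΨx, coeFn_expLp L l] with x h1 h2
    rw [h1, h2, RCLike.inner_apply, map_mul, conj_expMode, Complex.conj_ofReal,
      show -(k - l) = -k + l by abel, ← expMode_mul]; ring
  refine ⟨(L2.integrable_inner Ψ (comp L i u)).congr hae, ?_⟩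
  rw [← integral_congr_ae hae, ← L2.inner_def]
  have h := (hasSum_coef hL u i).mapL (innerSL ℂ Ψ)
  simp only [map_smul, smul_eq_mul, innerSL_apply_apply, hin] at h
  exact h

/-- The Navier-Stokes nonlinearity in Fourier space. -/
lemma pair_bilin {L : ℝ} (hL : 0 < L) {u v b : H L} (h : IsBilin L u v b) (k : Freq) :
    pair L k (perp k) b = bil (2 * Real.pi / L / L) k (toSeq hL u) (toSeq hL v) := by
  obtain ⟨D, w, hD, hw, rfl⟩ := h
  -- The factor `L⁻¹` comes from the normalization of the exponentials and accounts for the second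
  -- division by `L` in the constant of `bil`.
  have hcoef (m : Fin 2) : HasSum (fun l => (L : ℂ)⁻¹ * (coef L 0 l u * coef L m (k - l) (D 0) +
      coef L 1 l u * coef L m (k - l) (D 1))) (coef L m k w) := by
    obtain ⟨i0, s0⟩ := exists_product_expansion hL u (D 0) 0 m k
    obtain ⟨i1, s1⟩ := exists_product_expansion hL u (D 1) 1 m k
    have e : coef L m k w = (L : ℂ)⁻¹ *
        ((∫ x in box L, expMode L (-k) x * (((u : L2 L) x 0 : ℝ) * (D 0 x m : ℝ))) +
          ∫ x in box L, expMode L (-k) x * (((u : L2 L) x 1 : ℝ) * (D 1 x m : ℝ))) := by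
      rw [coef_eq_integral, ← integral_add i0 i1]
      congr 1
      refine integral_congr_ae ?_
      filter_upwards [hw] with x hx
      rw [hx]
      simp only [Fin.sum_univ_two, PiLp.add_apply, PiLp.smul_apply, smul_eq_mul]
      push_cast; ring
    rw [e]
    exact (s0.add s1).mul_left _
  have hd (i m : Fin 2) (l : Freq) : coef L m (k - l) (D i) =
      ((2 * Real.pi / L * (k - l) i : ℝ) : ℂ) * Complex.I *
        (perp (k - l) m * toSeq hL v (k - l)) := by
    rw [← pair_basisVec, pair_weakPartial hL (hD i), pair_basisVec, coef_eq_perp_mul hL v]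
    rfl
  rw [pair_perp_leray hL, pair_apply]
  have hs := ((hcoef 0).mul_left (perp k 0 : ℂ)).add ((hcoef 1).mul_left (perp k 1 : ℂ))
  rw [← hs.tsum_eq, bil]
  refine tsum_congr fun l => ?_
  rw [hd, hd, hd, hd, coef_eq_perp_mul hL u, coef_eq_perp_mul hL u, kernel_eq]
  simp only [← toSeq_apply hL]
  push_cast
  ring

/-- The Fourier coefficients of a solution of the Navier-Stokes equation. -/
lemma IsSolution.exists_isFlow {L ν : ℝ} (hL : 0 < L) {g : H L} {u : ℝ → H L}
    (h : IsSolution L ν g u) : ∃ W, IsFlow (2 * Real.pi / L / L) (ν * (2 * Real.pi / L) ^ 2)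
      (toSeq hL g) (fun t => toSeq hL (u t)) W := by
  choose a b ha hb hd using h
  refine ⟨fun t => toSeq hL (g - ν • a t - b t : H L), ⟨fun t => ?_, fun t k => ?_, fun t => ?_,
    fun t k => toSeq_neg hL _ k, fun t => ?_⟩⟩
  · have h1 : HasDerivAt (fun t => (u t : L2 L)) ((g - ν • a t - b t : H L) : L2 L) t :=
      (H L).subtypeL.hasFDerivAt.comp_hasDerivAt t (hd t)
    exact (toSeq hL).hasFDerivAt.comp_hasDerivAt t h1
  · have e1 := pair_stokes hL (ha t) k
    have e2 := pair_bilin hL (hb t) k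
    rw [← e2]
    rw [toSeq_apply, toSeq_apply, toSeq_apply, Submodule.coe_sub, Submodule.coe_sub,
      Submodule.coe_smul, map_sub, map_sub, map_smul, e1, Complex.real_smul]
    push_cast; ring
  · exact pair_perp_zero L _
  -- Regularity comes from `A u ∈ H`: its coefficients are those of `u` times a multiple of `|k|²`.
  · have hs := (summable_norm_sq (toSeq hL (a t))).mul_left (((2 * Real.pi / L) ^ 2)⁻¹ ^ 2)
    refine hs.congr fun k => ?_
    have hc : (0 : ℝ) < (2 * Real.pi / L) ^ 2 := by positivity
    rw [← mul_pow, toSeq_apply, pair_stokes hL (ha t), norm_mul, Complex.norm_real,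
      Real.norm_of_nonneg (by positivity), toSeq_apply]
    by_cases hk : k = 0
    · subst hk; rw [pair_perp_zero]; simp
    · rw [wt_eq hk]
      congr 1
      field_simp

/-! ### Smoothness of rapidly decreasing Fourier series -/

lemma iteratedDeriv_exp_mul_I (n : ℕ) :
    iteratedDeriv n (fun t : ℝ => Complex.exp (t * Complex.I)) =
      fun t : ℝ => Complex.I ^ n * Complex.exp (t * Complex.I) := by
  induction n with
  | zero => simp
  | succ n ih =>
    rw [iteratedDeriv_succ, ih]
    funext t
    have h1 : HasDerivAt (fun t : ℝ => (t : ℂ) * Complex.I) Complex.I t := by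
      simpa using (Complex.ofRealCLM.hasDerivAt (x := t)).mul_const Complex.I
    have h2 := (h1.cexp.const_mul (Complex.I ^ n)).deriv
    rw [h2]; ring

lemma contDiff_exp_mul_I : ContDiff ℝ ∞ fun t : ℝ => Complex.exp (t * Complex.I) :=
  (Complex.ofRealCLM.contDiff.mul contDiff_const).cexp

lemma expMode_eq_comp (L : ℝ) (k : Freq) :
    expMode L k = (fun t : ℝ => Complex.exp (t * Complex.I)) ∘ phaseCLM L k := by
  funext x; rw [Function.comp, phaseCLM_apply, expMode]

lemma contDiff_expMode (L : ℝ) (k : Freq) : ContDiff ℝ ∞ (expMode L k) := by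
  rw [expMode_eq_comp]; exact contDiff_exp_mul_I.comp (phaseCLM L k).contDiff

lemma norm_phaseCLM_le {L : ℝ} (hL : 0 < L) (k : Freq) :
    ‖phaseCLM L k‖ ≤ 2 * Real.pi / L * wt k := by
  rw [phaseCLM, norm_smul, Real.norm_of_nonneg (by positivity), innerSL_apply_norm]
  exact mul_le_mul_of_nonneg_left (norm_freqVec_le_wt k) (by positivity)

lemma norm_iteratedFDeriv_expMode_le {L : ℝ} (hL : 0 < L) (k : Freq) (n : ℕ) (x : Plane) :
    ‖iteratedFDeriv ℝ n (expMode L k) x‖ ≤ (2 * Real.pi / L * wt k) ^ n := by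
  rw [expMode_eq_comp, ContinuousLinearMap.iteratedFDeriv_comp_right _ contDiff_exp_mul_I x
    (i := n) (by exact_mod_cast le_top)]
  refine (ContinuousMultilinearMap.norm_compContinuousLinearMap_le _ _).trans ?_
  rw [norm_iteratedFDeriv_eq_norm_iteratedDeriv, iteratedDeriv_exp_mul_I, norm_mul, norm_pow,
    Complex.norm_I, one_pow, Complex.norm_exp_ofReal_mul_I, one_mul, one_mul, Finset.prod_const,
    Finset.card_univ, Fintype.card_fin]
  exact pow_le_pow_left₀ (norm_nonneg _) (norm_phaseCLM_le hL k) n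

/-- Rapidly decreasing Fourier series are smooth. -/
lemma contDiff_tsum_expMode {L : ℝ} (hL : 0 < L) {c : Freq → ℂ}
    (hc : ∀ b : ℕ, ∃ C, ∀ k, ‖c k‖ ≤ C * wt k ^ (-(b : ℝ))) :
    ContDiff ℝ ∞ fun x => ∑' k, c k * expMode L k x := by
  have hsum (n : ℕ) : Summable fun k => ‖c k‖ * (2 * Real.pi / L * wt k) ^ n := by
    -- Differentiating `n` times costs `wt k ^ n`; three more powers ensure summability over the
    -- two-dimensional lattice.
    obtain ⟨C, hC⟩ := hc (n + 3)
    have hs := (summable_wt_rpow (p := 3) (by norm_num)).mul_left ((2 * Real.pi / L) ^ n * C)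
    refine Summable.of_nonneg_of_le (fun k => by have := wt_pos k; positivity) (fun k => ?_) hs
    have e : wt k ^ (-((n + 3 : ℕ) : ℝ)) * wt k ^ n = wt k ^ (-3 : ℝ) := by
      rw [← Real.rpow_natCast (wt k) n, ← Real.rpow_add (wt_pos k)]
      push_cast; ring_nf
    have hw := wt_pos k
    calc _ = (2 * Real.pi / L) ^ n * (‖c k‖ * wt k ^ n) := by rw [mul_pow]; ring
      _ ≤ (2 * Real.pi / L) ^ n * (C * wt k ^ (-((n + 3 : ℕ) : ℝ)) * wt k ^ n) := by
          have := hC k; gcongr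
      _ = _ := by rw [mul_assoc C, e]; ring
  refine contDiff_tsum (N := ⊤) (v := fun n k => ‖c k‖ * (2 * Real.pi / L * wt k) ^ n)
    (fun k => contDiff_const.mul (contDiff_expMode L k)) (fun n _ => hsum n) fun n k x _ => ?_
  have : (fun x => c k * expMode L k x) = c k • expMode L k := rfl
  rw [this, iteratedFDeriv_const_smul_apply ((contDiff_expMode L k).contDiffAt.of_le
    (by exact_mod_cast le_top)), norm_smul]
  exact mul_le_mul_of_nonneg_left (norm_iteratedFDeriv_expMode_le hL k n x) (norm_nonneg _)

lemma expMode_add_period {L : ℝ} (hL : 0 < L) (k : Freq) (i : Fin 2) (x : Plane) :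
    expMode L k (x + L • basisVec i) = expMode L k x := by
  simp only [expMode_eq, phase_add_period hL, Real.cos_add_int_mul_two_pi,
    Real.sin_add_int_mul_two_pi]

/-- A component of an element of `H` with summable Fourier coefficients is the sum of its
Fourier series. -/
lemma comp_ae_eq_tsum {L : ℝ} (hL : 0 < L) (u : H L) (i : Fin 2)
    (hs : Summable fun k => ‖coef L i k u‖) :
    comp L i u =ᵐ[volume.restrict (box L)]
      fun x => ∑' k, coef L i k u * ((L : ℂ)⁻¹ * expMode L k x) := by
  have hn (k : Freq) : ‖expBCF L k‖ ≤ |L|⁻¹ :=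
    BoundedContinuousFunction.norm_ofNormedAddCommGroup_le _ (by positivity) _
  have hsB : Summable fun k => coef L i k u • expBCF L k := by
    refine Summable.of_norm_bounded (hs.mul_right |L|⁻¹) fun k => ?_
    rw [norm_smul]
    exact mul_le_mul_of_nonneg_left (hn k) (norm_nonneg _)
  have h1 := hsB.hasSum.mapL (BoundedContinuousFunction.toLp 2 (volume.restrict (box L)) ℂ)
  simp only [map_smul] at h1
  -- The series converges uniformly and, by the expansion in `H`, also in `L²`; the two sums agree
  -- there by uniqueness of limits.
  have h2 := (hasSum_coef hL u i).unique h1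
  rw [h2]
  refine (BoundedContinuousFunction.coeFn_toLp 2 (volume.restrict (box L)) ℂ _).trans
    (Filter.Eventually.of_forall fun x => ?_)
  have h3 := hsB.hasSum.mapL (BoundedContinuousFunction.evalCLM ℂ x)
  exact h3.tsum_eq.symm

/-- Elements of `H` with rapidly decreasing Fourier coefficients are smooth. -/
lemma mem_smoothFields {L : ℝ} (hL : 0 < L) (u : H L)
    (h : ∀ b : ℕ, ∃ C, ∀ k, ‖toSeq hL u k‖ ≤ C * wt k ^ (-(b : ℝ))) : u ∈ smoothFields L := by
  have hc (i : Fin 2) (b : ℕ) : ∃ C, ∀ k, ‖coef L i k u‖ ≤ C * wt k ^ (-(b : ℝ)) := by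
    obtain ⟨C, hC⟩ := h b
    refine ⟨C, fun k => le_trans ?_ (hC k)⟩
    rw [coef_eq_perp_mul hL, norm_mul, Complex.norm_real]
    exact mul_le_of_le_one_left (norm_nonneg _) (abs_perp_le k i)
  have hs (i : Fin 2) : Summable fun k => ‖coef L i k u‖ := by
    obtain ⟨C, hC⟩ := hc i 3
    refine Summable.of_nonneg_of_le (fun _ => norm_nonneg _) (fun k => ?_)
      ((summable_wt_rpow (p := 3) (by norm_num)).mul_left C)
    exact_mod_cast hC k
  set F : Fin 2 → Plane → ℂ := fun i x => ∑' k, coef L i k u * (L : ℂ)⁻¹ * expMode L k x with hF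
  refine ⟨fun x => WithLp.toLp 2 fun i => (F i x).re, ?_, fun i x => ?_, ?_⟩
  · rw [contDiff_piLp]
    intro i
    refine Complex.reCLM.contDiff.comp (contDiff_tsum_expMode hL fun b => ?_)
    obtain ⟨C, hC⟩ := hc i b
    refine ⟨C * ‖(L : ℂ)⁻¹‖, fun k => ?_⟩
    rw [norm_mul]
    have := mul_le_mul_of_nonneg_right (hC k) (norm_nonneg (L : ℂ)⁻¹)
    linarith
  · simp only [hF, expMode_add_period hL]
  · filter_upwards [coeFn_comp L 0 (u : L2 L), coeFn_comp L 1 (u : L2 L),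
      comp_ae_eq_tsum hL u 0 (hs 0), comp_ae_eq_tsum hL u 1 (hs 1)] with x h0 h1 h2 h3
    rw [h0] at h2
    rw [h1] at h3
    ext i
    fin_cases i
    · have := congrArg Complex.re h2
      simpa [hF, mul_assoc] using this
    · have := congrArg Complex.re h3
      simpa [hF, mul_assoc] using this

end NSE2D

end

theorem corollary2p2 (L ν : ℝ) (hL : 0 < L) (hν : 0 < ν) (g : NSE2D.H L)
    (h0 : (0 : NSE2D.H L) ∈ NSE2D.attractor L ν g) :
    NSE2D.attractor L ν g ∪ {g} ⊆ NSE2D.smoothFields L := by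
  have hκ : 0 ≤ 2 * Real.pi / L / L := by positivity
  have hμ : 0 < ν * (2 * Real.pi / L) ^ 2 := by positivity
  obtain ⟨u, hu, hu0, -⟩ := h0
  obtain ⟨W, hW⟩ := NSE2D.IsSolution.exists_isFlow hL hu
  have hg := hW.force_decays hκ hμ (by rw [hu0]; exact map_zero _)
  rintro v (⟨w, hw, rfl, -⟩ | hv)
  · obtain ⟨W', hW'⟩ := NSE2D.IsSolution.exists_isFlow hL hw
    exact NSE2D.mem_smoothFields hL _ (hW'.rapidly_decreasing hκ hμ hg)
  · rw [Set.mem_singleton_iff] at hv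
    subst hv
    exact NSE2D.mem_smoothFields hL _ hg
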